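/- **Conventions.** Alphabets are finite sets. For $w\in A^*$, $|w|$ is its length, $w[i]$ its $i$-th letter and $w[i{:}j]$ the factor from position $i$ to position $j$ (empty if $j<i$). Let $\underline A$ be a disjoint underlined copy of $A$, and for $0\le i\le |w|+1$ let $w\bullet i\in (A\uplus\underline A)^*$ be $w$ in which the letter at position $i$ is underlined ($w\bullet i=w$ if $i=0$ or $i=|w|+1$). *Two-way transducers with external functions.* Such a machine has an input alphabet $A$, a finite set $Q$ of states, an initial state $q_0$, a set $F\subseteq Q$ of final states, a finite set $\mathfrak F$ of functions to $\mathbb N$ (external functions), and partial functions $\delta:Q\times(A\uplus\{\vdash,\dashv\})\to Q\times\{\triangleleft,\triangleright\}$ and $\lambda:Q\times(A\uplus\{\vdash,\dashv\})\to\mathfrak F$ with the same domain. On $w\in A^*$ the tape contains $\vdash w\dashv$, with $\vdash$ at position $0$ and $\dashv$ at position $|w|+1$. From the configuration $(q,i)$ with tape symbol $x$ at position $i$ and $\delta(q,x)=(q',\star)$ the machine moves to $(q',i-1)$ if $\star=\triangleleft$ and to $(q',i+1)$ if $\star=\triangleright$, provided that the new position lies in $\{0,\dots,|w|+1\}$.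 The accepting run is the run from $(q_0,0)$ up to the first configuration $(q,|w|+1)$ with $q\in F$, if there is one. The value of the machine on $w$ is the sum, over the transitions of the accepting run, taken from configurations $(q,i)$ with tape symbol $x$, of $\mathfrak f$ applied to $w\bullet i$ (pebble), to $w$ (blind), or to $w[1{:}\min(i,|w|)]$ (marble), where $\mathfrak f=\lambda(q,x)$; it is $0$ if there is no accepting run. External functions have domain $(A\uplus\underline A)^*$ for pebble and $A^*$ for blind and marble. If $\lambda$ takes values in $\mathbb N$ instead, and these values are summed, the machine is a two-way transducer (with unary output). *Bimachines with external functions.* Such a machine has an input alphabet $A$, a morphism $\mu:A^*\to M$ into a finite monoid, a finite set $\mathfrak F$ of functions to $\mathbb N$, and a total function $\lambda:M\times A\times M\to\mathfrak F$. It computes $f:A^+\to\mathbb N$, where, with $\mathfrak f_i:=\lambda(\mu(w[1{:}i-1]),w[i],\mu(w[i+1{:}|w|]))$, $$f(w)=\sum_{1\le i\le|w|}\mathfrak f_i(w\bullet i)\ \text{(pebble)},\qquad \sum_{1\le i\le|w|}\mathfrak f_i(w)\ \text{(blind)},\qquad \sum_{1\le i\le|w|}\mathfrak f_i(w[1{:}i])\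 \text{(marble)}.$$ External functions have domain $(A\uplus\underline A)^+$ for pebble and $A^+$ for blind and marble. If $\lambda$ takes values in $\mathbb N$ instead, and $f(w)=\sum_i\lambda(\mu(w[1{:}i-1]),w[i],\mu(w[i+1{:}|w|]))$, the machine is a bimachine (without external functions). *Levels.* A $0$-pebble (resp. $0$-blind, $0$-marble) transducer is a two-way transducer, and for $k\ge1$ a $k$-pebble (resp. $k$-blind, $k$-marble) transducer is a two-way transducer with external pebble (resp. blind, marble) functions computed by $(k-1)$-pebble (resp. $(k-1)$-blind, $(k-1)$-marble) transducers. The $k$-pebble (resp. $k$-blind, $k$-marble) bimachines are defined in the same way from bimachines. **Proposition.** For every $k\ge0$, every finite alphabet $A$ and every function $f:A^+\to\mathbb N$: $f$ is computed by a $k$-pebble (resp. $k$-blind, $k$-marble) bimachine if and only if $f$ is computed, on $A^+$, by a $k$-pebble (resp. $k$-blind, $k$-marble) transducer. Moreover both conversions are effective: for each of the three kinds there is an algorithm that, given $k$ and the explicit finite description of a $k$-bimachine (over an enumerated alphabet, with states and monoid elements numbered, given by its tables, with the machines of lower level nested in them), outputs the description of a $k$-transducer over the same alphabet which computes the same function on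 nonempty words; and there is an algorithm for the opposite direction. -/

import Mathlib

universe u v

namespace PebbleBim

/-- The three ways of calling an external function from a position of the input word. -/
inductive Mode where
  | pebble
  | blind
  | marble

/-- The alphabet read by external functions: `A` plus a disjoint underlined copy of `A` for
pebbles (`Sum.inr a` is the underlined letter `a`), and `A` itself otherwise. -/
def Mode.Ext : Mode → Type u → Type u
  | .pebble, A => A ⊕ A
  | .blind, A => A
  | .marble, A => A

/-- The word to which an external function is applied when it is called from position `i` of `w`
(the letters of `w` have positions `1, …, |w|`, the end marks have positions `0` and `|w| + 1`):
* pebble: `w` in which the letter at position `i` is underlined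
  (no letter is underlined if `i` is the position of an end mark);
* blind: `w`;
* marble: the prefix of `w` that ends at position `i`
  (empty if `i = 0`, and `w` if `i = |w| + 1`). -/
def Mode.arg {A : Type u} : (mode : Mode) → List A → ℕ → List (mode.Ext A)
  | .pebble, w, i => w.mapIdx fun j a => if j + 1 = i then Sum.inr a else Sum.inl a
  | .blind, w, _ => w
  | .marble, w, i => w.take i

/-- An enumeration of the alphabet `A` induces one of the alphabet of the external functions. -/
def Mode.extLetters {A : Type u} : (mode : Mode) → List A → List (mode.Ext A)
  | .pebble, l => l.map Sum.inl ++ l.map Sum.inr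
  | .blind, l => l
  | .marble, l => l

/-! ### Two-way transducers -/

/-- The symbols on the tape: the letters and the two end marks. -/
inductive TapeSymbol (A : Type u) where
  | leftMark
  | rightMark
  | letter (a : A)

/-- Move directions of the reading head. -/
inductive Dir where
  | left
  | right

/-- `true` for a move to the right. -/
def Dir.toBool : Dir → Bool
  | .left => false
  | .right => true

/-- A deterministic two-way transducer over `A`, whose output labels are elements of `L`
(integers, or machines that compute the external functions). The finite set of states is `Fin n`.
The partial transition function and the partial output function have the same domain; `step`
holds both. -/
structure TwoWay (A : Type u) (L : Type v) where
  n : ℕ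
  init : Fin n
  final : Finset (Fin n)
  step : Fin n → TapeSymbol A → Option ((Fin n × Dir) × L)

/-- The symbol at position `i` of the tape that contains `w` between its two end marks. -/
def tapeAt {A : Type u} (w : List A) (i : ℕ) : TapeSymbol A :=
  if i = 0 then .leftMark
  else match w[i - 1]? with
    | some a => .letter a
    | none => .rightMark

namespace TwoWay

variable {A : Type u} {L : Type v}

/-- The configuration that follows `(q, i)` on input `w`, with the label that is output by this
transition. The head may not leave the tape. -/
def next (T : TwoWay A L) (w : List A) (c : Fin T.n × ℕ) : Option ((Fin T.n × ℕ) × L) :=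
  match T.step c.1 (tapeAt w c.2) with
  | none => none
  | some ((q', .left), lab) => if c.2 = 0 then none else some ((q', c.2 - 1), lab)
  | some ((q', .right), lab) =>
      if c.2 = w.length + 1 then none else some ((q', c.2 + 1), lab)

/-- Accepting configurations: a final state on the right end mark. -/
def IsAccepting (T : TwoWay A L) (w : List A) (c : Fin T.n × ℕ) : Prop :=
  c.2 = w.length + 1 ∧ c.1 ∈ T.final

/-- `T.AcceptingRun w ν c s`: the run of `T` on `w` that starts in the configuration `c` reaches an
accepting configuration, where it ends, and the values `ν lab i` of the labels `lab` that are
output along this run, at positions `i`, have sum `s`. -/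
inductive AcceptingRun (T : TwoWay A L) (w : List A) (ν : L → ℕ → ℕ) :
    Fin T.n × ℕ → ℕ → Prop
  | halt {c : Fin T.n × ℕ} (h : T.IsAccepting w c) : AcceptingRun T w ν c 0
  | move {c c' : Fin T.n × ℕ} {lab : L} {s : ℕ} (h : ¬ T.IsAccepting w c)
      (hc : T.next w c = some (c', lab)) (hs : AcceptingRun T w ν c' s) :
      AcceptingRun T w ν c (ν lab c.2 + s)

/-- The machine is deterministic: the sum of the outputs along the accepting run is unique. -/
theorem AcceptingRun.unique {T : TwoWay A L} {w : List A} {ν : L → ℕ → ℕ}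
    {c : Fin T.n × ℕ} {s s' : ℕ} (h : T.AcceptingRun w ν c s) (h' : T.AcceptingRun w ν c s') :
    s = s' := by
  induction h generalizing s' with
  | halt h =>
    cases h' with
    | halt _ => rfl
    | move h2 _ _ => exact absurd h h2
  | move h hc _ ih =>
    cases h' with
    | halt h2 => exact absurd h2 h
    | move _ hc2 hs2 =>
      rw [hc] at hc2
      cases hc2
      rw [ih hs2]

open Classical in
/-- The value of the transducer on `w`: the sum of the values of the outputs along the accepting
run from the initial state at position `0`, and `0` if there is no accepting run. -/
noncomputable def output (T : TwoWay A L) (w : List A) (ν : L → ℕ → ℕ) : ℕ :=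
  if h : ∃ s, T.AcceptingRun w ν (T.init, 0) s then h.choose else 0

/-- The description of the transducer by a natural number, given an enumeration `letters` of the
alphabet and numbers for the labels: the number of letters, the number of states, the initial
state, the set of final states and the transition table (one row for each state; in each row, the
entries for the left mark, for the right mark and for the letters). -/
def code (letters : List A) (labelCode : L → ℕ) (T : TwoWay A L) : ℕ :=
  Encodable.encode
    (letters.length, T.n, (T.init : ℕ),
      (List.ofFn fun q : Fin T.n => decide (q ∈ T.final)),
      List.ofFn fun q : Fin T.n =>
        (TapeSymbol.leftMark :: TapeSymbol.rightMark :: letters.map TapeSymbol.letter).map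
          fun t => (T.step q t).map fun r => (((r.1.1 : ℕ), r.1.2.toBool), labelCode r.2))

end TwoWay

/-- The `k`-pebble (resp. `k`-blind, `k`-marble) transducers over the alphabet `A`. For `k ≥ 1` the
output labels are the `(k-1)`-pebble (resp. blind, marble) transducers that compute the external
functions; as there are finitely many states and tape symbols, only finitely many occur. -/
def KTransducer (mode : Mode) : ℕ → Type u → Type u
  | 0, A => TwoWay A ℕ
  | k + 1, A => TwoWay A (KTransducer mode k (mode.Ext A))

/-- The function computed by a `k`-pebble (resp. `k`-blind, `k`-marble) transducer. -/
noncomputable def KTransducer.eval (mode : Mode) :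
    (k : ℕ) → {A : Type u} → KTransducer mode k A → List A → ℕ
  | 0, A, T, w => TwoWay.output (A := A) (L := ℕ) T w fun x _ => x
  | k + 1, A, T, w =>
      TwoWay.output (A := A) (L := KTransducer mode k (mode.Ext A)) T w fun S i =>
        KTransducer.eval mode k S (mode.arg w i)

/-- The description of a `k`-pebble (resp. `k`-blind, `k`-marble) transducer by a natural number,
given an enumeration of its alphabet. -/
def KTransducer.code (mode : Mode) :
    (k : ℕ) → {A : Type u} → List A → KTransducer mode k A → ℕ
  | 0, A, letters, T => TwoWay.code (A := A) (L := ℕ) letters (fun x => x) T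
  | k + 1, A, letters, T =>
      TwoWay.code (A := A) (L := KTransducer mode k (mode.Ext A)) letters
        (fun S => KTransducer.code mode k (mode.extLetters letters) S) T

/-! ### Bimachines -/

/-- A bimachine over `A` with output labels in `L`. The finite monoid is `Fin n` with the
multiplication `mul` and the neutral element `one`; the morphism from `A*` to this monoid is given
by the images `letterImage a` of the letters, and `out` is the total output function. -/
structure Bimachine (A : Type u) (L : Type v) where
  n : ℕ
  mul : Fin n → Fin n → Fin n
  one : Fin n
  mul_assoc : ∀ x y z, mul (mul x y) z = mul x (mul y z)
  one_mul : ∀ x, mul one x = x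
  mul_one : ∀ x, mul x one = x
  letterImage : A → Fin n
  out : Fin n → A → Fin n → L

namespace Bimachine

variable {A : Type u} {L : Type v}

/-- The morphism from `A*` to the monoid of the bimachine. -/
def mu (B : Bimachine A L) (w : List A) : Fin B.n :=
  w.foldr (fun a x => B.mul (B.letterImage a) x) B.one

theorem mu_append (B : Bimachine A L) (w w' : List A) :
    B.mu (w ++ w') = B.mul (B.mu w) (B.mu w') := by
  induction w with
  | nil => exact (B.one_mul _).symm
  | cons a w ih =>
    have h : B.mu (a :: (w ++ w')) = B.mul (B.letterImage a) (B.mu (w ++ w')) := rfl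
    rw [List.cons_append, h, ih, ← B.mul_assoc]
    rfl

/-- The value of the bimachine on `w`: the sum over the positions of the letters of `w` of the
values `ν lab i` of the labels `lab` that are output there (`j : Fin w.length` stands for the
position `j + 1`). -/
def output (B : Bimachine A L) (w : List A) (ν : L → ℕ → ℕ) : ℕ :=
  ∑ j : Fin w.length,
    ν (B.out (B.mu (w.take j)) (w.get j) (B.mu (w.drop (j + 1)))) (j + 1)

/-- The description of the bimachine by a natural number, given an enumeration `letters` of the
alphabet and numbers for the labels: the number of letters, the number of elements of the monoid,
its multiplication table, its neutral element, the images of the letters, and the table of the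
output function. -/
def code (letters : List A) (labelCode : L → ℕ) (B : Bimachine A L) : ℕ :=
  Encodable.encode
    (letters.length, B.n,
      (List.ofFn fun x : Fin B.n => List.ofFn fun y : Fin B.n => (B.mul x y : ℕ)),
      (B.one : ℕ),
      letters.map (fun a => (B.letterImage a : ℕ)),
      List.ofFn fun x : Fin B.n => letters.map fun a =>
        List.ofFn fun y : Fin B.n => labelCode (B.out x a y))

end Bimachine

/-- The `k`-pebble (resp. `k`-blind, `k`-marble) bimachines over the alphabet `A`. For `k ≥ 1` the
output labels are the `(k-1)`-pebble (resp. blind, marble) bimachines that compute the external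
functions. -/
def KBimachine (mode : Mode) : ℕ → Type u → Type u
  | 0, A => Bimachine A ℕ
  | k + 1, A => Bimachine A (KBimachine mode k (mode.Ext A))

/-- The function computed by a `k`-pebble (resp. `k`-blind, `k`-marble) bimachine; only its values
on nonempty words are meaningful. -/
def KBimachine.eval (mode : Mode) :
    (k : ℕ) → {A : Type u} → KBimachine mode k A → List A → ℕ
  | 0, A, B, w => Bimachine.output (A := A) (L := ℕ) B w fun x _ => x
  | k + 1, A, B, w =>
      Bimachine.output (A := A) (L := KBimachine mode k (mode.Ext A)) B w fun S i =>
        KBimachine.eval mode k S (mode.arg w i)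

/-- The description of a `k`-pebble (resp. `k`-blind, `k`-marble) bimachine by a natural number,
given an enumeration of its alphabet. -/
def KBimachine.code (mode : Mode) :
    (k : ℕ) → {A : Type u} → List A → KBimachine mode k A → ℕ
  | 0, A, letters, B => Bimachine.code (A := A) (L := ℕ) letters (fun x => x) B
  | k + 1, A, letters, B =>
      Bimachine.code (A := A) (L := KBimachine mode k (mode.Ext A)) letters
        (fun S => KBimachine.code mode k (mode.extLetters letters) S) B

/-- `f : A⁺ → ℕ` is computed by some `k`-pebble (resp. `k`-blind, `k`-marble) transducer. -/
def TransducerComputable (mode : Mode) (k : ℕ) {A : Type u}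
    (f : {w : List A // w ≠ []} → ℕ) : Prop :=
  ∃ T : KTransducer mode k A, ∀ w, T.eval mode k w.1 = f w

/-- `f : A⁺ → ℕ` is computed by some `k`-pebble (resp. `k`-blind, `k`-marble) bimachine. -/
def BimachineComputable (mode : Mode) (k : ℕ) {A : Type u}
    (f : {w : List A // w ≠ []} → ℕ) : Prop :=
  ∃ B : KBimachine mode k A, ∀ w, B.eval mode k w.1 = f w

end PebbleBim

/-!
# Bimachines and two-way transducers with external functions are effectively equivalent

*From bimachines to transducers.* At each letter the transducer has to know the image `p` of the
prefix before it and the image `y` of the suffix after it. It computes the image of the whole word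
in a first sweep and then keeps, in its main phase, the images of the prefix before the head and of
the suffix `s` from the head on. To process a letter of image `c` it has to divide `s` by `c` on the
left. The solutions `y` of `c y = s` that are compatible with what follows are found by scanning to
the right until only one of them is left; the candidates are then traced back to the left, as in the
classical argument of Hopcroft and Ullman, and the first position at which the true one and a false
one merge is the letter from which the scan started (`Bimachine.toTwoWay`,
`Bimachine.toTwoWay_output`). Labels are converted recursively, and steps that should output nothing
call a machine without accepting runs.

*From transducers to bimachines.* An accepting run visits no configuration twice, so the value of a
transducer is a sum over the set of visited configurations (`TwoWay.output_eq_sum`). Whether a given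
configuration is visited, and whether the run is accepting, depends on the behaviour of the machine
on the prefix and on the suffix around a letter. A finite one-way automaton computes these
behaviours (`Machines.toBimachine`), and the maps on its states form the monoid of the bimachine.
The transitions taken on the left and on the right end mark are charged to the first and to the last
letter. Many transitions may be charged to one letter, while a bimachine outputs a single label
there; the induction on the level therefore converts finite lists of transducers to one bimachine
that computes the sum of their values (`KBimachine.ofList`, `KBimachine.eval_ofList`). Moreover, a
transition on an end mark calls its external function with an argument that a call from the first or
last letter does not yield directly: in the pebble case without the underlining, in the marble case
on the left mark with the empty word. So each transducer in a list comes with a substitution of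
letters, or with the instruction to read the empty word (`Mode.extSubst`, `Mode.substWord_arg`).

*Effectiveness.* All constructions are functions on natural numbers that describe states, tables and
behaviours, and they are primitive recursive. The recursion on the level is primitive recursive
since the value at level `k + 1` depends on a computable finite list of values at level `k`
(`Prim.levelRec`). The descriptions that the numerical functions produce are those of the machines
constructed above (`KBimachine.code_toTransducer`, `KTransducer.code_toBimachine`).
-/

universe w

namespace PebbleBim

/-! ### Primitive recursive functions in compositional form -/

-- With this tag and the lemmas below, `fun_prop` proves primitive recursiveness along the structure
-- of a term.
attribute [fun_prop] Primrec

namespace Prim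

variable {α β γ σ : Type*} [Primcodable α] [Primcodable β] [Primcodable γ] [Primcodable σ]

@[fun_prop] theorem id' : Primrec fun x : α => x := Primrec.id

@[fun_prop] theorem const' (b : β) : Primrec fun _ : α => b := Primrec.const b

@[fun_prop] theorem comp' {f : β → γ} {g : α → β} (hf : Primrec f) (hg : Primrec g) :
    Primrec fun x => f (g x) := hf.comp hg

@[fun_prop] theorem mk {f : α → β} {g : α → γ} (hf : Primrec f) (hg : Primrec g) :
    Primrec fun x => (f x, g x) := hf.pair hg

@[fun_prop] theorem fst {f : α → β × γ} (hf : Primrec f) : Primrec fun x => (f x).1 :=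
  Primrec.fst.comp hf

@[fun_prop] theorem snd {f : α → β × γ} (hf : Primrec f) : Primrec fun x => (f x).2 :=
  Primrec.snd.comp hf

section Nat

variable {f g : α → ℕ}

@[fun_prop] theorem add (hf : Primrec f) (hg : Primrec g) : Primrec fun x => f x + g x :=
  Primrec.nat_add.comp hf hg

@[fun_prop] theorem sub (hf : Primrec f) (hg : Primrec g) : Primrec fun x => f x - g x :=
  Primrec.nat_sub.comp hf hg

@[fun_prop] theorem mul (hf : Primrec f) (hg : Primrec g) : Primrec fun x => f x * g x :=
  Primrec.nat_mul.comp hf hg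

@[fun_prop] theorem div (hf : Primrec f) (hg : Primrec g) : Primrec fun x => f x / g x :=
  Primrec.nat_div.comp hf hg

@[fun_prop] theorem mod (hf : Primrec f) (hg : Primrec g) : Primrec fun x => f x % g x :=
  Primrec.nat_mod.comp hf hg

@[fun_prop] theorem pow (hf : Primrec f) (hg : Primrec g) : Primrec fun x => f x ^ g x :=
  (Primrec₂.unpaired'.1 Nat.Primrec.pow).comp hf hg

@[fun_prop] theorem natPair (hf : Primrec f) (hg : Primrec g) :
    Primrec fun x => Nat.pair (f x) (g x) :=
  Primrec₂.natPair.comp hf hg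

@[fun_prop] theorem unpair (hf : Primrec f) : Primrec fun x => Nat.unpair (f x) :=
  Primrec.unpair.comp hf

@[fun_prop] theorem decideEq (hf : Primrec f) (hg : Primrec g) :
    Primrec fun x => decide (f x = g x) :=
  PrimrecPred.decide (p := fun x => f x = g x) (Primrec.eq.comp hf hg)

@[fun_prop] theorem decideLt (hf : Primrec f) (hg : Primrec g) :
    Primrec fun x => decide (f x < g x) :=
  PrimrecPred.decide (p := fun x => f x < g x) (Primrec.nat_lt.comp hf hg)

@[fun_prop] theorem natRec {n : α → ℕ} {f : α → β} {g : α → ℕ → β → β} (hn : Primrec n)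
    (hf : Primrec f) (hg : Primrec fun p : α × ℕ × β => g p.1 p.2.1 p.2.2) :
    Primrec fun x => Nat.rec (motive := fun _ => β) (f x) (g x) (n x) :=
  Primrec.nat_rec' (h := fun x p => g x p.1 p.2) hn hf hg

end Nat

section Bool

variable {b c : α → Bool}

@[fun_prop] theorem and' (hb : Primrec b) (hc : Primrec c) : Primrec fun x => b x && c x :=
  Primrec.and.comp hb hc

@[fun_prop] theorem not' (hb : Primrec b) : Primrec fun x => !b x :=
  Primrec.not.comp hb

@[fun_prop] theorem cond' {f g : α → β} (hb : Primrec b) (hf : Primrec f) (hg : Primrec g) :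
    Primrec fun x => bif b x then f x else g x :=
  Primrec.cond hb hf hg

end Bool

section Option

@[fun_prop] theorem some' {f : α → β} (hf : Primrec f) : Primrec fun x => some (f x) :=
  Primrec.option_some.comp hf

@[fun_prop] theorem optionElim {o : α → Option β} {f : α → γ} {g : α → β → γ} (ho : Primrec o)
    (hf : Primrec f) (hg : Primrec fun p : α × β => g p.1 p.2) :
    Primrec fun x => (o x).elim (f x) (g x) :=
  (Primrec.option_casesOn ho hf (Primrec₂.mk hg)).of_eq fun x => by cases o x <;> rfl

@[fun_prop] theorem optionMap {o : α → Option β} {g : α → β → γ} (ho : Primrec o)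
    (hg : Primrec fun p : α × β => g p.1 p.2) : Primrec fun x => (o x).map (g x) :=
  Primrec.option_map ho hg

@[fun_prop] theorem optionBind {o : α → Option β} {g : α → β → Option γ} (ho : Primrec o)
    (hg : Primrec fun p : α × β => g p.1 p.2) : Primrec fun x => (o x).bind (g x) :=
  Primrec.option_bind ho hg

@[fun_prop] theorem optionGetD {o : α → Option β} {f : α → β} (ho : Primrec o)
    (hf : Primrec f) : Primrec fun x => (o x).getD (f x) :=
  Primrec.option_getD.comp ho hf

end Option

section List

@[fun_prop] theorem map {l : α → List β} {g : α → β → γ} (hl : Primrec l)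
    (hg : Primrec fun p : α × β => g p.1 p.2) : Primrec fun x => (l x).map (g x) :=
  Primrec.list_map hl hg

@[fun_prop] theorem flatMap {l : α → List β} {g : α → β → List γ} (hl : Primrec l)
    (hg : Primrec fun p : α × β => g p.1 p.2) : Primrec fun x => (l x).flatMap (g x) :=
  Primrec.list_flatMap hl hg

@[fun_prop] theorem flatten {l : α → List (List β)} (hl : Primrec l) :
    Primrec fun x => (l x).flatten :=
  Primrec.list_flatten.comp hl

@[fun_prop] theorem filterMap {l : α → List β} {g : α → β → Option γ} (hl : Primrec l)
    (hg : Primrec fun p : α × β => g p.1 p.2) : Primrec fun x => (l x).filterMap (g x) :=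
  Primrec.listFilterMap hl hg

@[fun_prop] theorem filter {l : α → List β} {g : α → β → Bool} (hl : Primrec l)
    (hg : Primrec fun p : α × β => g p.1 p.2) : Primrec fun x => (l x).filter (g x) := by
  refine (Primrec.listFilterMap (g := fun x b => bif g x b then some b else none) hl
    (by unfold Primrec₂; fun_prop)).of_eq fun x => ?_
  rw [← List.filterMap_eq_filter]
  congr
  funext b
  cases h : g x b <;> simp [Option.guard, h]

@[fun_prop] theorem sum {l : α → List ℕ} (hl : Primrec l) : Primrec fun x => (l x).sum :=
  (Primrec.list_foldr (h := fun _ p => p.1 + p.2) hl (Primrec.const 0)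
    (by unfold Primrec₂; fun_prop)).of_eq fun _ => rfl

@[fun_prop] theorem range {n : α → ℕ} (hn : Primrec n) : Primrec fun x => List.range (n x) :=
  Primrec.list_range.comp hn

@[fun_prop] theorem length {l : α → List β} (hl : Primrec l) : Primrec fun x => (l x).length :=
  Primrec.list_length.comp hl

@[fun_prop] theorem cons {f : α → β} {l : α → List β} (hf : Primrec f) (hl : Primrec l) :
    Primrec fun x => f x :: l x :=
  Primrec.list_cons.comp hf hl

@[fun_prop] theorem append {l l' : α → List β} (hl : Primrec l) (hl' : Primrec l') :
    Primrec fun x => l x ++ l' x :=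
  Primrec.list_append.comp hl hl'

@[fun_prop] theorem getElem? {l : α → List β} {n : α → ℕ} (hl : Primrec l) (hn : Primrec n) :
    Primrec fun x => (l x)[n x]? :=
  Primrec.list_getElem?.comp hl hn

@[fun_prop] theorem getD {l : α → List β} {n : α → ℕ} {d : α → β} (hl : Primrec l)
    (hn : Primrec n) (hd : Primrec d) : Primrec fun x => (l x).getD (n x) (d x) :=
  (optionGetD (getElem? hl hn) hd).of_eq fun _ => List.getD_eq_getElem?_getD.symm

@[fun_prop] theorem findIdx {l : α → List β} {p : α → β → Bool} (hl : Primrec l)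
    (hp : Primrec fun q : α × β => p q.1 q.2) : Primrec fun x => (l x).findIdx (p x) :=
  Primrec.list_findIdx hl hp

end List

@[fun_prop] theorem encode {f : α → β} (hf : Primrec f) :
    Primrec fun x => Encodable.encode (f x) :=
  Primrec.encode.comp hf

@[fun_prop] theorem decode {f : α → ℕ} (hf : Primrec f) :
    Primrec fun x => (Encodable.decode (f x) : Option β) :=
  Primrec.decode.comp hf

end Prim

/-! ### Runs and their outputs -/

theorem TwoWay.output_eq {A : Type u} {L : Type v} {T : TwoWay A L} {w : List A} {ν : L → ℕ → ℕ}
    {s : ℕ} (h : T.AcceptingRun w ν (T.init, 0) s) : T.output w ν = s := by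
  have h' : ∃ s, T.AcceptingRun w ν (T.init, 0) s := ⟨s, h⟩
  rw [TwoWay.output, dif_pos h']
  exact h'.choose_spec.unique h

@[simp] theorem tapeAt_zero {A : Type u} (w : List A) : tapeAt w 0 = .leftMark := rfl

@[simp] theorem tapeAt_length {A : Type u} (w : List A) :
    tapeAt w (w.length + 1) = .rightMark := by
  simp [tapeAt]

theorem tapeAt_append {A : Type u} (u : List A) (a : A) (v : List A) :
    tapeAt (u ++ a :: v) (u.length + 1) = .letter a := by
  simp [tapeAt]

/-! ### Simulating a bimachine by a two-way machine -/

/-- States of the simulating machine: a phase `tag` and four registers. The phases are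
* `0`: first sweep to the right, the first register holds the image of the prefix read so far;
* `1`: return to the left mark, the first register holds the image of the whole word;
* `2`: the registers `p`, `s` hold the images of the word before the head and from the head on;
* `3`: the letter of image `c` that follows a prefix of image `p` is being processed, its suffix
  (including this letter) has image `s`, and `x` is the image of what was read after it;
* `4`: the way back to this letter; `p` is as before, `y` is the image of what follows the letter,
  and the last two registers trace two candidates. -/
def st (tag a b c d : ℕ) : ℕ := Nat.pair tag (Nat.pair a (Nat.pair b (Nat.pair c d)))

/-- A number of states that suffices if the registers hold numbers below `n`. -/
def stCount (n : ℕ) : ℕ := st 5 n n n n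

theorem pair_le_pair {a b c d : ℕ} (h : a ≤ c) (h' : b ≤ d) : Nat.pair a b ≤ Nat.pair c d := by
  rcases h.eq_or_lt with rfl | h
  · rcases h'.eq_or_lt with rfl | h'
    · exact le_rfl
    · exact (Nat.pair_lt_pair_right _ h').le
  · refine (Nat.pair_lt_pair_left b h).le.trans ?_
    rcases h'.eq_or_lt with rfl | h'
    · exact le_rfl
    · exact (Nat.pair_lt_pair_right _ h').le

theorem st_lt {n tag a b c d : ℕ} (ht : tag < 5) (ha : a ≤ n) (hb : b ≤ n) (hc : c ≤ n)
    (hd : d ≤ n) : st tag a b c d < stCount n :=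
  (Nat.pair_lt_pair_left _ ht).trans_le
    (pair_le_pair le_rfl (pair_le_pair ha (pair_le_pair hb (pair_le_pair hc hd))))

theorem stCount_pos (n : ℕ) : 0 < stCount n :=
  (Nat.zero_le _).trans_lt (st_lt (n := n) (tag := 0) (a := 0) (b := 0) (c := 0) (d := 0)
    (by decide) (Nat.zero_le _) (Nat.zero_le _) (Nat.zero_le _) (Nat.zero_le _))

/-- The first `r < n` with `c * (z * r) = s`; it is `n` if there is none. -/
def sol (mul : ℕ → ℕ → ℕ) (n c s z : ℕ) : ℕ :=
  (List.range n).findIdx fun r => decide (mul c (mul z r) = s)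

/-- The first `r < n` with `c * (z * r) = s` and `z * r ≠ y`; it is `n` if there is none. -/
def other (mul : ℕ → ℕ → ℕ) (n c s z y : ℕ) : ℕ :=
  (List.range n).findIdx fun r => decide (mul c (mul z r) = s) && !decide (mul z r = y)

/-- The step in phase `2` on a letter of image `b`; see `letterStep`. -/
def mainStep (mul : ℕ → ℕ → ℕ) (n one p s b : ℕ) : Option ((ℕ × Bool) × Option (ℕ × ℕ)) :=
  bif decide (other mul n b s one (mul one (sol mul n b s one)) < n) then
    some ((st 3 p b s one, true), none)
  else some ((st 2 (mul p b) (mul one (sol mul n b s one)) 0 0, true),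
    some (p, mul one (sol mul n b s one)))

/-- The step in phase `3` on a letter of image `b`, where `z` is the product of the last register
and `b`; see `letterStep`. -/
def scanStep (mul : ℕ → ℕ → ℕ) (n p c s x b z : ℕ) : Option ((ℕ × Bool) × Option (ℕ × ℕ)) :=
  bif decide (other mul n c s z (mul z (sol mul n c s z)) < n) then
    some ((st 3 p c s z, true), none)
  else some ((st 4 p (mul z (sol mul n c s z)) (mul b (sol mul n c s z))
    (other mul n c s x (mul z (sol mul n c s z))), false), none)

/-- The step in phase `4` on a letter of image `b`; see `letterStep`. -/
def backStep (mul : ℕ → ℕ → ℕ) (p y x z b : ℕ) : Option ((ℕ × Bool) × Option (ℕ × ℕ)) :=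
  bif decide (mul b x = mul b z) then some ((st 2 (mul p b) y 0 0, true), some (p, y))
  else some ((st 4 p y (mul b x) (mul b z), false), none)

/-- The step in the phase `tag` with registers `r₁`, …, `r₄` on a letter of image `b`. The last
component of the result is `some (p, y)` if the machine has found out that the prefix before the
letter has image `p` and the suffix after the letter has image `y`. -/
def phaseStep (mul : ℕ → ℕ → ℕ) (n one b tag r₁ r₂ r₃ r₄ : ℕ) :
    Option ((ℕ × Bool) × Option (ℕ × ℕ)) :=
  bif decide (tag = 0) then some ((st 0 (mul r₁ b) 0 0 0, true), none)
  else bif decide (tag = 1) then some ((st 1 r₁ 0 0 0, false), none)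
  else bif decide (tag = 2) then mainStep mul n one r₁ r₂ b
  else bif decide (tag = 3) then scanStep mul n r₁ r₂ r₃ r₄ b (mul r₄ b)
  else backStep mul r₁ r₂ r₃ r₄ b

/-- The step in state `q` on a letter of image `b`; see `phaseStep`. -/
def letterStep (mul : ℕ → ℕ → ℕ) (n one q b : ℕ) : Option ((ℕ × Bool) × Option (ℕ × ℕ)) :=
  phaseStep mul n one b q.unpair.1 q.unpair.2.unpair.1 q.unpair.2.unpair.2.unpair.1
    q.unpair.2.unpair.2.unpair.2.unpair.1 q.unpair.2.unpair.2.unpair.2.unpair.2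

/-- The step on the left mark. -/
def leftStep (one q : ℕ) : Option (ℕ × Bool) :=
  bif decide (q.unpair.1 = 0) then some (q, true)
  else bif decide (q.unpair.1 = 1) then some (st 2 one q.unpair.2.unpair.1 0 0, true)
  else none

/-- The step on the right mark in the phase `tag` with registers `r₁`, …, `r₄`. -/
def rightPhaseStep (mul : ℕ → ℕ → ℕ) (n one tag r₁ r₂ r₃ r₄ : ℕ) : Option (ℕ × Bool) :=
  bif decide (tag = 0) then some (st 1 r₁ 0 0 0, false)
  else bif decide (tag = 3) then some (st 4 r₁ r₄ one (other mul n r₂ r₃ r₄ r₄), false)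
  else none

/-- The step on the right mark. -/
def rightStep (mul : ℕ → ℕ → ℕ) (n one q : ℕ) : Option (ℕ × Bool) :=
  rightPhaseStep mul n one q.unpair.1 q.unpair.2.unpair.1 q.unpair.2.unpair.2.unpair.1
    q.unpair.2.unpair.2.unpair.2.unpair.1 q.unpair.2.unpair.2.unpair.2.unpair.2

/-- The multiplication given by a table. -/
def tableMul (tbl : List (List ℕ)) (x y : ℕ) : ℕ := (tbl.getD x []).getD y 0

/-- The inverse of `Dir.toBool`. -/
def dirOfBool (b : Bool) : Dir := bif b then .right else .left

@[simp] theorem dirOfBool_toBool (b : Bool) : (dirOfBool b).toBool = b := by cases b <;> rfl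

namespace Bimachine

variable {A : Type u} {L : Type v}

/-- The multiplication table of the monoid of a bimachine. -/
def table (B : Bimachine A L) : List (List ℕ) :=
  List.ofFn fun x : Fin B.n => List.ofFn fun y : Fin B.n => (B.mul x y : ℕ)

@[simp] theorem tableMul_table (B : Bimachine A L) (x y : Fin B.n) :
    tableMul B.table x y = B.mul x y := by
  simp [tableMul, table, List.getD_eq_getElem?_getD]

theorem n_pos (B : Bimachine A L) : 0 < B.n := (Nat.zero_le _).trans_lt B.one.2

/-- The number `k`, reduced to an element of `Fin N`. -/
def modFin {N : ℕ} (hN : 0 < N) (k : ℕ) : Fin N := ⟨k % N, Nat.mod_lt _ hN⟩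

theorem modFin_eq {N : ℕ} (hN : 0 < N) (k : Fin N) : modFin hN (k : ℕ) = k :=
  Fin.ext (Nat.mod_eq_of_lt k.2)

/-- The two-way machine that simulates the bimachine `B`. It outputs the label `lab p a s` instead
of the label `B.out p a s` of the bimachine, and `zero` in all other steps. -/
def toTwoWay {L' : Type w} (B : Bimachine A L) (lab : Fin B.n → A → Fin B.n → L') (zero : L') :
    TwoWay A L' where
  n := stCount B.n
  init := modFin (stCount_pos _) (st 0 B.one 0 0 0)
  final := Finset.univ.filter fun q => (q : ℕ).unpair.1 = 2
  step q t :=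
    match t with
    | .leftMark => (leftStep B.one q).map fun r =>
        ((modFin (stCount_pos _) r.1, dirOfBool r.2), zero)
    | .rightMark => (rightStep (tableMul B.table) B.n B.one q).map fun r =>
        ((modFin (stCount_pos _) r.1, dirOfBool r.2), zero)
    | .letter a => (letterStep (tableMul B.table) B.n B.one q (B.letterImage a)).map fun r =>
        ((modFin (stCount_pos _) r.1.1, dirOfBool r.1.2),
          r.2.elim zero fun py => lab (modFin B.n_pos py.1) a (modFin B.n_pos py.2))

section Search

variable (B : Bimachine A L)

theorem sol_spec {c s z : Fin B.n} (h : ∃ r, B.mul c (B.mul z r) = s) :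
    ∃ r : Fin B.n, sol (tableMul B.table) B.n c s z = r ∧ B.mul c (B.mul z r) = s := by
  obtain ⟨r, hr⟩ := h
  set p : ℕ → Bool := fun r => decide (tableMul B.table c (tableMul B.table z r) = s) with hp
  have h1 : (List.range B.n).findIdx p < (List.range B.n).length :=
    List.findIdx_lt_length_of_exists ⟨r, by simp, by simp [hp, hr]⟩
  have h2 := List.findIdx_getElem (w := h1)
  have h3 : (List.range B.n).findIdx p < B.n := by simpa using h1
  refine ⟨⟨_, h3⟩, rfl, ?_⟩
  simp only [List.getElem_range, hp, decide_eq_true_eq] at h2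
  rw [show (List.findIdx (fun r => decide (tableMul B.table c (tableMul B.table z r) = s))
    (List.range B.n)) = ((⟨_, h3⟩ : Fin B.n) : ℕ) from rfl] at h2
  rw [tableMul_table, tableMul_table] at h2
  exact Fin.ext h2

theorem other_spec {c s z y : Fin B.n} (h : ∃ r, B.mul c (B.mul z r) = s ∧ B.mul z r ≠ y) :
    ∃ r : Fin B.n, other (tableMul B.table) B.n c s z y = r ∧ B.mul c (B.mul z r) = s ∧
      B.mul z r ≠ y := by
  obtain ⟨r, hr, hr'⟩ := h
  set p : ℕ → Bool := fun r => decide (tableMul B.table c (tableMul B.table z r) = s) &&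
    !decide (tableMul B.table z r = y) with hp
  have h1 : (List.range B.n).findIdx p < (List.range B.n).length :=
    List.findIdx_lt_length_of_exists ⟨r, by simp, by simp [hp, hr, Fin.val_inj, hr']⟩
  have h2 := List.findIdx_getElem (w := h1)
  have h3 : (List.range B.n).findIdx p < B.n := by simpa using h1
  refine ⟨⟨_, h3⟩, rfl, ?_⟩
  have h4 : p ((⟨_, h3⟩ : Fin B.n) : ℕ) = true := by simpa using h2
  generalize (⟨_, h3⟩ : Fin B.n) = r' at h4
  simpa [hp, Fin.val_inj] using h4

theorem other_lt_iff {c s z y : Fin B.n} :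
    other (tableMul B.table) B.n c s z y < B.n ↔
      ∃ r, B.mul c (B.mul z r) = s ∧ B.mul z r ≠ y := by
  refine ⟨fun h => ?_, fun h => ?_⟩
  · by_contra hn
    have : other (tableMul B.table) B.n c s z y = (List.range B.n).length := by
      refine List.findIdx_eq_length_of_false fun x hx => ?_
      rw [List.mem_range] at hx
      have := fun h' => hn ⟨⟨x, hx⟩, h'⟩
      have e : tableMul B.table z x = B.mul z ⟨x, hx⟩ := B.tableMul_table z ⟨x, hx⟩
      simpa [e, Fin.val_inj] using this
    simp [this] at h
  · obtain ⟨r, hr, -⟩ := B.other_spec h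
    rw [hr]
    exact r.2

end Search

end Bimachine

namespace Bimachine

variable {A : Type u} {L : Type v} {L' : Type w}

@[simp] theorem mu_nil (B : Bimachine A L) : B.mu [] = B.one := rfl

@[simp] theorem mu_cons (B : Bimachine A L) (a : A) (w : List A) :
    B.mu (a :: w) = B.mul (B.letterImage a) (B.mu w) := rfl

theorem mu_concat (B : Bimachine A L) (w : List A) (a : A) :
    B.mu (w ++ [a]) = B.mul (B.mu w) (B.letterImage a) := by
  rw [mu_append, mu_cons, mu_nil, B.mul_one]

section Run

variable (B : Bimachine A L) (lab : Fin B.n → A → Fin B.n → L') (zero : L')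
  (ν : L' → ℕ → ℕ)

/-- The state of the simulating machine with the given phase and registers. -/
def state (tag a b c d : ℕ) : Fin (stCount B.n) := modFin (stCount_pos _) (st tag a b c d)

theorem val_state {tag a b c d : ℕ} (ht : tag < 5) (ha : a ≤ B.n) (hb : b ≤ B.n) (hc : c ≤ B.n)
    (hd : d ≤ B.n) : (B.state tag a b c d : ℕ) = st tag a b c d :=
  Nat.mod_eq_of_lt (st_lt ht ha hb hc hd)

variable {B lab zero ν}

theorem mem_final {q : Fin (stCount B.n)} :
    q ∈ (B.toTwoWay lab zero).final ↔ (q : ℕ).unpair.1 = 2 :=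
  Finset.mem_filter.trans (and_iff_right (Finset.mem_univ q))

theorem run_letter_right {w u v : List A} {a : A} (hw : w = u ++ a :: v) {q : Fin (stCount B.n)}
    {q' : ℕ} {r : Option (ℕ × ℕ)} {s : ℕ}
    (hq : letterStep (tableMul B.table) B.n B.one q (B.letterImage a) = some ((q', true), r))
    (h : (B.toTwoWay lab zero).AcceptingRun w ν (modFin (stCount_pos _) q', u.length + 2) s) :
    (B.toTwoWay lab zero).AcceptingRun w ν (q, u.length + 1)
      (ν (r.elim zero fun py => lab (modFin B.n_pos py.1) a (modFin B.n_pos py.2))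
        (u.length + 1) + s) := by
  subst hw
  refine TwoWay.AcceptingRun.move (fun hacc => ?_) ?_ h
  · have := hacc.1
    simp at this
  · simp only [TwoWay.next, tapeAt_append]
    simp [toTwoWay, hq, dirOfBool]

theorem run_letter_left {w u v : List A} {a : A} (hw : w = u ++ a :: v) {q : Fin (stCount B.n)}
    {q' : ℕ} {s : ℕ} (hz : ∀ i, ν zero i = 0)
    (hq : letterStep (tableMul B.table) B.n B.one q (B.letterImage a) = some ((q', false), none))
    (h : (B.toTwoWay lab zero).AcceptingRun w ν (modFin (stCount_pos _) q', u.length) s) :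
    (B.toTwoWay lab zero).AcceptingRun w ν (q, u.length + 1) s := by
  subst hw
  rw [show s = ν zero (u.length + 1) + s by rw [hz, Nat.zero_add]]
  refine TwoWay.AcceptingRun.move (fun hacc => ?_) ?_ h
  · have := hacc.1
    simp at this
  · simp only [TwoWay.next, tapeAt_append]
    simp [toTwoWay, hq, dirOfBool]

theorem run_left {w : List A} {q : Fin (stCount B.n)} {q' : ℕ} {s : ℕ} (hz : ∀ i, ν zero i = 0)
    (hq : leftStep B.one q = some (q', true))
    (h : (B.toTwoWay lab zero).AcceptingRun w ν (modFin (stCount_pos _) q', 1) s) :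
    (B.toTwoWay lab zero).AcceptingRun w ν (q, 0) s := by
  rw [show s = ν zero 0 + s by rw [hz, Nat.zero_add]]
  refine TwoWay.AcceptingRun.move (fun hacc => ?_) ?_ h
  · have := hacc.1
    simp at this
  · simp only [TwoWay.next, tapeAt_zero]
    simp [toTwoWay, hq, dirOfBool]

theorem run_right {w : List A} {q : Fin (stCount B.n)} {q' : ℕ} {s : ℕ} (hz : ∀ i, ν zero i = 0)
    (hq : rightStep (tableMul B.table) B.n B.one q = some (q', false))
    (hf : (q : ℕ).unpair.1 ≠ 2)
    (h : (B.toTwoWay lab zero).AcceptingRun w ν (modFin (stCount_pos _) q', w.length) s) :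
    (B.toTwoWay lab zero).AcceptingRun w ν (q, w.length + 1) s := by
  rw [show s = ν zero (w.length + 1) + s by rw [hz, Nat.zero_add]]
  refine TwoWay.AcceptingRun.move (fun hacc => ?_) ?_ h
  · exact hf (mem_final.1 hacc.2)
  · simp only [TwoWay.next, tapeAt_length]
    simp [toTwoWay, hq, dirOfBool]

/-- The way back: while the two traced candidates differ, the letter being processed has not been
reached, and there they merge. -/
theorem run_back (hz : ∀ i, ν zero i = 0) {u : List A} {a : A} {s : ℕ} {y z : Fin B.n}
    (hyz : y ≠ z) (hc : B.mul (B.letterImage a) y = B.mul (B.letterImage a) z) (v : List A) :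
    ∀ (w t : List A) (r₁ r₂ : Fin B.n), w = u ++ a :: (v ++ t) → B.mul (B.mu v) r₁ = y →
      B.mul (B.mu v) r₂ = z →
      (B.toTwoWay lab zero).AcceptingRun w ν
        (B.state 2 (B.mu (u ++ [a])) y 0 0, u.length + 2) s →
      (B.toTwoWay lab zero).AcceptingRun w ν (B.state 4 (B.mu u) y r₁ r₂, u.length + v.length + 1)
        (ν (lab (B.mu u) a y) (u.length + 1) + s) := by
  induction v using List.reverseRecOn with
  | nil =>
    intro w t r₁ r₂ hw h₁ h₂ h
    rw [mu_nil, B.one_mul] at h₁ h₂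
    subst h₁ h₂
    have hq := B.val_state (tag := 4) (by decide) (B.mu u).2.le r₁.2.le r₁.2.le r₂.2.le
    have := run_letter_right (lab := lab) (zero := zero) (ν := ν) (s := s)
      (q := B.state 4 (B.mu u) r₁ r₁ r₂) (r := some ((B.mu u : ℕ), (r₁ : ℕ)))
      (q' := st 2 (B.mul (B.mu u) (B.letterImage a)) r₁ 0 0) (w := w) (u := u) (v := t) (a := a)
      (by simpa using hw)
      (by rw [hq]; simp [letterStep, phaseStep, mainStep, scanStep, backStep, st, hc])
      (by rw [mu_concat] at h; exact h)
    simpa [modFin_eq] using this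
  | append_singleton v b ih =>
    intro w t r₁ r₂ hw h₁ h₂ h
    have hne : B.mul (B.letterImage b) r₁ ≠ B.mul (B.letterImage b) r₂ := by
      intro he
      rw [mu_concat, B.mul_assoc] at h₁ h₂
      rw [he] at h₁
      exact hyz (h₁.symm.trans h₂)
    have hq := B.val_state (tag := 4) (by decide) (B.mu u).2.le y.2.le r₁.2.le r₂.2.le
    have := run_letter_left (lab := lab) (zero := zero) (ν := ν)
      (s := ν (lab (B.mu u) a y) (u.length + 1) + s)
      (q := B.state 4 (B.mu u) y r₁ r₂)
      (q' := st 4 (B.mu u) y (B.mul (B.letterImage b) r₁) (B.mul (B.letterImage b) r₂))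
      (w := w) (u := u ++ a :: v) (v := t) (a := b)
      (by simpa using hw) hz
      (by rw [hq]; simp [letterStep, phaseStep, mainStep, scanStep, backStep, st, Fin.val_inj, hne])
      (by
        have := ih w (b :: t) (B.mul (B.letterImage b) r₁) (B.mul (B.letterImage b) r₂)
          (by simpa using hw) (by rw [← h₁, mu_concat, B.mul_assoc])
          (by rw [← h₂, mu_concat, B.mul_assoc]) h
        simpa [← Nat.add_assoc] using! this)
    simpa [← Nat.add_assoc] using this

/-- The scan: as long as several values are possible for the image of what follows the letter
being processed, the head moves on to the right. -/
theorem run_scan (hz : ∀ i, ν zero i = 0) {u : List A} {a : A} {s : ℕ} (t : List A) :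
    ∀ (w v : List A), w = u ++ a :: (v ++ t) →
      (∃ y', B.mul (B.letterImage a) (B.mul (B.mu v) y') = B.mu (a :: (v ++ t)) ∧
        B.mul (B.mu v) y' ≠ B.mu (v ++ t)) →
      (B.toTwoWay lab zero).AcceptingRun w ν
        (B.state 2 (B.mu (u ++ [a])) (B.mu (v ++ t)) 0 0, u.length + 2) s →
      (B.toTwoWay lab zero).AcceptingRun w ν
        (B.state 3 (B.mu u) (B.letterImage a) (B.mu (a :: (v ++ t))) (B.mu v),
          u.length + v.length + 2)
        (ν (lab (B.mu u) a (B.mu (v ++ t))) (u.length + 1) + s) := by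
  induction t with
  | nil =>
    intro w v hw hex h
    have hq := B.val_state (tag := 3) (by decide) (B.mu u).2.le (B.letterImage a).2.le
      (B.mu (a :: (v ++ []))).2.le (B.mu v).2.le
    rw [List.append_nil] at hw hex h hq ⊢
    obtain ⟨r, hr, hr1, hr2⟩ := B.other_spec hex
    have := run_right (lab := lab) (zero := zero) (ν := ν) (w := w)
      (s := ν (lab (B.mu u) a (B.mu v)) (u.length + 1) + s)
      (q := B.state 3 (B.mu u) (B.letterImage a) (B.mu (a :: v)) (B.mu v))
      (q' := st 4 (B.mu u) (B.mu v) B.one r) hz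
      (by rw [hq]; simp only [rightStep, rightPhaseStep, st, Nat.unpair_pair]; rw [hr]; rfl)
      (by rw [hq]; simp [st])
      (by
        have := run_back (lab := lab) (zero := zero) (ν := ν) hz hr2.symm (a := a) (u := u) (s := s)
          (by rw [hr1]; rfl) v w [] B.one r (by simpa using hw) (B.mul_one _) rfl h
        subst hw
        simpa [← Nat.add_assoc] using! this)
    subst hw
    simpa [← Nat.add_assoc] using this
  | cons b t ih =>
    intro w v hw hex h
    have hq := B.val_state (tag := 3) (by decide) (B.mu u).2.le (B.letterImage a).2.le
      (B.mu (a :: (v ++ b :: t))).2.le (B.mu v).2.le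
    -- `z` is the image of what has been read after `a`, including the letter `b`
    set z := B.mul (B.mu v) (B.letterImage b) with hzdef
    have hmu : B.mu (v ++ b :: t) = B.mul z (B.mu t) := by
      rw [mu_append, mu_cons, ← B.mul_assoc]
    obtain ⟨r, hr, hr1⟩ := B.sol_spec (c := B.letterImage a) (s := B.mu (a :: (v ++ b :: t)))
      (z := z) ⟨B.mu t, by rw [← hmu]; rfl⟩
    have hvb : v ++ b :: t = (v ++ [b]) ++ t := by simp
    have hlet : w = (u ++ a :: v) ++ b :: t := by simpa using hw
    by_cases hex' : ∃ y', B.mul (B.letterImage a) (B.mul z y') = B.mu (a :: (v ++ b :: t)) ∧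
        B.mul z y' ≠ B.mul z r
    · have hlt := B.other_lt_iff.2 hex'
      have hex2 : ∃ y', B.mul (B.letterImage a) (B.mul (B.mu (v ++ [b])) y') =
          B.mu (a :: ((v ++ [b]) ++ t)) ∧
          B.mul (B.mu (v ++ [b])) y' ≠ B.mu ((v ++ [b]) ++ t) := by
        rw [← hvb, hmu, mu_concat, ← hzdef]
        by_cases he : B.mul z (B.mu t) = B.mul z r
        · rw [he]
          exact hex'
        · exact ⟨r, hr1, fun h' => he h'.symm⟩
      have := run_letter_right (lab := lab) (zero := zero) (ν := ν)
        (s := ν (lab (B.mu u) a (B.mu (v ++ b :: t))) (u.length + 1) + s)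
        (q := B.state 3 (B.mu u) (B.letterImage a) (B.mu (a :: (v ++ b :: t))) (B.mu v))
        (q' := st 3 (B.mu u) (B.letterImage a) (B.mu (a :: (v ++ b :: t))) z)
        (r := none) hlet
        (by
          rw [hq]
          simp only [letterStep, phaseStep, mainStep, scanStep, backStep, st,
            Nat.unpair_pair, tableMul_table, ← hzdef, hr]
          simp [hlt, -mu_cons])
        (by
          have := ih w (v ++ [b]) (by simpa using hw) hex2 (by rw [← hvb]; exact h)
          rw [← hvb, mu_concat, ← hzdef] at this
          simpa [← Nat.add_assoc] using! this)
      simpa [hz, ← Nat.add_assoc] using this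
    · have hlt := mt B.other_lt_iff.1 hex'
      push Not at hex'
      have hy : B.mul z r = B.mu (v ++ b :: t) := by
        rw [hmu]
        exact (hex' (B.mu t) (by rw [← hmu]; rfl)).symm
      rw [← hy] at hex
      obtain ⟨r', hr', hr1', hr2'⟩ := B.other_spec hex
      have := run_letter_left (lab := lab) (zero := zero) (ν := ν)
        (s := ν (lab (B.mu u) a (B.mu (v ++ b :: t))) (u.length + 1) + s)
        (q := B.state 3 (B.mu u) (B.letterImage a) (B.mu (a :: (v ++ b :: t))) (B.mu v))
        (q' := st 4 (B.mu u) (B.mul z r) (B.mul (B.letterImage b) r) r') hlet hz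
        (by
          rw [hq]
          simp only [letterStep, phaseStep, mainStep, scanStep, backStep, st,
            Nat.unpair_pair, tableMul_table, ← hzdef, hr, hr']
          simp [hlt, -mu_cons])
        (by
          have := run_back (lab := lab) (zero := zero) (ν := ν) hz hr2'.symm (a := a) (u := u)
            (s := s) (by rw [hr1, hr1']) v w (b :: t) (B.mul (B.letterImage b) r) r' hw
            (by rw [← B.mul_assoc]) rfl (by rw [hy]; exact h)
          rw [hy] at this ⊢
          simpa [← Nat.add_assoc] using! this)
      simpa [← Nat.add_assoc] using this

/-- The main phase: the outputs for the remaining letters are produced one by one. -/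
theorem run_main (hz : ∀ i, ν zero i = 0) (v : List A) : ∀ (w u : List A), w = u ++ v →
    (B.toTwoWay lab zero).AcceptingRun w ν (B.state 2 (B.mu u) (B.mu v) 0 0, u.length + 1)
      (∑ j : Fin v.length, ν (lab (B.mu (u ++ v.take j)) (v.get j) (B.mu (v.drop (j + 1))))
        (u.length + j + 1)) := by
  induction v with
  | nil =>
    rintro w u rfl
    have hq := B.val_state (tag := 2) (by decide) (B.mu u).2.le B.one.2.le (Nat.zero_le _)
      (Nat.zero_le _)
    refine TwoWay.AcceptingRun.halt ⟨by simp, mem_final.2 ?_⟩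
    rw [mu_nil, hq]
    simp [st]
  | cons a v ih =>
    intro w u hw
    have ih' := ih w (u ++ [a]) (by simpa using hw)
    have hsum : (∑ j : Fin (a :: v).length,
        ν (lab (B.mu (u ++ (a :: v).take j)) ((a :: v).get j) (B.mu ((a :: v).drop (j + 1))))
          (u.length + j + 1)) = ν (lab (B.mu u) a (B.mu v)) (u.length + 1) +
        ∑ j : Fin v.length, ν (lab (B.mu (u ++ [a] ++ v.take j)) (v.get j)
          (B.mu (v.drop (j + 1)))) ((u ++ [a]).length + j + 1) := by
      refine (Fin.sum_univ_succ (n := v.length) _).trans (congrArg₂ _ (by simp) ?_)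
      refine Finset.sum_congr rfl fun j _ => ?_
      simp [Nat.add_comm 1, Nat.add_assoc]
    refine hsum ▸ ?_
    generalize (∑ j : Fin v.length, ν (lab (B.mu (u ++ [a] ++ v.take j)) (v.get j)
      (B.mu (v.drop (j + 1)))) ((u ++ [a]).length + j + 1)) = s at ih' ⊢
    have hq := B.val_state (tag := 2) (by decide) (B.mu u).2.le (B.mu (a :: v)).2.le
      (Nat.zero_le _) (Nat.zero_le _)
    obtain ⟨r, hr, hr1⟩ := B.sol_spec (c := B.letterImage a) (s := B.mu (a :: v))
      (z := B.one) ⟨B.mu v, by rw [B.one_mul]; rfl⟩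
    simp only [List.length_append, List.length_singleton] at ih'
    by_cases hex : ∃ y', B.mul (B.letterImage a) (B.mul B.one y') = B.mu (a :: v) ∧
        B.mul B.one y' ≠ B.mul B.one r
    · have hlt := B.other_lt_iff.2 hex
      have hex2 : ∃ y', B.mul (B.letterImage a) (B.mul (B.mu []) y') =
          B.mu (a :: ([] ++ v)) ∧ B.mul (B.mu []) y' ≠ B.mu ([] ++ v) := by
        by_cases he : B.mu v = B.mul B.one r
        · rw [List.nil_append, he]
          exact hex
        · exact ⟨r, hr1, fun h' => he h'.symm⟩
      have := run_letter_right (lab := lab) (zero := zero) (ν := ν) (w := w) (u := u) (v := v)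
        (a := a) (s := ν (lab (B.mu u) a (B.mu v)) (u.length + 1) + s)
        (q := B.state 2 (B.mu u) (B.mu (a :: v)) 0 0)
        (q' := st 3 (B.mu u) (B.letterImage a) (B.mu (a :: v)) B.one) (r := none) hw
        (by
          rw [hq]
          simp only [letterStep, phaseStep, mainStep, scanStep, backStep, st,
            Nat.unpair_pair, hr, tableMul_table]
          simp [hlt, -mu_cons])
        (run_scan (lab := lab) (zero := zero) (ν := ν) hz v w [] hw hex2 ih')
      simpa [hz] using this
    · have hlt := mt B.other_lt_iff.1 hex
      push Not at hex
      have hy : B.mul B.one r = B.mu v := by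
        rw [← hex (B.mu v) (by rw [B.one_mul]; rfl), B.one_mul]
      have := run_letter_right (lab := lab) (zero := zero) (ν := ν) (w := w) (u := u) (v := v)
        (a := a) (s := s) (q := B.state 2 (B.mu u) (B.mu (a :: v)) 0 0)
        (q' := st 2 (B.mu (u ++ [a])) (B.mu v) 0 0)
        (r := some ((B.mu u : ℕ), (B.mu v : ℕ))) hw
        (by
          rw [hq]
          simp only [letterStep, phaseStep, mainStep, scanStep, backStep, st,
            Nat.unpair_pair, hr, tableMul_table]
          rw [hy] at hlt ⊢
          simp [hlt, mu_concat, -mu_cons])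
        ih'
      simpa [modFin_eq] using this

theorem run_sweep_left (hz : ∀ i, ν zero i = 0) {x : Fin B.n} {s : ℕ} (u : List A) :
    ∀ (w v : List A), w = u ++ v →
      (B.toTwoWay lab zero).AcceptingRun w ν (B.state 2 B.one x 0 0, 1) s →
      (B.toTwoWay lab zero).AcceptingRun w ν (B.state 1 x 0 0 0, u.length) s := by
  have hq := B.val_state (tag := 1) (by decide) x.2.le (Nat.zero_le _) (Nat.zero_le _)
    (Nat.zero_le _)
  induction u using List.reverseRecOn with
  | nil =>
    intro w v _ h
    exact run_left (q' := st 2 B.one x 0 0) hz (by rw [hq]; simp [leftStep, st]) h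
  | append_singleton u a ih =>
    intro w v hw h
    have := run_letter_left (q := B.state 1 x 0 0 0) (q' := st 1 x 0 0 0) (w := w) (u := u)
      (a := a) (v := v) (by simpa using hw) hz (by
        rw [hq]
        simp [letterStep, phaseStep, mainStep, scanStep, backStep, st])
      (ih w (a :: v) (by simpa using hw) h)
    simpa using this

theorem run_sweep_right (hz : ∀ i, ν zero i = 0) {s : ℕ} (v : List A) :
    ∀ (w u : List A), w = u ++ v →
      (B.toTwoWay lab zero).AcceptingRun w ν (B.state 1 (B.mu w) 0 0 0, w.length) s →
      (B.toTwoWay lab zero).AcceptingRun w ν (B.state 0 (B.mu u) 0 0 0, u.length + 1) s := by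
  induction v with
  | nil =>
    intro w u hw h
    have hq := B.val_state (tag := 0) (by decide) (B.mu u).2.le (Nat.zero_le _) (Nat.zero_le _)
      (Nat.zero_le _)
    rw [List.append_nil] at hw
    subst hw
    exact run_right (q' := st 1 (B.mu w) 0 0 0) hz
      (by rw [hq]; simp [rightStep, rightPhaseStep, st])
      (by rw [hq]; simp [st]) h
  | cons a v ih =>
    intro w u hw h
    have hq := B.val_state (tag := 0) (by decide) (B.mu u).2.le (Nat.zero_le _) (Nat.zero_le _)
      (Nat.zero_le _)
    have h' := ih w (u ++ [a]) (by simpa using hw) h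
    have := run_letter_right (lab := lab) (zero := zero) (ν := ν) (w := w) (u := u) (v := v)
      (a := a) (s := s) (q := B.state 0 (B.mu u) 0 0 0) (q' := st 0 (B.mu (u ++ [a])) 0 0 0)
      (r := none) hw (by
        rw [hq]
        simp [letterStep, phaseStep, mainStep, scanStep, backStep, st, mu_concat])
      (by simpa using! h')
    simpa [hz] using this

variable (B lab zero ν)

theorem toTwoWay_output (hz : ∀ i, ν zero i = 0) (w : List A) :
    (B.toTwoWay lab zero).output w ν =
      ∑ j : Fin w.length, ν (lab (B.mu (w.take j)) (w.get j) (B.mu (w.drop (j + 1)))) (j + 1) := by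
  refine TwoWay.output_eq ?_
  have h := run_main (B := B) (lab := lab) (zero := zero) hz w w [] rfl
  simp only [List.nil_append, List.length_nil, Nat.zero_add] at h
  have hq := B.val_state (tag := 0) (by decide) B.one.2.le (Nat.zero_le _) (Nat.zero_le _)
      (Nat.zero_le _)
  refine run_left (q' := st 0 B.one 0 0 0) hz ?_ (run_sweep_right hz w w [] rfl
    (run_sweep_left hz w w [] (by simp) h))
  exact (congrArg (leftStep B.one) hq).trans (by simp [leftStep, st])

end Run

end Bimachine

/-! ### From bimachines to transducers, with all levels -/

/-- A two-way transducer without accepting runs. -/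
def zeroTwoWay (A : Type u) (L : Type v) : TwoWay A L where
  n := 1
  init := 0
  final := ∅
  step _ _ := none

theorem zeroTwoWay_output {A : Type u} {L : Type v} (w : List A) (ν : L → ℕ → ℕ) :
    (zeroTwoWay A L).output w ν = 0 := by
  rw [TwoWay.output, dif_neg]
  rintro ⟨s, hs⟩
  cases hs with
  | halt h => exact absurd h.2 (Finset.notMem_empty _)
  | move _ hc _ => simp [TwoWay.next, zeroTwoWay] at hc

/-- A `k`-transducer that computes the function `0`. -/
def KTransducer.zero (mode : Mode) : (k : ℕ) → (A : Type u) → KTransducer mode k A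
  | 0, A => zeroTwoWay A ℕ
  | k + 1, A => zeroTwoWay A (KTransducer mode k (mode.Ext A))

theorem KTransducer.eval_zero (mode : Mode) (k : ℕ) {A : Type u} (w : List A) :
    (KTransducer.zero mode k A).eval mode k w = 0 := by
  cases k with
  | zero => exact zeroTwoWay_output w _
  | succ k => exact zeroTwoWay_output w _

/-- The `k`-transducer that simulates a `k`-bimachine. -/
def KBimachine.toTransducer (mode : Mode) :
    (k : ℕ) → {A : Type u} → KBimachine mode k A → KTransducer mode k A
  | 0, A, B => Bimachine.toTwoWay (A := A) (L := ℕ) B (Bimachine.out (A := A) (L := ℕ) B) (0 : ℕ)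
  | k + 1, A, B => Bimachine.toTwoWay (A := A) (L := KBimachine mode k (mode.Ext A)) B
      (fun p a s => KBimachine.toTransducer mode k
        (Bimachine.out (A := A) (L := KBimachine mode k (mode.Ext A)) B p a s))
      (KTransducer.zero mode k (mode.Ext A))

theorem Mode.arg_ne_nil (mode : Mode) {A : Type u} {w : List A} (hw : w ≠ []) (i : ℕ) :
    mode.arg w (i + 1) ≠ [] := by
  cases mode with
  | pebble =>
    intro h
    have := congrArg List.length h
    simp [Mode.arg] at this
    exact hw this
  | blind => exact hw
  | marble =>
    intro h
    exact (List.take_eq_nil_iff.1 h).elim (fun h => absurd h (Nat.succ_ne_zero i)) hw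

theorem KBimachine.eval_toTransducer (mode : Mode) (k : ℕ) {A : Type u} (B : KBimachine mode k A)
    (w : List A) (hw : w ≠ []) :
    (KBimachine.toTransducer mode k B).eval mode k w = B.eval mode k w := by
  induction k generalizing A with
  | zero => exact Bimachine.toTwoWay_output (A := A) (L := ℕ) B _ _ _ (fun _ => rfl) w
  | succ k ih =>
    refine (Bimachine.toTwoWay_output (A := A) (L := KBimachine mode k (mode.Ext A)) B _ _ _
      (fun i => KTransducer.eval_zero mode k _) w).trans ?_
    exact Finset.sum_congr rfl fun j _ => ih _ _ (mode.arg_ne_nil hw j)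

/-! ### The conversion of descriptions of bimachines -/

theorem ofFn_val {β : Type*} (N : ℕ) (g : ℕ → β) :
    (List.ofFn fun i : Fin N => g i) = (List.range N).map g := by
  apply List.ext_getElem <;> simp

theorem map_eq_map_range {α β : Type*} (l : List α) (f : α → β) (g : ℕ → β)
    (h : ∀ i (hi : i < l.length), f l[i] = g i) : l.map f = (List.range l.length).map g := by
  apply List.ext_getElem
  · simp
  · intro i h1 h2
    simpa using h i (by simpa using h1)

namespace Prim

variable {α β γ : Type*} [Primcodable α] [Primcodable β] [Primcodable γ]

@[fun_prop] theorem idxOf [DecidableEq β] {f : α → β} {l : α → List β} (hf : Primrec f)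
    (hl : Primrec l) : Primrec fun x => (l x).idxOf (f x) :=
  Primrec.list_idxOf.comp hf hl

/-- A function defined by recursion on the level `k`, from finitely many values at level `k - 1`
whose arguments depend primitively recursively on the given argument, is primitive recursive. -/
theorem levelRec {R : ℕ → α → β} {base : α → β} {deps : α → List α} {step : α → List β → β}
    (hb : Primrec base) (hd : Primrec deps) (hs : Primrec fun p : α × List β => step p.1 p.2)
    (h0 : ∀ a, R 0 a = base a) (h1 : ∀ k a, R (k + 1) a = step a ((deps a).map (R k))) :
    Primrec fun p : ℕ × α => R p.1 p.2 := by
  refine Primrec.nat_omega_rec' (fun p : ℕ × α => R p.1 p.2) (m := fun p => p.1)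
    (l := fun p => bif decide (p.1 = 0) then [] else (deps p.2).map fun a => (p.1 - 1, a))
    (g := fun p vals => some (bif decide (p.1 = 0) then base p.2 else step p.2 vals))
    (by fun_prop) (by fun_prop) (by unfold Primrec₂; fun_prop) ?_ ?_
  · rintro ⟨k, a⟩ ⟨k', a'⟩ h
    cases k with
    | zero => simp at h
    | succ k =>
      simp only [Nat.add_eq_zero_iff, one_ne_zero, and_false, decide_false, cond_false,
        List.mem_map] at h
      obtain ⟨b, -, hb⟩ := h
      cases hb
      simp
  · rintro ⟨k, a⟩
    cases k with
    | zero => simp [h0]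
    | succ k => simp [h1, Function.comp_def]

end Prim

/-- The value at `d` of a function on the elements of the list `deps` whose values are `vals`. -/
def valueAt {α : Type*} [DecidableEq α] (deps : List α) (vals : List ℕ) (d : α) : ℕ :=
  vals.getD (deps.idxOf d) 0

theorem valueAt_map {α : Type*} [DecidableEq α] {deps : List α} (f : α → ℕ) {d : α}
    (hd : d ∈ deps) : valueAt deps (deps.map f) d = f d := by
  have h := List.idxOf_lt_length_of_mem hd
  simp [valueAt, List.getD_eq_getElem?_getD, h]

/-- The descriptions of bimachines, before they are encoded as numbers. -/
abbrev BData : Type := ℕ × ℕ × List (List ℕ) × ℕ × List ℕ × List (List (List ℕ))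

/-- The descriptions of two-way transducers, before they are encoded as numbers. -/
abbrev TData : Type := ℕ × ℕ × ℕ × List Bool × List (List (Option ((ℕ × Bool) × ℕ)))

/-- The description of a bimachine, see `Bimachine.code`. -/
def Bimachine.data {A : Type u} {L : Type v} (letters : List A) (labelCode : L → ℕ)
    (B : Bimachine A L) : BData :=
  (letters.length, B.n,
    (List.ofFn fun x : Fin B.n => List.ofFn fun y : Fin B.n => (B.mul x y : ℕ)),
    (B.one : ℕ), letters.map (fun a => (B.letterImage a : ℕ)),
    List.ofFn fun x : Fin B.n => letters.map fun a =>
      List.ofFn fun y : Fin B.n => labelCode (B.out x a y))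

/-- The description that is encoded by a number, with a default value for all other numbers. -/
def BData.decode (c : ℕ) : BData := (Encodable.decode c).getD (0, 0, [], 0, [], [])

theorem BData.decode_encode (d : BData) : BData.decode (Encodable.encode d) = d := by
  rw [BData.decode, Encodable.encodek, Option.getD_some]

/-- The entry of the transition table of the simulating machine for the state `q` and the `i`-th
letter. -/
def letterEntry (d : BData) (z : ℕ) (lab : ℕ → ℕ) (q i : ℕ) : Option ((ℕ × Bool) × ℕ) :=
  (letterStep (tableMul d.2.2.1) d.2.1 d.2.2.2.1 q (d.2.2.2.2.1.getD i 0)).map fun r =>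
    ((r.1.1 % stCount d.2.1, r.1.2), r.2.elim z fun py =>
      lab (((d.2.2.2.2.2.getD (py.1 % d.2.1) []).getD i []).getD (py.2 % d.2.1) 0))

/-- The description of the machine that simulates a bimachine. -/
def toTwoWayData (d : BData) (z : ℕ) (lab : ℕ → ℕ) : TData :=
  (d.1, stCount d.2.1, st 0 d.2.2.2.1 0 0 0 % stCount d.2.1,
    (List.range (stCount d.2.1)).map (fun q => decide (q.unpair.1 = 2)),
    (List.range (stCount d.2.1)).map fun q =>
      ((leftStep d.2.2.2.1 q).map fun r => ((r.1 % stCount d.2.1, r.2), z)) ::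
      ((rightStep (tableMul d.2.2.1) d.2.1 d.2.2.2.1 q).map fun r =>
        ((r.1 % stCount d.2.1, r.2), z)) ::
      (List.range d.1).map fun i => letterEntry d z lab q i)

theorem Bimachine.code_toTwoWay {A : Type u} {L : Type v} {L' : Type w} (B : Bimachine A L)
    (letters : List A) (labelCode : L → ℕ) (labelCode' : L' → ℕ)
    (lab : Fin B.n → A → Fin B.n → L') (zero : L') (labN : ℕ → ℕ)
    (h : ∀ p a s, a ∈ letters → labelCode' (lab p a s) = labN (labelCode (B.out p a s))) :
    (B.toTwoWay lab zero).code letters labelCode' =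
      Encodable.encode (toTwoWayData (B.data letters labelCode) (labelCode' zero) labN) := by
  unfold TwoWay.code
  congr 1
  refine Prod.ext rfl (Prod.ext rfl (Prod.ext rfl (Prod.ext ?_ ?_)))
  · refine Eq.trans ?_ (ofFn_val (stCount B.n) _)
    refine congrArg List.ofFn (funext fun q => ?_)
    exact decide_eq_decide.2 mem_final
  · refine Eq.trans ?_ (ofFn_val (stCount B.n) _)
    refine congrArg List.ofFn (funext fun q => ?_)
    simp only [List.map_cons, List.map_map]
    refine congrArg₂ _ ?_ (congrArg₂ _ ?_ ?_)
    · simp [toTwoWay, Bimachine.data, Function.comp_def, modFin]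
    · simp [toTwoWay, Bimachine.data, Function.comp_def, modFin, table]
    · refine map_eq_map_range _ _ _ fun i hi => ?_
      have hp := B.n_pos
      simp [toTwoWay, Bimachine.data, Function.comp_def, letterEntry, table, hi,
        List.getD_eq_getElem?_getD]
      refine congrArg₂ _ (funext fun r => ?_) rfl
      rcases r with ⟨r1, r2⟩
      cases r2 with
      | none => simp [modFin]
      | some py => simp [modFin, Nat.mod_lt _ hp, h _ _ _ (List.getElem_mem hi), hi]

namespace Prim

variable {α : Type*} [Primcodable α]

@[fun_prop] theorem valueAt {β : Type*} [Primcodable β] [DecidableEq β] {f : α → List β}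
    {g : α → List ℕ} {h : α → β} (hf : Primrec f) (hg : Primrec g) (hh : Primrec h) :
    Primrec fun x => PebbleBim.valueAt (f x) (g x) (h x) := by
  unfold PebbleBim.valueAt; fun_prop

@[fun_prop] theorem st {f g h i j : α → ℕ} (hf : Primrec f) (hg : Primrec g) (hh : Primrec h)
    (hi : Primrec i) (hj : Primrec j) :
    Primrec fun x => PebbleBim.st (f x) (g x) (h x) (i x) (j x) := by
  unfold PebbleBim.st; fun_prop

@[fun_prop] theorem stCount {f : α → ℕ} (hf : Primrec f) :
    Primrec fun x => PebbleBim.stCount (f x) := by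
  unfold PebbleBim.stCount; fun_prop

@[fun_prop] theorem tableMul {t : α → List (List ℕ)} {f g : α → ℕ} (ht : Primrec t)
    (hf : Primrec f) (hg : Primrec g) : Primrec fun x => PebbleBim.tableMul (t x) (f x) (g x) := by
  unfold PebbleBim.tableMul; fun_prop

@[fun_prop] theorem sol {t : α → List (List ℕ)} {n c s z : α → ℕ} (ht : Primrec t)
    (hn : Primrec n) (hc : Primrec c) (hs : Primrec s) (hz : Primrec z) :
    Primrec fun x => PebbleBim.sol (PebbleBim.tableMul (t x)) (n x) (c x) (s x) (z x) := by
  unfold PebbleBim.sol; fun_prop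

@[fun_prop] theorem other {t : α → List (List ℕ)} {n c s z y : α → ℕ} (ht : Primrec t)
    (hn : Primrec n) (hc : Primrec c) (hs : Primrec s) (hz : Primrec z) (hy : Primrec y) :
    Primrec fun x => PebbleBim.other (PebbleBim.tableMul (t x)) (n x) (c x) (s x) (z x) (y x) := by
  unfold PebbleBim.other; fun_prop

@[fun_prop] theorem letterStep {t : α → List (List ℕ)} {n one q b : α → ℕ} (ht : Primrec t)
    (hn : Primrec n) (ho : Primrec one) (hq : Primrec q) (hb : Primrec b) : Primrec fun x =>
      PebbleBim.letterStep (PebbleBim.tableMul (t x)) (n x) (one x) (q x) (b x) := by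
  unfold PebbleBim.letterStep phaseStep
  refine cond' (by fun_prop) (by fun_prop) (cond' (by fun_prop) (by fun_prop)
    (cond' (by fun_prop) ?_ (cond' (by fun_prop) ?_ ?_)))
  · unfold mainStep; fun_prop
  · unfold scanStep; fun_prop
  · unfold backStep; fun_prop

@[fun_prop] theorem leftStep {one q : α → ℕ} (ho : Primrec one) (hq : Primrec q) :
    Primrec fun x => PebbleBim.leftStep (one x) (q x) := by
  unfold PebbleBim.leftStep; fun_prop

@[fun_prop] theorem rightStep {t : α → List (List ℕ)} {n one q : α → ℕ} (ht : Primrec t)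
    (hn : Primrec n) (ho : Primrec one) (hq : Primrec q) :
    Primrec fun x => PebbleBim.rightStep (PebbleBim.tableMul (t x)) (n x) (one x) (q x) := by
  unfold PebbleBim.rightStep rightPhaseStep; fun_prop

@[fun_prop] theorem letterEntry {d : α → BData} {zero q i : α → ℕ} {lab : α → ℕ → ℕ}
    (hd : Primrec d) (hz : Primrec zero) (hl : Primrec fun p : α × ℕ => lab p.1 p.2)
    (hq : Primrec q) (hi : Primrec i) :
    Primrec fun x => PebbleBim.letterEntry (d x) (zero x) (lab x) (q x) (i x) := by
  unfold PebbleBim.letterEntry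
  refine optionMap (by fun_prop) (mk (by fun_prop) ?_)
  refine optionElim (by fun_prop) (by fun_prop) ?_
  exact hl.comp (mk (by fun_prop) (getD (by fun_prop) (by fun_prop) (by fun_prop)))

@[fun_prop] theorem toTwoWayData {d : α → BData} {zero : α → ℕ} {lab : α → ℕ → ℕ}
    (hd : Primrec d) (hz : Primrec zero) (hl : Primrec fun p : α × ℕ => lab p.1 p.2) :
    Primrec fun x => PebbleBim.toTwoWayData (d x) (zero x) (lab x) := by
  unfold PebbleBim.toTwoWayData; fun_prop

@[fun_prop] theorem decodeBData {f : α → ℕ} (hf : Primrec f) :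
    Primrec fun x => BData.decode (f x) := by
  unfold BData.decode; fun_prop

end Prim

/-- The number of letters of the alphabet of the external functions. -/
def Mode.extCount : Mode → ℕ → ℕ
  | .pebble, n => n + n
  | .blind, n => n
  | .marble, n => n

theorem Mode.length_extLetters (mode : Mode) {A : Type u} (letters : List A) :
    (mode.extLetters letters).length = mode.extCount letters.length := by
  cases mode with
  | pebble =>
    change (letters.map Sum.inl ++ letters.map Sum.inr : List (A ⊕ A)).length = _
    simp [Mode.extCount]
  | blind => rfl
  | marble => rfl

@[fun_prop] theorem Prim.extCount {α : Type*} [Primcodable α] (mode : Mode) {f : α → ℕ}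
    (hf : Primrec f) : Primrec fun x => mode.extCount (f x) := by
  cases mode <;> unfold Mode.extCount <;> fun_prop

/-- The description of a two-way transducer without accepting runs. -/
def zeroCode (l : ℕ) : ℕ :=
  Encodable.encode ((l, 1, 0, [false], [(List.range (l + 2)).map fun _ => none]) : TData)

@[fun_prop] theorem Prim.zeroCode {α : Type*} [Primcodable α] {f : α → ℕ}
    (hf : Primrec f) : Primrec fun x => zeroCode (f x) := by
  unfold PebbleBim.zeroCode; fun_prop

theorem zeroTwoWay_code {A : Type u} {L : Type v} (letters : List A) (labelCode : L → ℕ) :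
    (zeroTwoWay A L).code letters labelCode = zeroCode letters.length := by
  unfold TwoWay.code zeroCode
  congr 1
  refine Prod.ext rfl (Prod.ext rfl (Prod.ext rfl (Prod.ext ?_ ?_)))
  · simp only [zeroTwoWay, List.ofFn_succ, List.ofFn_zero]
    rfl
  · simp only [zeroTwoWay, List.ofFn_succ, List.ofFn_zero]
    refine congrArg (fun x => [x]) ?_
    refine List.ext_getElem (by simp) fun i h1 h2 => ?_
    rw [List.getElem_map, List.getElem_map, Option.map_none]

theorem KTransducer.code_zero (mode : Mode) (k : ℕ) {A : Type u} (letters : List A) :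
    (KTransducer.zero mode k A).code mode k letters = zeroCode letters.length := by
  cases k with
  | zero => exact zeroTwoWay_code (L := ℕ) letters _
  | succ k => exact zeroTwoWay_code (L := KTransducer mode k (mode.Ext A)) letters _

/-- The labels that occur in the description of a bimachine. -/
def bimachineLabels (c : ℕ) : List ℕ := (BData.decode c).2.2.2.2.2.flatten.flatten

/-- The conversion of descriptions of `k`-bimachines to descriptions of `k`-transducers. -/
def toTransducerCode (mode : Mode) : ℕ → ℕ → ℕ
  | 0, c => Encodable.encode (toTwoWayData (BData.decode c) 0 fun x => x)
  | k + 1, c => Encodable.encode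
      (toTwoWayData (BData.decode c) (zeroCode (mode.extCount (BData.decode c).1))
        (valueAt (bimachineLabels c) ((bimachineLabels c).map (toTransducerCode mode k))))

theorem primrec_toTransducerCode (mode : Mode) :
    Primrec fun p : ℕ × ℕ => toTransducerCode mode p.1 p.2 :=
  Prim.levelRec (R := toTransducerCode mode)
    (base := fun c => Encodable.encode (toTwoWayData (BData.decode c) 0 fun x => x))
    (deps := bimachineLabels)
    (step := fun c vals => Encodable.encode
      (toTwoWayData (BData.decode c) (zeroCode (mode.extCount (BData.decode c).1))
        (valueAt (bimachineLabels c) vals)))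
    (by fun_prop) (by unfold bimachineLabels; fun_prop) (by unfold bimachineLabels; fun_prop)
    (fun _ => rfl) (fun _ _ => rfl)

/-- The numerical conversion agrees with the conversion of machines. -/
theorem KBimachine.code_toTransducer (mode : Mode) (k : ℕ) {A : Type u} (letters : List A)
    (B : KBimachine mode k A) :
    (KBimachine.toTransducer mode k B).code mode k letters =
      toTransducerCode mode k (B.code mode k letters) := by
  induction k generalizing A with
  | zero =>
    refine (Bimachine.code_toTwoWay (A := A) (L := ℕ) B letters (fun x => x) (fun x => x) _ _
      (fun x => x) fun _ _ _ _ => rfl).trans ?_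
    change _ = Encodable.encode (toTwoWayData (BData.decode (Encodable.encode
      (Bimachine.data (A := A) (L := ℕ) letters (fun x => x) B))) 0 fun x => x)
    rw [BData.decode_encode]
  | succ k ih =>
    set d := Bimachine.data (A := A) (L := KBimachine mode k (mode.Ext A)) letters
      (fun S => KBimachine.code mode k (mode.extLetters letters) S) B with hd
    have hdec : BData.decode (B.code mode (k + 1) letters) = d := BData.decode_encode d
    refine (Bimachine.code_toTwoWay (A := A) (L := KBimachine mode k (mode.Ext A)) B letters
      (fun S => KBimachine.code mode k (mode.extLetters letters) S)
      (fun S => KTransducer.code mode k (mode.extLetters letters) S) _ _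
      (valueAt (bimachineLabels (B.code mode (k + 1) letters))
        ((bimachineLabels (B.code mode (k + 1) letters)).map (toTransducerCode mode k)))
      fun p a s ha => ?_).trans ?_
    · rw [valueAt_map]
      · exact ih _ _
      · unfold bimachineLabels
        rw [hdec]
        simp only [hd, Bimachine.data, List.mem_flatten]
        exact ⟨_, ⟨_, List.mem_ofFn.2 ⟨p, rfl⟩, List.mem_map.2 ⟨a, ha, rfl⟩⟩,
          List.mem_ofFn.2 ⟨s, rfl⟩⟩
    · rw [KTransducer.code_zero, Mode.length_extLetters]
      change _ = Encodable.encode (toTwoWayData (BData.decode (B.code mode (k + 1) letters))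
        (zeroCode (mode.extCount (BData.decode (B.code mode (k + 1) letters)).1)) _)
      rw [hdec]
      rfl

/-! ### Functions on a finite set of numbers, encoded as numbers -/

/-- The number with the digits `f 0, …, f (t - 1)` (reduced modulo `s`) in base `s`. -/
def encFun (s t : ℕ) (f : ℕ → ℕ) : ℕ := ((List.range t).map fun i => f i % s * s ^ i).sum

/-- The digit number `i` of `x` in base `s`. -/
def digit (s x i : ℕ) : ℕ := x / s ^ i % s

theorem encFun_succ (s t : ℕ) (f : ℕ → ℕ) :
    encFun s (t + 1) f = encFun s t f + f t % s * s ^ t := by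
  simp [encFun, List.range_succ]

theorem encFun_congr {s t : ℕ} {f g : ℕ → ℕ} (h : ∀ i < t, f i = g i) :
    encFun s t f = encFun s t g := by
  unfold encFun
  congr 1
  exact List.map_congr_left fun i hi => by rw [h i (List.mem_range.1 hi)]

theorem encFun_lt {s : ℕ} (hs : 0 < s) (t : ℕ) (f : ℕ → ℕ) : encFun s t f < s ^ t := by
  induction t with
  | zero => simp [encFun]
  | succ t ih =>
    rw [encFun_succ, pow_succ]
    have h : f t % s + 1 ≤ s := Nat.mod_lt _ hs
    have := Nat.mul_le_mul_right (s ^ t) h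
    nlinarith

theorem digit_lt {s : ℕ} (hs : 0 < s) (x i : ℕ) : digit s x i < s := Nat.mod_lt _ hs

theorem digit_encFun {s : ℕ} (hs : 0 < s) {t i : ℕ} (hi : i < t) (f : ℕ → ℕ) :
    digit s (encFun s t f) i = f i % s := by
  induction t with
  | zero => omega
  | succ t ih =>
    rw [encFun_succ, digit]
    rcases Nat.lt_succ_iff_lt_or_eq.1 hi with h | rfl
    · obtain ⟨d, rfl⟩ := Nat.exists_eq_add_of_lt h
      rw [show f (i + d + 1) % s * s ^ (i + d + 1) = s ^ i * (s * (f (i + d + 1) % s * s ^ d)) by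
        ring, Nat.add_mul_div_left _ _ (pow_pos hs i), Nat.add_mul_mod_self_left]
      exact ih h
    · rw [Nat.add_mul_div_right _ _ (pow_pos hs i), Nat.div_eq_of_lt (encFun_lt hs i f), zero_add,
        Nat.mod_mod]

theorem encFun_digit (s t x : ℕ) : encFun s t (digit s x) = x % s ^ t := by
  induction t with
  | zero => simp [encFun, Nat.mod_one]
  | succ t ih =>
    rw [encFun_succ, ih, Nat.mod_pow_succ, digit, Nat.mod_mod, mul_comm]

/-! ### Behaviours of two-way machines on prefixes -/

/-- One round at a position with action `g`: a machine in state `q` that moves to the left returns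
in the state that is given by the behaviour `f` of the prefix before this position. -/
def roundTrip (g : ℕ → ℕ × Bool) (f : ℕ → ℕ) (q : ℕ) : ℕ :=
  bif (g q).2 then q else f (g q).1

/-- The state after `t` rounds. -/
def rounds (g : ℕ → ℕ × Bool) (f : ℕ → ℕ) (t q : ℕ) : ℕ :=
  Nat.rec q (fun _ p => roundTrip g f p) t

/-- The state in which the machine leaves to the right a position with action `g`, if it starts
there in the state `q` and if `f` is the behaviour of the prefix before this position. After `s`
rounds the machine is known to loop, and the result is the dead state `0`. -/
def leave (s : ℕ) (g : ℕ → ℕ × Bool) (f : ℕ → ℕ) (q : ℕ) : ℕ :=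
  bif (g (rounds g f s q)).2 then (g (rounds g f s q)).1 else 0

/-- The behaviour of a prefix that is extended by a position with action `g`. The behaviour sends
each state, taken at the last position, to the state in which the machine first leaves the prefix;
at the artificial argument `2` it stands for the run from the initial configuration. -/
def extend (s : ℕ) (g : ℕ → ℕ × Bool) (f : ℕ → ℕ) (q : ℕ) : ℕ :=
  leave s g f (bif decide (q = 2) then f 2 else q)

/-- The behaviour of the empty prefix. -/
def emptyBehaviour (q₀ q : ℕ) : ℕ := bif decide (q = 2) then q₀ else 0

/-- Actions on the states `0, …, s - 1`: the dead state `0` goes on to the right, and no action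
leads to the artificial state `2`. -/
structure IsAction (s : ℕ) (g : ℕ → ℕ × Bool) : Prop where
  dead : g 0 = (0, true)
  lt : ∀ q < s, (g q).1 < s
  ne : ∀ q, (g q).1 ≠ 2

/-- The steps of a total two-way machine on a tape of `r` cells whose actions are `gs 0`, …,
`gs (r - 1)`. The machine stops when it has left the tape to the right. -/
def tapeStep (gs : ℕ → ℕ → ℕ × Bool) (r : ℕ) (c : ℕ × ℕ) : Option (ℕ × ℕ) :=
  if c.2 < r then
    if (gs c.2 c.1).2 then some ((gs c.2 c.1).1, c.2 + 1)
    else if c.2 = 0 then none else some ((gs c.2 c.1).1, c.2 - 1)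
  else none

section Deterministic

variable {σ : Type*} {f : σ → Option σ}

/-- The configuration `b` is reached from `a` by the steps of a deterministic machine. -/
abbrev Reach (f : σ → Option σ) : σ → σ → Prop := Relation.ReflTransGen fun a b => f a = some b

theorem Reach.of_terminal {a t : σ} (h : Reach f a t) (ha : f a = none) : a = t := by
  rcases Relation.ReflTransGen.cases_head h with rfl | ⟨b, hb, -⟩
  · rfl
  · rw [ha] at hb
    cases hb

theorem Reach.step {a b t : σ} (h : Reach f a t) (ht : f t = none) (hab : f a = some b) :
    Reach f b t := by
  rcases Relation.ReflTransGen.cases_head h with rfl | ⟨c, hc, hct⟩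
  · rw [ht] at hab
    cases hab
  · rw [hab] at hc
    cases hc
    exact hct

theorem Reach.trans_terminal {a b t : σ} (h : Reach f a t) (ht : f t = none) (hab : Reach f a b) :
    Reach f b t := by
  induction hab with
  | refl => exact h
  | tail _ hbc ih => exact ih.step ht hbc

theorem Reach.acyclic {a b t : σ} (h : Reach f a t) (ht : f t = none) (hab : f a = some b)
    (hba : Reach f b a) : False := by
  have key : ∀ c, Reach f a c → Reach f c a := by
    intro c hc
    induction hc with
    | refl => exact .refl
    | tail _ hcd ih =>
      rcases Relation.ReflTransGen.cases_head ih with rfl | ⟨d', hd', hd⟩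
      · rw [hab] at hcd
        cases hcd
        exact hba
      · rw [hcd] at hd'
        cases hd'
        exact hd
  have := (key t h).of_terminal ht
  subst this
  rw [ht] at hab
  cases hab

end Deterministic

section Behaviour

/-- `F i` is the behaviour of the first `i` cells of a tape of `r` cells with actions `gs`, and
`q₀` is the initial state. -/
structure IsBehaviour (s r q₀ : ℕ) (gs : ℕ → ℕ → ℕ × Bool) (F : ℕ → ℕ → ℕ) : Prop where
  action : ∀ i < r, IsAction s (gs i)
  zero : ∀ q < s, F 0 q = emptyBehaviour q₀ q
  succ : ∀ i < r, ∀ q < s, F (i + 1) q = extend s (gs i) (F i) q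
  lt : ∀ i q, F i q < s
  two_lt : 2 < s

variable {s r q₀ : ℕ} {gs : ℕ → ℕ → ℕ × Bool} {F : ℕ → ℕ → ℕ}

theorem rounds_succ (g : ℕ → ℕ × Bool) (f : ℕ → ℕ) (t q : ℕ) :
    rounds g f (t + 1) q = roundTrip g f (rounds g f t q) := rfl

theorem tapeStep_none {q : ℕ} : tapeStep gs r (q, r) = none := by simp [tapeStep]

theorem tapeStep_right {q i : ℕ} (hi : i < r) (h : (gs i q).2 = true) :
    tapeStep gs r (q, i) = some ((gs i q).1, i + 1) := by simp [tapeStep, hi, h]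

theorem tapeStep_left {q i : ℕ} (hi : i + 1 < r) (h : (gs (i + 1) q).2 = false) :
    tapeStep gs r (q, i + 1) = some ((gs (i + 1) q).1, i) := by simp [tapeStep, hi, h]

theorem rounds_lt {g : ℕ → ℕ × Bool} {f : ℕ → ℕ} {q : ℕ} (hf : ∀ p, f p < s) (hq : q < s)
    (t : ℕ) : rounds g f t q < s := by
  induction t with
  | zero => exact hq
  | succ t ih =>
    rw [rounds_succ, roundTrip]
    cases (g (rounds g f t q)).2
    · exact hf _
    · exact ih

theorem extend_lt {g : ℕ → ℕ × Bool} {f : ℕ → ℕ} {q : ℕ} (hg : IsAction s g) (hf : ∀ p, f p < s)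
    (hq : q < s) : extend s g f q < s := by
  have hp : (bif decide (q = 2) then f 2 else q) < s := by
    cases decide (q = 2)
    · exact hq
    · exact hf 2
  rw [extend, leave]
  cases (g (rounds g f s (bif decide (q = 2) then f 2 else q))).2
  · exact (Nat.zero_le _).trans_lt hq
  · exact hg.lt _ (rounds_lt hf hp s)

namespace IsBehaviour

variable (h : IsBehaviour s r q₀ gs F)

include h

theorem rounds_lt {i q : ℕ} (hq : q < s) (t : ℕ) : rounds (gs i) (F i) t q < s :=
  PebbleBim.rounds_lt (h.lt i) hq t

/-- Soundness of the computation of the rounds at one position. -/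
theorem reach_rounds {i q : ℕ} (hi : i < r) (hq : q < s)
    (ih : ∀ j, i = j + 1 → ∀ p < s, p ≠ 2 → F i p ≠ 0 → Reach (tapeStep gs r) (p, j) (F i p, i))
    (t : ℕ) (ht : rounds (gs i) (F i) t q ≠ 0) :
    Reach (tapeStep gs r) (q, i) (rounds (gs i) (F i) t q, i) := by
  induction t with
  | zero => exact .refl
  | succ t iht =>
    rw [rounds_succ, roundTrip] at ht ⊢
    have hlt := h.rounds_lt (i := i) hq t
    generalize hp : rounds (gs i) (F i) t q = p at *
    have hp0 : p ≠ 0 := by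
      rintro rfl
      rw [(h.action i hi).dead] at ht
      exact ht rfl
    cases hd : (gs i p).2
    · rw [hd, cond_false] at ht
      rw [cond_false]
      cases i with
      | zero =>
        rw [h.zero _ ((h.action 0 hi).lt p hlt), emptyBehaviour,
          decide_eq_false ((h.action 0 hi).ne p)] at ht
        exact absurd rfl ht
      | succ j =>
        refine (iht hp0).trans (.head (tapeStep_left hi hd) ?_)
        exact ih j rfl _ ((h.action _ hi).lt p hlt) ((h.action _ hi).ne p) ht
    · rw [cond_true]
      exact iht hp0

theorem reach_leave {i q : ℕ} (hi : i < r) (hq : q < s)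
    (ih : ∀ j, i = j + 1 → ∀ p < s, p ≠ 2 → F i p ≠ 0 → Reach (tapeStep gs r) (p, j) (F i p, i))
    (ht : leave s (gs i) (F i) q ≠ 0) :
    Reach (tapeStep gs r) (q, i) (leave s (gs i) (F i) q, i + 1) := by
  rw [leave] at ht ⊢
  cases hd : (gs i (rounds (gs i) (F i) s q)).2
  · rw [hd, cond_false] at ht
    exact absurd rfl ht
  · rw [hd, cond_true] at ht
    rw [cond_true]
    refine (h.reach_rounds hi hq ih s fun h0 => ?_).tail (tapeStep_right hi hd)
    rw [h0, (h.action i hi).dead] at ht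
    exact ht rfl

theorem reach_state (i : ℕ) (hi : i < r) : ∀ q < s, q ≠ 2 → F (i + 1) q ≠ 0 →
    Reach (tapeStep gs r) (q, i) (F (i + 1) q, i + 1) := by
  induction i with
  | zero =>
    intro q hq hq2 hF
    rw [h.succ 0 hi q hq, extend, decide_eq_false hq2, cond_false] at hF ⊢
    exact h.reach_leave hi hq (fun j hj => by omega) hF
  | succ i ih =>
    intro q hq hq2 hF
    rw [h.succ _ hi q hq, extend, decide_eq_false hq2, cond_false] at hF ⊢
    refine h.reach_leave hi hq (fun j hj => ?_) hF
    obtain rfl : i = j := by omega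
    exact ih (by omega)

theorem reach_start (i : ℕ) (hi : i ≤ r) (hF : F i 2 ≠ 0) :
    Reach (tapeStep gs r) (q₀, 0) (F i 2, i) := by
  induction i with
  | zero =>
    rw [h.zero 2 h.two_lt]
    exact .refl
  | succ i ih =>
    have hne : F i 2 ≠ 0 := by
      intro h0
      apply hF
      rw [h.succ i hi 2 h.two_lt, extend, decide_eq_true rfl, cond_true, h0, leave]
      have : ∀ t, rounds (gs i) (F i) t 0 = 0 := by
        intro t
        induction t with
        | zero => rfl
        | succ t iht => rw [rounds_succ, iht, roundTrip, (h.action i hi).dead]; rfl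
      rw [this, (h.action i hi).dead]
      rfl
    refine (ih (by omega) hne).trans ?_
    have he : F (i + 1) 2 = leave s (gs i) (F i) (F i 2) := by
      rw [h.succ i hi 2 h.two_lt, extend, decide_eq_true rfl, cond_true]
    rw [he] at hF ⊢
    refine h.reach_leave hi (h.lt _ _) (fun j hj => ?_) hF
    subst hj
    exact h.reach_state j (by omega)

/-- Completeness of the computation of the rounds at one position: a machine that eventually stops
cannot be in the same state in two different rounds, so `s` rounds suffice. -/
theorem leave_of_reach {i q : ℕ} (hi : i < r) (hq : q < s)
    (ih : ∀ j, i = j + 1 → ∀ p < s, p ≠ 2 → Reach (tapeStep gs r) (p, j) (1, r) →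
      Reach (tapeStep gs r) (p, j) (F i p, i))
    (ht : Reach (tapeStep gs r) (q, i) (1, r)) :
    Reach (tapeStep gs r) (q, i) (leave s (gs i) (F i) q, i + 1) := by
  have hterm : tapeStep gs r (1, r) = none := tapeStep_none
  have hstep : ∀ p < s, Reach (tapeStep gs r) (p, i) (1, r) → (gs i p).2 = false →
      ∃ c, tapeStep gs r (p, i) = some c ∧ Reach (tapeStep gs r) c (F i (gs i p).1, i) := by
    intro p hp hpt hd
    cases i with
    | zero =>
      have h0 : tapeStep gs r (p, 0) = none := by simp [tapeStep, hi, hd]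
      have := hpt.of_terminal h0
      cases this
      omega
    | succ j =>
      have h1 := tapeStep_left hi hd
      exact ⟨_, h1, ih j rfl _ ((h.action _ hi).lt p hp) ((h.action _ hi).ne p)
        (hpt.step hterm h1)⟩
  have hround : ∀ p < s, Reach (tapeStep gs r) (p, i) (1, r) →
      Reach (tapeStep gs r) (p, i) (roundTrip (gs i) (F i) p, i) := by
    intro p hp hpt
    rw [roundTrip]
    cases hd : (gs i p).2
    · obtain ⟨c, hc, hc'⟩ := hstep p hp hpt hd
      exact .head hc hc'
    · exact .refl
  have hreach : ∀ t, Reach (tapeStep gs r) (q, i) (rounds (gs i) (F i) t q, i) := by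
    intro t
    induction t with
    | zero => exact .refl
    | succ t iht =>
      exact iht.trans (hround _ (h.rounds_lt hq t) (ht.trans_terminal hterm iht))
  have hbetween : ∀ t u, Reach (tapeStep gs r) (rounds (gs i) (F i) t q, i)
      (rounds (gs i) (F i) (t + u) q, i) := by
    intro t u
    induction u with
    | zero => exact .refl
    | succ u ihu =>
      exact ihu.trans (hround _ (h.rounds_lt hq _) (ht.trans_terminal hterm (hreach _)))
  cases hd : (gs i (rounds (gs i) (F i) s q)).2
  · exfalso
    have hall : ∀ u t, t + u = s → (gs i (rounds (gs i) (F i) t q)).2 = false := by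
      intro u
      induction u with
      | zero =>
        rintro t rfl
        exact hd
      | succ u ihu =>
        intro t htu
        have h1 := ihu (t + 1) (by omega)
        cases h2 : (gs i (rounds (gs i) (F i) t q)).2
        · rfl
        · rw [rounds_succ, roundTrip, h2, cond_true, h2] at h1
          cases h1
    obtain ⟨a, b, hab, he⟩ := Fintype.exists_ne_map_eq_of_card_lt
      (fun t : Fin (s + 1) => (⟨rounds (gs i) (F i) t q, h.rounds_lt hq t⟩ : Fin s)) (by simp)
    have key : ∀ a b : ℕ, a < b → b ≤ s → rounds (gs i) (F i) a q = rounds (gs i) (F i) b q →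
        False := by
      intro a b hlt hb he
      have hta := ht.trans_terminal hterm (hreach a)
      obtain ⟨c, hc, hc'⟩ := hstep _ (h.rounds_lt hq a) hta (hall (s - a) a (by omega))
      refine hta.acyclic hterm hc (hc'.trans ?_)
      have hsucc : F i (gs i (rounds (gs i) (F i) a q)).1 = rounds (gs i) (F i) (a + 1) q := by
        rw [rounds_succ, roundTrip, hall (s - a) a (by omega), cond_false]
      rw [hsucc]
      have := hbetween (a + 1) (b - (a + 1))
      rw [show a + 1 + (b - (a + 1)) = b by omega, ← he] at this
      exact this
    have he' : rounds (gs i) (F i) a q = rounds (gs i) (F i) b q := congrArg Fin.val he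
    rcases lt_or_gt_of_ne (fun hv => hab (Fin.ext hv) : (a : ℕ) ≠ b) with hlt | hlt
    · exact key a b hlt (by omega) he'
    · exact key b a hlt (by omega) he'.symm
  · rw [leave, hd, cond_true]
    exact (hreach s).tail (tapeStep_right hi hd)

theorem state_of_reach (i : ℕ) (hi : i < r) : ∀ q < s, q ≠ 2 →
    Reach (tapeStep gs r) (q, i) (1, r) →
    Reach (tapeStep gs r) (q, i) (F (i + 1) q, i + 1) := by
  induction i with
  | zero =>
    intro q hq hq2 ht
    rw [h.succ 0 hi q hq, extend, decide_eq_false hq2, cond_false]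
    exact h.leave_of_reach hi hq (fun j hj => by omega) ht
  | succ i ih =>
    intro q hq hq2 ht
    rw [h.succ _ hi q hq, extend, decide_eq_false hq2, cond_false]
    refine h.leave_of_reach hi hq (fun j hj => ?_) ht
    obtain rfl : i = j := by omega
    exact ih (by omega)

theorem start_of_reach (i : ℕ) (hi : i ≤ r) (ht : Reach (tapeStep gs r) (q₀, 0) (1, r)) :
    Reach (tapeStep gs r) (q₀, 0) (F i 2, i) := by
  induction i with
  | zero =>
    rw [h.zero 2 h.two_lt]
    exact .refl
  | succ i ih =>
    have hr := ih (by omega)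
    refine hr.trans ?_
    rw [h.succ i hi 2 h.two_lt, extend, decide_eq_true rfl, cond_true]
    refine h.leave_of_reach hi (h.lt _ _) (fun j hj => ?_) (ht.trans_terminal tapeStep_none hr)
    subst hj
    exact h.state_of_reach j (by omega)

/-- The behaviour of the whole tape tells whether the machine leaves it in the state `1`. -/
theorem eq_one_iff : F r 2 = 1 ↔ Reach (tapeStep gs r) (q₀, 0) (1, r) := by
  refine ⟨fun h1 => ?_, fun ht => ?_⟩
  · have := h.reach_start r le_rfl (by omega)
    rwa [h1] at this
  · have := (ht.trans_terminal tapeStep_none (h.start_of_reach r le_rfl ht)).of_terminal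
      tapeStep_none
    exact congrArg Prod.fst this

end IsBehaviour

end Behaviour

/-! ### Visited configurations of two-way transducers -/

namespace TwoWay

variable {A : Type u} {L : Type v} (T : TwoWay A L) (w : List A)

open Classical in
/-- The steps of a transducer, which stops in accepting configurations, without their labels. -/
noncomputable def step' (c : Fin T.n × ℕ) : Option (Fin T.n × ℕ) :=
  if T.IsAccepting w c then none else (T.next w c).map Prod.fst

/-- The run from the initial configuration visits the configuration `c`. -/
def Visits (c : Fin T.n × ℕ) : Prop := Reach (T.step' w) (T.init, 0) c

/-- The transducer has an accepting run. -/
def Accepts : Prop := ∃ c, T.Visits w c ∧ T.IsAccepting w c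

variable {T w}

theorem step'_none {c : Fin T.n × ℕ} (h : T.IsAccepting w c) : T.step' w c = none := if_pos h

theorem step'_some {c c' : Fin T.n × ℕ} :
    T.step' w c = some c' ↔ ¬ T.IsAccepting w c ∧ ∃ lab, T.next w c = some (c', lab) := by
  unfold step'
  split_ifs with h <;> simp [h]

theorem next_le {c c' : Fin T.n × ℕ} {lab : L} (hc : c.2 ≤ w.length + 1)
    (h : T.next w c = some (c', lab)) : c'.2 ≤ w.length + 1 := by
  unfold next at h
  rcases hs : T.step c.1 (tapeAt w c.2) with _ | ⟨⟨q, _ | _⟩, l⟩ <;> rw [hs] at h <;>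
    simp only at h
  · cases h
  · split_ifs at h
    cases h
    simp only
    omega
  · split_ifs at h
    cases h
    simp only
    omega

/-- The output of the step that is taken from the configuration `c`. -/
def stepValue (T : TwoWay A L) (w : List A) (ν : L → ℕ → ℕ) (c : Fin T.n × ℕ) : ℕ :=
  (T.step c.1 (tapeAt w c.2)).elim 0 fun r => ν r.2 c.2

theorem stepValue_eq {ν : L → ℕ → ℕ} {c c' : Fin T.n × ℕ} {lab : L}
    (h : T.next w c = some (c', lab)) : stepValue T w ν c = ν lab c.2 := by
  unfold next at h
  unfold stepValue
  rcases hs : T.step c.1 (tapeAt w c.2) with _ | ⟨⟨q, _ | _⟩, l⟩ <;> rw [hs] at h <;>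
    simp only at h
  · cases h
  · split_ifs at h
    cases h
    rfl
  · split_ifs at h
    cases h
    rfl

open Classical in
/-- The sum along an accepting run is the sum over the set of the visited configurations, as no
configuration is visited twice. -/
theorem AcceptingRun.eq_sum {ν : L → ℕ → ℕ} {c : Fin T.n × ℕ} {s : ℕ}
    (h : T.AcceptingRun w ν c s) (hc : c.2 ≤ w.length + 1) :
    (∃ d, Reach (T.step' w) c d ∧ T.IsAccepting w d) ∧
    s = ∑ i ∈ Finset.range (w.length + 2), ∑ q : Fin T.n,
      if Reach (T.step' w) c (q, i) ∧ ¬ T.IsAccepting w (q, i) then stepValue T w ν (q, i)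
      else 0 := by
  induction h with
  | @halt c h =>
    refine ⟨⟨c, .refl, h⟩, (Finset.sum_eq_zero fun i _ => Finset.sum_eq_zero fun q _ => ?_).symm⟩
    rw [if_neg]
    rintro ⟨h1, h2⟩
    rw [← Reach.of_terminal h1 (step'_none h)] at h2
    exact h2 h
  | @move c c' lab s h hn hs ih =>
    obtain ⟨⟨d, hd, hacc⟩, hsum⟩ := ih (next_le hc hn)
    have hstep : T.step' w c = some c' := step'_some.2 ⟨h, lab, hn⟩
    refine ⟨⟨d, .head hstep hd, hacc⟩, ?_⟩
    have hnot : ¬ Reach (T.step' w) c' c := fun hcc =>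
      Reach.acyclic (.head hstep hd) (step'_none hacc) hstep hcc
    have hval : ν lab c.2 = ∑ i ∈ Finset.range (w.length + 2), ∑ q : Fin T.n,
        if (q, i) = c then stepValue T w ν (q, i) else 0 := by
      rw [Finset.sum_eq_single c.2, Finset.sum_eq_single c.1, if_pos rfl, stepValue_eq hn]
      · exact fun q _ hq => if_neg fun he => hq (congrArg Prod.fst he)
      · exact fun hq => absurd (Finset.mem_univ _) hq
      · exact fun i _ hi => Finset.sum_eq_zero fun q _ => if_neg fun he => hi (congrArg Prod.snd he)
      · exact fun hi => absurd (Finset.mem_range.2 (by omega)) hi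
    rw [hsum, hval, ← Finset.sum_add_distrib]
    refine Finset.sum_congr rfl fun i _ => ?_
    rw [← Finset.sum_add_distrib]
    refine Finset.sum_congr rfl fun q _ => ?_
    have hiff : Reach (T.step' w) c (q, i) ↔ (q, i) = c ∨ Reach (T.step' w) c' (q, i) := by
      refine ⟨fun hr => ?_, ?_⟩
      · rcases Relation.ReflTransGen.cases_head hr with rfl | ⟨b, hb, hbr⟩
        · exact .inl rfl
        · rw [hstep] at hb
          cases hb
          exact .inr hbr
      · rintro (rfl | hr)
        · exact .refl
        · exact .head hstep hr
    by_cases he : (q, i) = c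
    · rw [if_pos he, if_neg (by rw [he]; exact fun hh => hnot hh.1),
        if_pos ⟨hiff.2 (.inl he), by rw [he]; exact h⟩, Nat.add_zero]
    · rw [if_neg he, Nat.zero_add]
      exact if_congr (by simp [hiff, he]) rfl rfl

theorem exists_acceptingRun {ν : L → ℕ → ℕ} {c d : Fin T.n × ℕ} (h : Reach (T.step' w) c d)
    (hd : T.IsAccepting w d) : ∃ s, T.AcceptingRun w ν c s := by
  induction h using Relation.ReflTransGen.head_induction_on with
  | refl => exact ⟨0, .halt hd⟩
  | head h _ ih =>
    obtain ⟨h1, lab, hl⟩ := step'_some.1 h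
    obtain ⟨s, hs⟩ := ih
    exact ⟨_, .move h1 hl hs⟩

open Classical in
/-- The value of a transducer is a sum over the set of the visited configurations. -/
theorem output_eq_sum (ν : L → ℕ → ℕ) : T.output w ν =
    if T.Accepts w then ∑ i ∈ Finset.range (w.length + 2), ∑ q : Fin T.n,
      if T.Visits w (q, i) ∧ ¬ T.IsAccepting w (q, i) then stepValue T w ν (q, i) else 0
    else 0 := by
  split_ifs with h
  · obtain ⟨d, hd, hacc⟩ := h
    obtain ⟨s, hs⟩ := exists_acceptingRun (ν := ν) hd hacc
    rw [output_eq hs]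
    exact (hs.eq_sum (Nat.zero_le _)).2
  · rw [output, dif_neg]
    rintro ⟨s, hs⟩
    exact h (hs.eq_sum (Nat.zero_le _)).1

/-- The moves of all states on a tape symbol. -/
def column (T : TwoWay A L) (t : TapeSymbol A) : List (Option (ℕ × Bool)) :=
  List.ofFn fun q : Fin T.n => (T.step q t).map fun r => ((r.1.1 : ℕ), r.1.2.toBool)

/-- The list that tells for each state whether it is final. -/
def finals (T : TwoWay A L) : List Bool := List.ofFn fun q : Fin T.n => decide (q ∈ T.final)

end TwoWay

/-- The action of a tape symbol with the given column of moves, on states that are shifted by `3`.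
In the states of `marks` the machine succeeds, which is the state `1`; in the other states of
`halting` it fails, which is the state `0`, and if `atEnd` is true, then it also fails if it has to
move to the right. -/
def action (column : List (Option (ℕ × Bool))) (halting marks : List Bool) (atEnd : Bool) (q : ℕ) :
    ℕ × Bool :=
  bif decide (q = 1) then (1, true)
  else bif decide (q < 3) then (0, true)
  else bif marks.getD (q - 3) false then (1, true)
  else bif halting.getD (q - 3) false then (0, true)
  else (column.getD (q - 3) none).elim (0, true) fun r =>
    bif atEnd && r.2 then (0, true) else (r.1 + 3, r.2)

namespace TwoWay

variable {A : Type u} {L : Type v} (T : TwoWay A L) (w : List A) (M : ℕ → List Bool)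

theorem isAction_action (t : TapeSymbol A) (halting marks : List Bool) (atEnd : Bool) {s : ℕ}
    (hs : T.n + 3 ≤ s) : IsAction s (action (T.column t) halting marks atEnd) := by
  have key : ∀ q, (action (T.column t) halting marks atEnd q).1 < s ∧
      (action (T.column t) halting marks atEnd q).1 ≠ 2 := by
    intro q
    unfold action
    cases decide (q = 1)
    · cases decide (q < 3)
      · cases marks.getD (q - 3) false
        · cases halting.getD (q - 3) false
          · simp only [cond_false]
            by_cases hq : q - 3 < T.n
            · simp only [column, List.getD_eq_getElem?_getD, List.length_ofFn, hq,
                getElem?_pos, List.getElem_ofFn, Option.getD_some]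
              rcases T.step ⟨q - 3, hq⟩ t with _ | ⟨⟨q', d⟩, l⟩
              · simp; omega
              · have := q'.2
                simp only [Option.map_some, Option.elim_some]
                cases (atEnd && d.toBool) <;> simp <;> omega
            · simp [column, List.getD_eq_getElem?_getD, hq]; omega
          · simp; omega
        · simp; omega
      · simp; omega
    · simp; omega
  exact ⟨rfl, fun q _ => (key q).1, fun q => (key q).2⟩

/-- The action of the cell `i` of the tape that contains `w`, with the set `M i` of marked
states. -/
def cellAction (i : ℕ) : ℕ → ℕ × Bool :=
  action (T.column (tapeAt w i)) (bif decide (i = w.length + 1) then T.finals else []) (M i)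
    (decide (i = w.length + 1))

variable {T w M}

theorem cellAction_marked {q : Fin T.n} {i : ℕ} (h : (M i).getD q false = true) :
    T.cellAction w M i (q + 3) = (1, true) := by
  simp only [cellAction, action, Nat.add_sub_cancel, h]
  simp

theorem cellAction_stop {q : Fin T.n} {i : ℕ} (h : (M i).getD q false = false)
    (hacc : T.IsAccepting w (q, i)) : T.cellAction w M i (q + 3) = (0, true) := by
  obtain ⟨rfl, h2⟩ := hacc
  simp only [cellAction, action, Nat.add_sub_cancel, h]
  simp [finals, List.getD_eq_getElem?_getD, show q ∈ T.final from h2]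

theorem cellAction_move {q : Fin T.n} {i : ℕ} (h : (M i).getD q false = false)
    (hacc : ¬ T.IsAccepting w (q, i)) : T.cellAction w M i (q + 3) =
      ((T.step q (tapeAt w i)).elim (0, true) fun r =>
        bif decide (i = w.length + 1) && r.1.2.toBool then (0, true)
        else ((r.1.1 : ℕ) + 3, r.1.2.toBool)) := by
  have hf : ((bif decide (i = w.length + 1) then T.finals else []) : List Bool).getD q false =
      false := by
    by_cases hi : i = w.length + 1
    · have : q ∉ T.final := fun hq => hacc ⟨hi, hq⟩
      simp [hi, finals, List.getD_eq_getElem?_getD, this]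
    · simp [hi]
  simp only [cellAction, action, Nat.add_sub_cancel, h, hf]
  have h1 : decide ((q : ℕ) + 3 = 1) = false := by simp
  have h2 : decide ((q : ℕ) + 3 < 3) = false := by simp
  simp only [h1, h2, cond_false, column, List.getD_eq_getElem?_getD, List.length_ofFn, q.2,
    getElem?_pos, List.getElem_ofFn, Option.getD_some]
  rcases T.step q (tapeAt w i) with _ | r <;> rfl

theorem reach_hit {r : ℕ} (h : ∀ i, (T.cellAction w M i 1) = (1, true)) (i : ℕ) (hi : i ≤ r) :
    Reach (tapeStep (T.cellAction w M) r) (1, i) (1, r) := by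
  obtain ⟨d, rfl⟩ := Nat.exists_eq_add_of_le hi
  clear hi
  induction d generalizing i with
  | zero => exact .refl
  | succ d ih =>
    refine .head (tapeStep_right (by omega) (by rw [h])) ?_
    rw [h, show i + (d + 1) = i + 1 + d by omega]
    exact ih _

theorem not_reach_of_dead {r : ℕ} {gs : ℕ → ℕ → ℕ × Bool} (h : ∀ i, gs i 0 = (0, true)) {i : ℕ}
    {c : ℕ × ℕ} (hc : Reach (tapeStep gs r) (0, i) c) : c.1 = 0 := by
  induction hc with
  | refl => rfl
  | @tail b c _ hbc ih =>
    obtain ⟨b1, b2⟩ := b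
    simp only at ih
    subst ih
    unfold tapeStep at hbc
    rw [h] at hbc
    split_ifs at hbc <;> simp_all
    rw [← hbc]

/-- The machine with marked configurations succeeds if and only if the transducer visits some
marked configuration. -/
theorem reach_marked_iff : Reach (tapeStep (T.cellAction w M) (w.length + 2)) (T.init + 3, 0)
    (1, w.length + 2) ↔ ∃ c, T.Visits w c ∧ (M c.2).getD c.1 false = true := by
  constructor
  · intro h
    have key : ∀ p, Reach (tapeStep (T.cellAction w M) (w.length + 2)) p (1, w.length + 2) →
        ∀ c : Fin T.n × ℕ, p = ((c.1 : ℕ) + 3, c.2) →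
        ∃ d, Reach (T.step' w) c d ∧ (M d.2).getD d.1 false = true := by
      intro p hp
      induction hp using Relation.ReflTransGen.head_induction_on with
      | refl =>
        intro c hc
        have := congrArg Prod.fst hc
        simp at this
      | @head p p' hpp hp' ih =>
        rintro ⟨q, i⟩ rfl
        cases hm : (M i).getD q false
        · have hdead : p'.1 ≠ 0 := by
            intro h0
            obtain ⟨p1, p2⟩ := p'
            simp only at h0
            subst h0
            have := not_reach_of_dead (fun i => rfl) hp'
            simp at this
          simp only [tapeStep] at hpp
          split_ifs at hpp with hi hd h0
          · cases hpp
            by_cases hacc : T.IsAccepting w (q, i)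
            · rw [cellAction_stop hm hacc] at hdead
              exact absurd rfl hdead
            · have hmove := cellAction_move (M := M) hm hacc
              rw [hmove] at hdead hd ih
              rcases hs : T.step q (tapeAt w i) with _ | ⟨⟨q', _ | _⟩, l⟩
              · rw [hs] at hdead
                exact absurd rfl hdead
              · rw [hs] at hd
                simp [Dir.toBool] at hd
              · by_cases hi' : i = w.length + 1
                · rw [hs] at hdead
                  simp [hi', Dir.toBool] at hdead
                · obtain ⟨d, hd1, hd2⟩ := ih (q', i + 1) (by simp [hs, hi'])
                  refine ⟨d, .head (step'_some.2 ⟨hacc, l, ?_⟩) hd1, hd2⟩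
                  simp [next, hs, hi']
          · cases hpp
            by_cases hacc : T.IsAccepting w (q, i)
            · rw [cellAction_stop hm hacc] at hdead
              exact absurd rfl hdead
            · have hmove := cellAction_move (M := M) hm hacc
              rw [hmove] at hdead hd ih
              rcases hs : T.step q (tapeAt w i) with _ | ⟨⟨q', _ | _⟩, l⟩
              · rw [hs] at hdead
                exact absurd rfl hdead
              · obtain ⟨d, hd1, hd2⟩ := ih (q', i - 1) (by simp [hs, Dir.toBool])
                refine ⟨d, .head (step'_some.2 ⟨hacc, l, ?_⟩) hd1, hd2⟩
                simp [next, hs, h0]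
              · rw [hs] at hd
                by_cases hi' : i = w.length + 1 <;> simp [hi', Dir.toBool] at hd
        · exact ⟨(q, i), .refl, hm⟩
    exact key _ h (T.init, 0) rfl
  · rintro ⟨d, hd, hm⟩
    have key : ∀ c : Fin T.n × ℕ, Reach (T.step' w) c d → c.2 ≤ w.length + 1 →
        Reach (tapeStep (T.cellAction w M) (w.length + 2)) ((c.1 : ℕ) + 3, c.2)
          (1, w.length + 2) := by
      intro c hc
      induction hc using Relation.ReflTransGen.head_induction_on with
      | refl =>
        intro hle
        refine .head (tapeStep_right (by omega) (by rw [cellAction_marked hm])) ?_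
        rw [cellAction_marked hm]
        exact reach_hit (fun i => rfl) _ (by omega)
      | @head c c' hcc _ ih =>
        intro hle
        obtain ⟨q, i⟩ := c
        simp only at hle
        cases hmc : (M i).getD q false
        · obtain ⟨hacc, l, hl⟩ := step'_some.1 hcc
          have ih' := ih (next_le hle hl)
          have hmove := cellAction_move (M := M) hmc hacc
          refine .head ?_ ih'
          simp only [next] at hl
          rcases hs : T.step q (tapeAt w i) with _ | ⟨⟨q', _ | _⟩, l'⟩ <;> rw [hs] at hl hmove <;>
            simp only at hl
          · cases hl
          · split_ifs at hl with h0
            cases hl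
            simp [tapeStep, hmove, Dir.toBool, h0]
            omega
          · split_ifs at hl with h0
            cases hl
            simp [tapeStep, hmove, Dir.toBool, h0]
            omega
        · refine .head (tapeStep_right (by simp only; omega) (by rw [cellAction_marked hmc])) ?_
          simp only
          rw [cellAction_marked hmc]
          exact reach_hit (fun i => rfl) _ (by omega)
    exact key _ hd (Nat.zero_le _)

end TwoWay

/-! ### The bimachine of a list of transducers -/

/-- The moves of all states of a two-way machine on one tape symbol. -/
abbrev Column : Type := List (Option (ℕ × Bool))

/-- What a bimachine has to know about a two-way machine, apart from its moves on letters: the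
number of states, the initial state, the final states, and the moves on the left and on the right
mark. -/
abbrev Skeleton : Type := ℕ × ℕ × List Bool × Column × Column

/-- The number that encodes the behaviour of a prefix extended by a cell with action `g`, computed
from the number `x` that encodes the behaviour of the prefix. -/
def update (s : ℕ) (g : ℕ → ℕ × Bool) (x : ℕ) : ℕ := encFun s s (extend s g (digit s x))

/-- The code of the behaviour of the empty prefix. -/
def startCode (s q₀ : ℕ) : ℕ := encFun s s (emptyBehaviour q₀)

/-- The change of the behaviour by a letter with moves `c`; there is no change if the letter is
erased. -/
def letterUpdate (s : ℕ) (c : Option Column) (marks : List Bool) (x : ℕ) : ℕ :=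
  c.elim x fun col => update s (action col [] marks false) x

/-- The transitions of a one-way automaton. Its state `2 + t + τ * x` stands for the behaviour
encoded by `x` of the machine number `t` of a list of `τ` machines; its states `0` and `1` tell
whether the word read so far is empty. -/
def letterMap (s τ : ℕ) (cols : List (Option Column)) (z : ℕ) : ℕ :=
  bif decide (z < 2) then 1
  else 2 + (z - 2) % τ + τ * letterUpdate s (cols.getD ((z - 2) % τ) none) [] ((z - 2) / τ)

/-- The change of the behaviour of the machine number `t` by a word that acts on the states of the
one-way automaton by the map encoded by `u`. -/
def wordUpdate (m τ u t x : ℕ) : ℕ := (digit m u (2 + t + τ * x) - 2) / τ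

/-- Whether the machine number `t` visits a marked configuration on a word `w₁ a w₂`, where `u` and
`v` are the images of `w₁` and `w₂`, `c` is the column of `a`, and `markL`, `mark` and `markR` are
the sets of marked states on the left mark, on the letter `a` and on the right mark. -/
def succeeds (s m τ t : ℕ) (sk : Skeleton) (c : Option Column) (u v : ℕ)
    (markL mark markR : List Bool) : Bool :=
  decide (digit s (update s (action sk.2.2.2.2 sk.2.2.1 markR true)
    (wordUpdate m τ v t (letterUpdate s c mark (wordUpdate m τ u t
      (update s (action sk.2.2.2.1 [] markL false) (startCode s (sk.2.1 + 3))))))) 2 = 1)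

/-- The set that contains only the state `q`. -/
def single (q : ℕ) : List Bool := (List.range (q + 1)).map fun i => decide (i = q)

/-- The transitions of the machine number `t` that are charged to the letter `a` of `w₁ a w₂`: those
taken on this letter, those taken on the left mark if `w₁` is empty, and those taken on the right
mark if `w₂` is empty. A transition is a triple of `t`, the kind of the position (`0` for the left
mark, `1` for the letter, `2` for the right mark) and the state. -/
def machineRefs (s m τ t : ℕ) (sk : Skeleton) (c : Option Column) (u v : ℕ) :
    List (ℕ × ℕ × ℕ) :=
  bif succeeds s m τ t sk c u v [] [] sk.2.2.1 then
    (c.elim [] fun _ => ((List.range sk.1).filter fun q =>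
      succeeds s m τ t sk c u v [] (single q) []).map fun q => (t, 1, q)) ++
    ((bif decide (digit m u 0 = 0) then ((List.range sk.1).filter fun q =>
      succeeds s m τ t sk c u v (single q) [] []).map fun q => (t, 0, q) else []) ++
    (bif decide (digit m v 0 = 0) then ((List.range sk.1).filter fun q =>
      succeeds s m τ t sk c u v [] [] (single q) && !sk.2.2.1.getD q false).map fun q => (t, 2, q)
      else []))
  else []

/-- A bound for the states in the behaviours of all machines. -/
def stateBound (sks : List Skeleton) : ℕ := 3 + (sks.map fun sk => sk.1).sum

/-- The number of states of the one-way automaton. -/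
def autSize (sks : List Skeleton) : ℕ :=
  sks.length * stateBound sks ^ stateBound sks + 2

/-- The transitions of all machines that are charged to a letter. -/
def allRefs (sks : List Skeleton) (cols : List (Option Column)) (u v : ℕ) :
    List (ℕ × ℕ × ℕ) :=
  (List.range sks.length).flatMap fun t =>
    machineRefs (stateBound sks) (autSize sks) sks.length t (sks.getD t (0, 0, [], [], []))
      (cols.getD t none) u v

/-- The product in the monoid of all maps from `{0, …, m - 1}` to itself; the left factor is
applied first. -/
def mapMul (m x y : ℕ) : ℕ := encFun m m fun z => digit m y (digit m x z)

/-- The neutral element of the monoid of all maps from `{0, …, m - 1}` to itself. -/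
def mapOne (m : ℕ) : ℕ := encFun m m fun z => z

theorem mapMul_assoc {m : ℕ} (hm : 0 < m) (x y z : ℕ) :
    mapMul m (mapMul m x y) z = mapMul m x (mapMul m y z) := by
  refine encFun_congr fun i hi => ?_
  rw [mapMul, digit_encFun hm hi, Nat.mod_eq_of_lt (digit_lt hm _ _), mapMul,
    digit_encFun hm (digit_lt hm _ _), Nat.mod_eq_of_lt (digit_lt hm _ _)]

theorem mapOne_mul {m : ℕ} (hm : 0 < m) {x : ℕ} (hx : x < m ^ m) : mapMul m (mapOne m) x = x := by
  refine Eq.trans (encFun_congr (g := digit m x) fun i hi => ?_)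
    ((encFun_digit m m x).trans (Nat.mod_eq_of_lt hx))
  rw [mapOne, digit_encFun hm hi, Nat.mod_eq_of_lt hi]

theorem mapMul_one {m : ℕ} (hm : 0 < m) {x : ℕ} (hx : x < m ^ m) : mapMul m x (mapOne m) = x := by
  refine Eq.trans (encFun_congr (g := digit m x) fun i hi => ?_)
    ((encFun_digit m m x).trans (Nat.mod_eq_of_lt hx))
  rw [mapOne, digit_encFun hm (digit_lt hm _ _), Nat.mod_eq_of_lt (digit_lt hm _ _)]

theorem autSize_pos (sks : List Skeleton) : 0 < autSize sks := by
  unfold autSize; omega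

section Machines

variable {A : Type u} {L : Type v} {L' : Type w}

/-- The skeleton of a transducer. -/
def TwoWay.skeleton (T : TwoWay A L) : Skeleton :=
  (T.n, (T.init : ℕ), T.finals, T.column .leftMark, T.column .rightMark)

/-- A list of transducers. Each comes with a substitution of letters, which is applied to the input
word first, or with `none`, which means that the input word is replaced by the empty word. -/
abbrev Machines (A : Type u) (L : Type v) : Type (max u v) := List (Option (A → A) × TwoWay A L)

/-- The word that is read by a transducer that comes with the substitution `h`. -/
def substWord (h : Option (A → A)) (w : List A) : List A := h.elim [] fun h => w.map h

namespace Machines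

variable (l : Machines A L)

/-- The skeletons of all machines. -/
def skeletons : List Skeleton := l.map fun e => e.2.skeleton

/-- The columns of the images of the letter `a` in all machines; `none` if `a` is erased. -/
def columns (a : A) : List (Option Column) :=
  l.map fun e => e.1.map fun h => e.2.column (.letter (h a))

/-- The bimachine whose monoid consists of all maps on the states of the one-way automaton. The
label `lab a refs` is output at the letter `a` if the transitions `refs` are charged to it. -/
def toBimachine (lab : A → List (ℕ × ℕ × ℕ) → L') : Bimachine A L' where
  n := autSize l.skeletons ^ autSize l.skeletons
  mul x y := ⟨mapMul (autSize l.skeletons) x y, encFun_lt (autSize_pos _) _ _⟩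
  one := ⟨mapOne (autSize l.skeletons), encFun_lt (autSize_pos _) _ _⟩
  mul_assoc x y z := Fin.ext (mapMul_assoc (autSize_pos _) x y z)
  one_mul x := Fin.ext (mapOne_mul (autSize_pos _) x.2)
  mul_one x := Fin.ext (mapMul_one (autSize_pos _) x.2)
  letterImage a := ⟨encFun (autSize l.skeletons) (autSize l.skeletons)
    (letterMap (stateBound l.skeletons) l.skeletons.length (l.columns a)),
    encFun_lt (autSize_pos _) _ _⟩
  out x a y := lab a (allRefs l.skeletons (l.columns a) x y)

/-- The change of the behaviour of the machine `e` by a word. -/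
def foldUpdate (s : ℕ) (e : Option (A → A) × TwoWay A L) (x : ℕ) (w : List A) : ℕ :=
  w.foldl (fun x a => letterUpdate s (e.1.map fun h => e.2.column (.letter (h a))) [] x) x

theorem letterUpdate_lt {s x : ℕ} (hs : 0 < s) (c : Option Column) (marks : List Bool)
    (hx : x < s ^ s) : letterUpdate s c marks x < s ^ s := by
  cases c with
  | none => exact hx
  | some col => exact encFun_lt hs _ _

theorem foldUpdate_lt {s x : ℕ} (hs : 0 < s) (e : Option (A → A) × TwoWay A L) (hx : x < s ^ s)
    (w : List A) : foldUpdate s e x w < s ^ s := by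
  induction w generalizing x with
  | nil => exact hx
  | cons a w ih => exact ih (letterUpdate_lt hs _ _ hx)

variable {l} {lab : A → List (ℕ × ℕ × ℕ) → L'}

theorem stateBound_pos (sks : List Skeleton) : 0 < stateBound sks := by
  unfold stateBound; omega

theorem state_lt {τ t x S : ℕ} (ht : t < τ) (hx : x < S) : 2 + t + τ * x < τ * S + 2 := by
  have : τ * (x + 1) ≤ τ * S := Nat.mul_le_mul_left τ hx
  rw [Nat.mul_add] at this
  omega

theorem div_state {τ t x : ℕ} (ht : t < τ) : (2 + t + τ * x - 2) / τ = x := by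
  rw [show 2 + t + τ * x - 2 = t + τ * x by omega, Nat.add_mul_div_left _ _ (by omega),
    Nat.div_eq_of_lt ht, Nat.zero_add]

theorem mod_state {τ t x : ℕ} (ht : t < τ) : (2 + t + τ * x - 2) % τ = t := by
  rw [show 2 + t + τ * x - 2 = t + τ * x by omega, Nat.add_mul_mod_self_left, Nat.mod_eq_of_lt ht]

theorem digit_mu_nil {z : ℕ} (hz : z < autSize l.skeletons) :
    digit (autSize l.skeletons) ((l.toBimachine lab).mu []) z = z :=
  (digit_encFun (autSize_pos _) hz _).trans (Nat.mod_eq_of_lt hz)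

theorem digit_mu_cons {z : ℕ} (hz : z < autSize l.skeletons) (a : A) (u : List A) :
    digit (autSize l.skeletons) ((l.toBimachine lab).mu (a :: u)) z =
      digit (autSize l.skeletons) ((l.toBimachine lab).mu u)
        (letterMap (stateBound l.skeletons) l.skeletons.length (l.columns a) z %
          autSize l.skeletons) := by
  have hm := autSize_pos l.skeletons
  refine (digit_encFun hm hz _).trans ((Nat.mod_eq_of_lt (digit_lt hm _ _)).trans ?_)
  exact congrArg _ (digit_encFun hm hz _)

theorem digit_mu (u : List A) {t x : ℕ} (ht : t < l.length)
    (hx : x < stateBound l.skeletons ^ stateBound l.skeletons) :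
    digit (autSize l.skeletons) ((l.toBimachine lab).mu u) (2 + t + l.length * x) =
      2 + t + l.length * foldUpdate (stateBound l.skeletons) l[t] x u := by
  have hlen : l.skeletons.length = l.length := List.length_map _
  have hlt : ∀ {y}, y < stateBound l.skeletons ^ stateBound l.skeletons →
      2 + t + l.length * y < autSize l.skeletons := fun hy => by
    have := state_lt ht hy
    rwa [← hlen, ← autSize, hlen] at this
  induction u generalizing x with
  | nil => exact digit_mu_nil (hlt hx)
  | cons a u ih =>
    have hx' := letterUpdate_lt (stateBound_pos l.skeletons)
      (l[t].1.map fun h => l[t].2.column (.letter (h a))) [] hx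
    have hstep : letterMap (stateBound l.skeletons) l.skeletons.length (l.columns a)
        (2 + t + l.length * x) = 2 + t + l.length * letterUpdate (stateBound l.skeletons)
          (l[t].1.map fun h => l[t].2.column (.letter (h a))) [] x := by
      rw [hlen, letterMap, div_state ht, mod_state ht, decide_eq_false (by omega), cond_false]
      simp [columns, List.getD_eq_getElem?_getD, ht]
    rw [digit_mu_cons (hlt hx), hstep, Nat.mod_eq_of_lt (hlt hx'), ih hx']
    rfl

/-- The states `0` and `1` of the one-way automaton tell whether a word is empty. -/
theorem digit_mu_zero (u : List A) :
    digit (autSize l.skeletons) ((l.toBimachine lab).mu u) 0 = 0 ↔ u = [] := by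
  have h2 : 2 ≤ autSize l.skeletons := by unfold autSize; omega
  have hstep : ∀ a z, z < 2 → letterMap (stateBound l.skeletons) l.skeletons.length (l.columns a)
      z % autSize l.skeletons = 1 := fun a z hz => by
    rw [letterMap, decide_eq_true hz, cond_true, Nat.mod_eq_of_lt (by omega)]
  have h1 : ∀ u, digit (autSize l.skeletons) ((l.toBimachine lab).mu u) 1 = 1 := by
    intro u
    induction u with
    | nil => exact digit_mu_nil (by omega)
    | cons a u ih => rw [digit_mu_cons (by omega), hstep a 1 (by omega), ih]
  cases u with
  | nil => rw [digit_mu_nil (by omega)]; simp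
  | cons a u => rw [digit_mu_cons (by omega), hstep a 0 (by omega), h1]; simp

theorem wordUpdate_mu (u : List A) {t x : ℕ} (ht : t < l.length)
    (hx : x < stateBound l.skeletons ^ stateBound l.skeletons) :
    wordUpdate (autSize l.skeletons) l.length ((l.toBimachine lab).mu u) t x =
      foldUpdate (stateBound l.skeletons) l[t] x u := by
  rw [wordUpdate, digit_mu u ht hx, div_state ht]

end Machines

/-- The code of the behaviour of a whole tape tells whether the run reaches the state `1`. -/
theorem digit_foldl_update {s r q₀ : ℕ} {gs : ℕ → ℕ → ℕ × Bool} (hs : 2 < s) (hq : q₀ < s)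
    (hgs : ∀ i < r, IsAction s (gs i)) :
    digit s (((List.range r).map gs).foldl (fun x g => update s g x) (startCode s q₀)) 2 = 1 ↔
      Reach (tapeStep gs r) (q₀, 0) (1, r) := by
  have hs0 : 0 < s := by omega
  refine IsBehaviour.eq_one_iff (F := fun i => digit s
    (((List.range i).map gs).foldl (fun x g => update s g x) (startCode s q₀)))
    ⟨hgs, fun q hq' => ?_, fun i hi q hq' => ?_, fun i q => digit_lt hs0 _ _, hs⟩
  · simp only [List.range_zero, List.map_nil, List.foldl_nil, startCode]
    rw [digit_encFun hs0 hq', Nat.mod_eq_of_lt]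
    unfold emptyBehaviour
    cases decide (q = 2) <;> simp [hq, hs0]
  · simp only [List.range_succ, List.map_append, List.map_cons, List.map_nil, List.foldl_append,
      List.foldl_cons, List.foldl_nil]
    rw [update, digit_encFun hs0 hq', Nat.mod_eq_of_lt]
    exact extend_lt (hgs i hi) (fun p => digit_lt hs0 _ _) hq'

theorem tapeAt_succ {w : List A} {i : ℕ} (hi : i < w.length) : tapeAt w (i + 1) = .letter w[i] := by
  simp [tapeAt, hi]

/-- The list of the actions of all cells, split into its parts. -/
theorem TwoWay.map_cellAction (T : TwoWay A L) (M : ℕ → List Bool) (h : A → A) (u : List A)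
    (a : A) (v : List A) (hM : ∀ i, i ≠ 0 → i ≠ u.length + 1 → i ≠ (u ++ a :: v).length + 1 →
      M i = []) :
    (List.range ((u ++ a :: v).length + 2)).map (T.cellAction ((u ++ a :: v).map h) M) =
      action (T.column .leftMark) [] (M 0) false ::
      (u.map fun b => action (T.column (.letter (h b))) [] [] false) ++
      action (T.column (.letter (h a))) [] (M (u.length + 1)) false ::
      (v.map fun b => action (T.column (.letter (h b))) [] [] false) ++
      [action (T.column .rightMark) T.finals (M ((u ++ a :: v).length + 1)) true] := by
  have key : ∀ i (hi : i < (u ++ a :: v).length), T.cellAction ((u ++ a :: v).map h) M (i + 1) =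
      action (T.column (.letter (h (u ++ a :: v)[i]))) [] (M (i + 1)) false := by
    intro i hi
    have h1 : tapeAt ((u ++ a :: v).map h) (i + 1) = .letter (h (u ++ a :: v)[i]) := by
      rw [tapeAt_succ (by simpa using hi), List.getElem_map]
    rw [TwoWay.cellAction, h1, List.length_map, decide_eq_false (by omega), cond_false]
  rw [List.range_succ, List.range_succ_eq_map, List.map_append, List.map_cons, List.map_map,
    List.map_cons, List.map_nil]
  congr 1
  · rw [List.cons_append]
    congr 1
    refine Eq.trans (List.map_congr_left (g := fun i => if hi : i < (u ++ a :: v).length then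
      action (T.column (.letter (h (u ++ a :: v)[i]))) [] (M (i + 1)) false
      else fun _ => (0, true)) fun i hi => ?_) ?_
    · rw [dif_pos (List.mem_range.1 hi)]
      exact key i (List.mem_range.1 hi)
    · refine List.ext_getElem (by simp) fun i h1 h2 => ?_
      simp only [List.length_map, List.length_range] at h1
      rw [List.getElem_map, List.getElem_range, dif_pos h1]
      rcases lt_trichotomy i u.length with hlt | rfl | hgt
      · rw [hM (i + 1) (by omega) (by omega) (by omega)]
        simp [List.getElem_append_left, hlt]
      · rw [List.getElem_append_right (by simp), List.getElem_append_right (by simp)]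
        simp
      · rw [hM (i + 1) (by omega) (by omega) (by omega)]
        obtain ⟨d, rfl⟩ := Nat.exists_eq_add_of_lt hgt
        rw [List.getElem_append_right (by omega),
          List.getElem_append_right (by rw [List.length_map]; omega)]
        simp [show u.length + d + 1 - u.length = d + 1 by omega]
  · rw [TwoWay.cellAction, decide_eq_true (by simp)]
    have := tapeAt_length ((u ++ a :: v).map h)
    rw [List.length_map] at this
    rw [this]
    rfl

/-- The marks on a tape with a word of length `n`: `markL` and `markR` on the end marks, `mark` on
the cell `i₀`. -/
def marksAt (n i₀ : ℕ) (markL mark markR : List Bool) (i : ℕ) : List Bool :=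
  if i = 0 then markL else if i = n + 1 then markR else if i = i₀ then mark else []

/-- The result of all updates along the tape of `u a v` tells whether the run visits a marked
configuration. -/
theorem TwoWay.digit_foldUpdate_iff (T : TwoWay A L) (h : Option (A → A)) {s : ℕ}
    (hs : T.n + 3 ≤ s) (u : List A) (a : A) (v : List A) (markL mark markR : List Bool) :
    digit s (update s (action (T.column .rightMark) T.finals markR true)
      (Machines.foldUpdate s (h, T) (letterUpdate s (h.map fun h => T.column (.letter (h a))) mark
        (Machines.foldUpdate s (h, T) (update s (action (T.column .leftMark) [] markL false)
          (startCode s (T.init + 3))) u)) v)) 2 = 1 ↔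
    ∃ c, T.Visits (substWord h (u ++ a :: v)) c ∧
      (marksAt (substWord h (u ++ a :: v)).length (u.length + 1) markL mark markR c.2).getD c.1
        false = true := by
  have hinit := T.init.2
  have hact : ∀ M : ℕ → List Bool, ∀ i < (substWord h (u ++ a :: v)).length + 2,
      IsAction s (T.cellAction (substWord h (u ++ a :: v)) M i) :=
    fun _ _ _ => TwoWay.isAction_action T _ _ _ _ hs
  rw [← TwoWay.reach_marked_iff, ← digit_foldl_update (by omega) (by omega) (hact _)]
  clear hact
  cases h with
  | none =>
    have hf : ∀ x w, Machines.foldUpdate s (none, T) x w = x := by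
      intro x w
      induction w generalizing x with
      | nil => rfl
      | cons b w ih => exact ih x
    rw [hf, hf]
    rfl
  | some h =>
    have hf : ∀ x w, Machines.foldUpdate s (some h, T) x w =
        (w.map fun b => action (T.column (.letter (h b))) [] [] false).foldl
          (fun x g => update s g x) x := by
      intro x w
      induction w generalizing x with
      | nil => rfl
      | cons b w ih => exact ih _
    simp only [substWord, Option.elim_some]
    rw [List.length_map, TwoWay.map_cellAction T _ h u a v fun i h0 h1 h2 => by
      unfold marksAt; rw [if_neg h0, if_neg h2, if_neg h1], hf, hf]
    have e1 : marksAt (u ++ a :: v).length (u.length + 1) markL mark markR (u.length + 1) =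
        mark := by
      simp [marksAt]
    have e2 : marksAt (u ++ a :: v).length (u.length + 1) markL mark markR
        ((u ++ a :: v).length + 1) = markR := by
      simp [marksAt]
    rw [e1, e2]
    simp [letterUpdate, marksAt, List.foldl_append]

namespace Machines

variable {l : Machines A L} {lab : A → List (ℕ × ℕ × ℕ) → L'}

theorem le_stateBound {t : ℕ} (ht : t < l.length) : l[t].2.n + 3 ≤ stateBound l.skeletons := by
  have hmem : l[t].2.n ∈ l.skeletons.map fun sk => sk.1 := by
    rw [skeletons, List.map_map]
    exact List.mem_map.2 ⟨l[t], List.getElem_mem ht, rfl⟩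
  have := List.single_le_sum (fun _ _ => Nat.zero_le _) _ hmem
  unfold stateBound
  omega

/-- What the bimachine computes from the images of `u` and `v`. -/
theorem succeeds_iff {t : ℕ} (ht : t < l.length) (u : List A) (a : A) (v : List A)
    (markL mark markR : List Bool) :
    succeeds (stateBound l.skeletons) (autSize l.skeletons) l.length t l[t].2.skeleton
      (l[t].1.map fun h => l[t].2.column (.letter (h a)))
      ((l.toBimachine lab).mu u) ((l.toBimachine lab).mu v) markL mark markR = true ↔
    ∃ c : Fin l[t].2.n × ℕ, l[t].2.Visits (substWord l[t].1 (u ++ a :: v)) c ∧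
      (marksAt (substWord l[t].1 (u ++ a :: v)).length (u.length + 1) markL mark markR c.2).getD
        c.1 false = true := by
  have hs := le_stateBound ht
  have hs0 := stateBound_pos l.skeletons
  have hx : ∀ g x, update (stateBound l.skeletons) g x <
      stateBound l.skeletons ^ stateBound l.skeletons := fun _ _ => encFun_lt hs0 _ _
  rw [← TwoWay.digit_foldUpdate_iff l[t].2 l[t].1 hs u a v markL mark markR, succeeds,
    decide_eq_true_iff, wordUpdate_mu u ht (hx _ _),
    wordUpdate_mu v ht (letterUpdate_lt hs0 _ _ (foldUpdate_lt hs0 _ (hx _ _) _))]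
  rfl

theorem getD_single (q i : ℕ) : (single q).getD i false = decide (i = q) := by
  rw [single, List.getD_eq_getElem?_getD, List.getElem?_map]
  by_cases hi : i < q + 1
  · simp [hi]
  · simp [hi]
    omega

theorem getD_finals (T : TwoWay A L) (q : Fin T.n) :
    T.finals.getD q false = decide (q ∈ T.final) := by
  simp [TwoWay.finals, List.getD_eq_getElem?_getD]

theorem succeeds_accepts {t : ℕ} (ht : t < l.length) (u : List A) (a : A) (v : List A) :
    succeeds (stateBound l.skeletons) (autSize l.skeletons) l.length t l[t].2.skeleton
      (l[t].1.map fun h => l[t].2.column (.letter (h a)))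
      ((l.toBimachine lab).mu u) ((l.toBimachine lab).mu v) [] [] l[t].2.finals = true ↔
    l[t].2.Accepts (substWord l[t].1 (u ++ a :: v)) := by
  rw [succeeds_iff ht]
  refine exists_congr fun c => and_congr_right fun _ => ?_
  unfold marksAt TwoWay.IsAccepting
  split_ifs with h1 h2
  · simp [h1]
  · rw [getD_finals]
    simp [h2]
  · simp [h2]
  · simp [h2]

theorem succeeds_left {t : ℕ} (ht : t < l.length) (u : List A) (a : A) (v : List A)
    (q : Fin l[t].2.n) :
    succeeds (stateBound l.skeletons) (autSize l.skeletons) l.length t l[t].2.skeleton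
      (l[t].1.map fun h => l[t].2.column (.letter (h a)))
      ((l.toBimachine lab).mu u) ((l.toBimachine lab).mu v) (single q) [] [] = true ↔
    l[t].2.Visits (substWord l[t].1 (u ++ a :: v)) (q, 0) := by
  rw [succeeds_iff ht]
  constructor
  · rintro ⟨⟨p, i⟩, hc, hm⟩
    unfold marksAt at hm
    split_ifs at hm with h1
    · rw [getD_single, decide_eq_true_iff] at hm
      obtain rfl := Fin.ext hm
      obtain rfl := h1
      exact hc
    all_goals simp at hm
  · intro hc
    refine ⟨_, hc, ?_⟩
    unfold marksAt
    rw [if_pos rfl, getD_single, decide_eq_true_iff]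

theorem succeeds_right {t : ℕ} (ht : t < l.length) (u : List A) (a : A) (v : List A)
    (q : Fin l[t].2.n) :
    succeeds (stateBound l.skeletons) (autSize l.skeletons) l.length t l[t].2.skeleton
      (l[t].1.map fun h => l[t].2.column (.letter (h a)))
      ((l.toBimachine lab).mu u) ((l.toBimachine lab).mu v) [] [] (single q) = true ↔
    l[t].2.Visits (substWord l[t].1 (u ++ a :: v))
      (q, (substWord l[t].1 (u ++ a :: v)).length + 1) := by
  rw [succeeds_iff ht]
  constructor
  · rintro ⟨⟨p, i⟩, hc, hm⟩
    unfold marksAt at hm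
    split_ifs at hm with h1 h2
    · simp at hm
    · rw [getD_single, decide_eq_true_iff] at hm
      obtain rfl := Fin.ext hm
      obtain rfl := h2
      exact hc
    all_goals simp at hm
  · intro hc
    refine ⟨_, hc, ?_⟩
    unfold marksAt
    rw [if_neg (by simp), if_pos rfl, getD_single, decide_eq_true_iff]

theorem succeeds_letter {t : ℕ} (ht : t < l.length) {h : A → A} (hh : l[t].1 = some h)
    (u : List A) (a : A) (v : List A) (q : Fin l[t].2.n) :
    succeeds (stateBound l.skeletons) (autSize l.skeletons) l.length t l[t].2.skeleton
      (l[t].1.map fun h => l[t].2.column (.letter (h a)))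
      ((l.toBimachine lab).mu u) ((l.toBimachine lab).mu v) [] (single q) [] = true ↔
    l[t].2.Visits (substWord l[t].1 (u ++ a :: v)) (q, u.length + 1) := by
  rw [succeeds_iff ht]
  constructor
  · rintro ⟨⟨p, i⟩, hc, hm⟩
    unfold marksAt at hm
    split_ifs at hm with h1 h2 h3
    · simp at hm
    · simp at hm
    · rw [getD_single, decide_eq_true_iff] at hm
      obtain rfl := Fin.ext hm
      obtain rfl := h3
      exact hc
    · simp at hm
  · intro hc
    refine ⟨_, hc, ?_⟩
    unfold marksAt
    rw [if_neg (by simp), if_neg (by simp [substWord, hh]), if_pos rfl, getD_single,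
      decide_eq_true_iff]

end Machines

end Machines

section Machines

variable {A : Type u} {L : Type v} {L' : Type w}

/-! ### The value of the bimachine of a list of transducers -/

/-- The tape symbol that is read by a transition of the given kind, if this kind exists. -/
def refSymbol (κ : ℕ) (h : Option (A → A)) (a : A) : Option (TapeSymbol A) :=
  bif decide (κ = 0) then some .leftMark
  else bif decide (κ = 2) then some .rightMark
  else h.map fun h => .letter (h a)

/-- The position of a transition of the given kind that is charged to the letter after a prefix of
length `i`, on a tape with a word of length `n`. -/
def refPos (κ i n : ℕ) : ℕ :=
  bif decide (κ = 0) then 0 else bif decide (κ = 2) then n + 1 else i + 1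

/-- The substitution and the output label of a transition that is charged to the letter `a`. -/
def Machines.resolve (l : Machines A L) (a : A) (r : ℕ × ℕ × ℕ) : Option (Option (A → A) × L) :=
  l[r.1]?.bind fun e => (refSymbol r.2.1 e.1 a).bind fun x =>
    if hq : r.2.2 < e.2.n then (e.2.step ⟨r.2.2, hq⟩ x).map fun p => (e.1, p.2) else none

theorem sum_map_filter_range {β : Type*} (n : ℕ) (p : ℕ → Bool) (f : ℕ → β) (val : β → ℕ) :
    ((((List.range n).filter p).map f).map val).sum =
      ∑ q : Fin n, if p q = true then val (f q) else 0 := by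
  rw [Fin.sum_univ_eq_sum_range fun q => if p q = true then val (f q) else 0]
  induction n with
  | zero => rfl
  | succ n ih =>
    rw [List.range_succ, List.filter_append, List.map_append, List.map_append, List.sum_append, ih,
      Finset.sum_range_succ]
    congr 1
    cases h : p n <;> simp [h]

theorem sum_map_elim {β γ : Type*} (o : Option γ) (X : List β) (f : β → ℕ) :
    ((o.elim [] fun _ => X).map f).sum = o.elim 0 fun _ => (X.map f).sum := by
  cases o <;> rfl

theorem elim_congr {γ : Type*} {o : Option γ} {b x y : ℕ} (h : ∀ g, o = some g → x = y) :
    (o.elim b fun _ => x) = o.elim b fun _ => y := by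
  cases o with
  | none => rfl
  | some g => exact h g rfl

/-- The value of a transition that is charged to the letter `a` of `u a v`. -/
def Machines.refValue (l : Machines A L) (ν : Option (A → A) → L → ℕ → ℕ) (u : List A) (a : A)
    (v : List A) (r : ℕ × ℕ × ℕ) : ℕ :=
  (l.resolve a r).elim 0 fun p =>
    ν p.1 p.2 (refPos r.2.1 u.length (substWord p.1 (u ++ a :: v)).length)

namespace Machines

variable {l : Machines A L} {lab : A → List (ℕ × ℕ × ℕ) → L'}

theorem refValue_eq (ν : Option (A → A) → L → ℕ → ℕ) (u : List A) (a : A) (v : List A)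
    {t : ℕ} (ht : t < l.length) {κ : ℕ} (q : Fin l[t].2.n)
    (hκ : refSymbol κ l[t].1 a = some (tapeAt (substWord l[t].1 (u ++ a :: v))
      (refPos κ u.length (substWord l[t].1 (u ++ a :: v)).length))) :
    l.refValue ν u a v (t, κ, q) = TwoWay.stepValue l[t].2 (substWord l[t].1 (u ++ a :: v))
      (ν l[t].1) (q, refPos κ u.length (substWord l[t].1 (u ++ a :: v)).length) := by
  unfold refValue resolve TwoWay.stepValue
  simp only [List.getElem?_eq_getElem ht, Option.bind_some, hκ, q.2, dif_pos, Fin.eta]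
  cases l[t].2.step q (tapeAt (substWord l[t].1 (u ++ a :: v))
      (refPos κ u.length (substWord l[t].1 (u ++ a :: v)).length)) <;> rfl

open Classical in
/-- The total output of the steps of an accepting run at position `i`. -/
noncomputable def posValue (T : TwoWay A L) (w : List A) (ν : L → ℕ → ℕ) (i : ℕ) : ℕ :=
  ∑ q : Fin T.n,
    if T.Visits w (q, i) ∧ ¬ T.IsAccepting w (q, i) then TwoWay.stepValue T w ν (q, i) else 0

open Classical in
/-- The value of the transitions of one machine that are charged to a letter. -/
theorem sum_machineRefs (ν : Option (A → A) → L → ℕ → ℕ) (u : List A) (a : A) (v : List A)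
    {t : ℕ} (ht : t < l.length) :
    ((machineRefs (stateBound l.skeletons) (autSize l.skeletons) l.length t l[t].2.skeleton
      (l[t].1.map fun h => l[t].2.column (.letter (h a)))
      ((l.toBimachine lab).mu u) ((l.toBimachine lab).mu v)).map (l.refValue ν u a v)).sum =
    if l[t].2.Accepts (substWord l[t].1 (u ++ a :: v)) then
      (l[t].1.elim 0 fun _ =>
        posValue l[t].2 (substWord l[t].1 (u ++ a :: v)) (ν l[t].1) (u.length + 1)) +
      ((if u = [] then posValue l[t].2 (substWord l[t].1 (u ++ a :: v)) (ν l[t].1) 0 else 0) +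
      (if v = [] then posValue l[t].2 (substWord l[t].1 (u ++ a :: v)) (ν l[t].1)
        ((substWord l[t].1 (u ++ a :: v)).length + 1) else 0))
    else 0 := by
  have hacc := succeeds_accepts (lab := lab) ht u a v
  unfold machineRefs
  by_cases hA : l[t].2.Accepts (substWord l[t].1 (u ++ a :: v))
  swap
  · rw [if_neg hA]
    have : ¬ _ := mt hacc.1 hA
    change ((bif succeeds (stateBound l.skeletons) (autSize l.skeletons) l.length t l[t].2.skeleton
      (l[t].1.map fun h => l[t].2.column (.letter (h a)))
      ((l.toBimachine lab).mu u) ((l.toBimachine lab).mu v) [] [] l[t].2.finals then _ else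
      []).map (l.refValue ν u a v)).sum = 0
    rw [Bool.not_eq_true] at this
    rw [this]
    rfl
  rw [if_pos hA, show l[t].2.skeleton.2.2.1 = l[t].2.finals from rfl, hacc.2 hA, cond_true,
    List.map_append, List.map_append, List.sum_append, List.sum_append]
  congr 1
  · rw [sum_map_elim, Option.elim_map]
    refine elim_congr fun h hh => (sum_map_filter_range _ _ _ _).trans ?_
    refine Finset.sum_congr rfl fun (q : Fin l[t].2.n) _ => ?_
    have hlen : (substWord l[t].1 (u ++ a :: v)).length = (u ++ a :: v).length := by
      simp [substWord, hh]
    have hval := refValue_eq ν u a v ht (κ := 1) q (by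
      simp [refSymbol, refPos, hh, substWord, tapeAt])
    refine if_congr ?_ hval rfl
    have := succeeds_letter (lab := lab) ht hh u a v q
    refine this.trans ⟨fun hv => ⟨hv, fun hc => ?_⟩, And.left⟩
    have := hc.1
    rw [hlen] at this
    simp at this
  congr 1
  · rw [Bool.cond_eq_ite]
    by_cases hu : u = []
    · rw [if_pos (decide_eq_true ((digit_mu_zero u).2 hu)), if_pos hu, sum_map_filter_range]
      refine Finset.sum_congr rfl fun (q : Fin l[t].2.n) _ => ?_
      refine if_congr ?_ (refValue_eq ν u a v ht (κ := 0) q rfl) rfl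
      refine (succeeds_left (lab := lab) ht u a v q).trans
        ⟨fun hv => ⟨hv, fun hc => absurd hc.1 (by simp)⟩, And.left⟩
    · rw [if_neg (by simpa using mt (digit_mu_zero u).1 hu), if_neg hu]
      rfl
  · rw [Bool.cond_eq_ite]
    by_cases hv : v = []
    · rw [if_pos (decide_eq_true ((digit_mu_zero v).2 hv)), if_pos hv, sum_map_filter_range]
      refine Finset.sum_congr rfl fun (q : Fin l[t].2.n) _ => ?_
      refine if_congr ?_ (refValue_eq ν u a v ht (κ := 2) q ?_) rfl
      · rw [Bool.and_eq_true, succeeds_right (lab := lab) ht u a v q]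
        refine and_congr_right fun _ => ?_
        rw [getD_finals]
        simp [TwoWay.IsAccepting]
      · exact congrArg some (tapeAt_length _).symm
    · rw [if_neg (by simpa using mt (digit_mu_zero v).1 hv), if_neg hv]
      rfl

theorem sum_range_posValue (F : ℕ → ℕ) (n : ℕ) :
    ∑ i ∈ Finset.range (n + 2), F i = F 0 + ∑ i ∈ Finset.range n, F (i + 1) + F (n + 1) := by
  rw [Finset.sum_range_succ, Finset.sum_range_succ']
  ring

/-- The transitions of the accepting run of one machine are charged to the letters of the word. -/
theorem sum_machine (ν : Option (A → A) → L → ℕ → ℕ) {w : List A} (hw : w ≠ [])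
    {t : ℕ} (ht : t < l.length) :
    ∑ j : Fin w.length,
      ((machineRefs (stateBound l.skeletons) (autSize l.skeletons) l.length t l[t].2.skeleton
        (l[t].1.map fun h => l[t].2.column (.letter (h (w.get j))))
        ((l.toBimachine lab).mu (w.take j)) ((l.toBimachine lab).mu (w.drop (j + 1)))).map
        (l.refValue ν (w.take j) (w.get j) (w.drop (j + 1)))).sum =
    l[t].2.output (substWord l[t].1 w) (ν l[t].1) := by
  classical
  have hpos := List.length_pos_iff.2 hw
  have hdec : ∀ j : Fin w.length, w.take j ++ w.get j :: w.drop (j + 1) = w := fun j => by simp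
  rw [TwoWay.output_eq_sum]
  simp only [sum_machineRefs, hdec]
  split_ifs with hA
  swap
  · simp
  have e1 : ∀ j : Fin w.length, (w.take j).length = j := fun j => by simp [j.2.le]
  have e2 : ∀ j : Fin w.length, w.take j = [] ↔ (j : ℕ) = 0 := fun j => by simp [hw]
  have e3 : ∀ j : Fin w.length, w.drop (j + 1) = [] ↔ (j : ℕ) = w.length - 1 := fun j => by
    have := j.2
    rw [List.drop_eq_nil_iff]
    omega
  simp only [e1, e2, e3]
  rw [Finset.sum_add_distrib, Finset.sum_add_distrib,
    Fin.sum_univ_eq_sum_range fun j => l[t].1.elim 0 fun _ =>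
      posValue l[t].2 (substWord l[t].1 w) (ν l[t].1) (j + 1),
    Fin.sum_univ_eq_sum_range fun j =>
      if j = 0 then posValue l[t].2 (substWord l[t].1 w) (ν l[t].1) 0 else 0,
    Fin.sum_univ_eq_sum_range fun j => if j = w.length - 1 then
      posValue l[t].2 (substWord l[t].1 w) (ν l[t].1) ((substWord l[t].1 w).length + 1) else 0,
    Finset.sum_ite_eq', Finset.sum_ite_eq', if_pos (Finset.mem_range.2 hpos),
    if_pos (Finset.mem_range.2 (by omega))]
  refine Eq.trans ?_ (sum_range_posValue
    (posValue l[t].2 (substWord l[t].1 w) (ν l[t].1)) _).symm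
  rcases hh : l[t].1 with _ | h
  · simp [substWord]
  · simp only [Option.elim_some, substWord, List.length_map]
    ring

theorem mem_machineRefs {s m τ t : ℕ} {sk : Skeleton} {c : Option Column} {u v : ℕ}
    {r : ℕ × ℕ × ℕ} (hr : r ∈ machineRefs s m τ t sk c u v) :
    (r.2.1 = 0 → digit m u 0 = 0) ∧ (r.2.1 = 2 → digit m v 0 = 0) ∧ r.2.1 ≤ 2 := by
  unfold machineRefs at hr
  cases hb : succeeds s m τ t sk c u v [] [] sk.2.2.1
  · rw [hb] at hr
    exact absurd hr List.not_mem_nil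
  rw [hb, cond_true, List.mem_append, List.mem_append] at hr
  rcases hr with hr | hr | hr
  · cases c with
    | none => exact absurd hr List.not_mem_nil
    | some c =>
      obtain ⟨q, -, rfl⟩ := List.mem_map.1 hr
      simp
  · by_cases h0 : digit m u 0 = 0
    · rw [decide_eq_true h0] at hr
      obtain ⟨q, -, rfl⟩ := List.mem_map.1 hr
      simp [h0]
    · rw [decide_eq_false h0] at hr
      exact absurd hr List.not_mem_nil
  · by_cases h0 : digit m v 0 = 0
    · rw [decide_eq_true h0] at hr
      obtain ⟨q, -, rfl⟩ := List.mem_map.1 hr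
      simp [h0]
    · rw [decide_eq_false h0] at hr
      exact absurd hr List.not_mem_nil

/-- The transitions `refs` may be charged to a letter between the words `u` and `v`: those on the
left mark only if `u` is empty, and those on the right mark only if `v` is empty. -/
def ChargedTo (u v : List A) (refs : List (ℕ × ℕ × ℕ)) : Prop :=
  ∀ r ∈ refs, (r.2.1 = 0 → u = []) ∧ (r.2.1 = 2 → v = []) ∧ r.2.1 ≤ 2

theorem sum_map_flatMap {α β : Type*} (l : List α) (f : α → List β) (g : β → ℕ) :
    ((l.flatMap f).map g).sum = (l.map fun a => ((f a).map g).sum).sum := by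
  induction l with
  | nil => rfl
  | cons a l ih => simp [ih]

theorem sum_map_range (n : ℕ) (f : ℕ → ℕ) :
    ((List.range n).map f).sum = ∑ i ∈ Finset.range n, f i := rfl

/-- The value of the bimachine is the sum of the values of the transducers, if each label has the
value of the transitions that it stands for. -/
theorem output_toBimachine (ν : Option (A → A) → L → ℕ → ℕ) (ν' : L' → ℕ → ℕ) {w : List A}
    (hw : w ≠ [])
    (hlab : ∀ u a v refs, w = u ++ a :: v → ChargedTo u v refs →
      ν' (lab a refs) (u.length + 1) = (refs.map (l.refValue ν u a v)).sum) :
    (l.toBimachine lab).output w ν' =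
      (l.map fun e => e.2.output (substWord e.1 w) (ν e.1)).sum := by
  have hdec : ∀ j : Fin w.length, w = w.take j ++ w.get j :: w.drop (j + 1) := fun j => by simp
  have key : ∀ j : Fin w.length, ν' ((l.toBimachine lab).out ((l.toBimachine lab).mu (w.take j))
      (w.get j) ((l.toBimachine lab).mu (w.drop (j + 1)))) (j + 1) =
      ∑ t : Fin l.length, ((machineRefs (stateBound l.skeletons) (autSize l.skeletons) l.length t
        l[t].2.skeleton (l[t].1.map fun h => l[t].2.column (.letter (h (w.get j))))
        ((l.toBimachine lab).mu (w.take j)) ((l.toBimachine lab).mu (w.drop (j + 1)))).map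
        (l.refValue ν (w.take j) (w.get j) (w.drop (j + 1)))).sum := by
    intro j
    have hj := hlab (w.take j) (w.get j) (w.drop (j + 1)) (allRefs l.skeletons
      (l.columns (w.get j)) ((l.toBimachine lab).mu (w.take j))
      ((l.toBimachine lab).mu (w.drop (j + 1)))) (hdec j) ?_
    · rw [List.length_take, Nat.min_eq_left j.2.le] at hj
      refine hj.trans ?_
      unfold allRefs
      rw [sum_map_flatMap, sum_map_range, ← Fin.sum_univ_eq_sum_range]
      have hlen : l.skeletons.length = l.length := List.length_map _
      refine Fintype.sum_equiv (finCongr hlen) _ _ fun t => ?_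
      have ht : (t : ℕ) < l.length := hlen ▸ t.2
      simp [skeletons, columns, List.getD_eq_getElem?_getD, ht]
      rfl
    · intro r hr
      obtain ⟨t, -, hr⟩ := List.mem_flatMap.1 hr
      have := mem_machineRefs hr
      rwa [digit_mu_zero, digit_mu_zero] at this
  unfold Bimachine.output
  rw [Finset.sum_congr rfl fun j _ => key j, Finset.sum_comm,
    Finset.sum_congr rfl fun t _ => sum_machine ν hw t.2]
  exact Fin.sum_univ_fun_getElem l fun e => e.2.output (substWord e.1 w) (ν e.1)

end Machines

end Machines

/-! ### From transducers to bimachines, with all levels -/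

/-- The substitution of letters for an external function that is called by a transition of the
given kind: if `h` is the substitution for the caller, and if the transition is charged to the
letter at position `i` of `w`, then it turns `mode.arg w i` into the argument of the external
function. -/
def Mode.extSubst {A : Type u} : (mode : Mode) → ℕ → Option (A → A) →
    Option (mode.Ext A → mode.Ext A)
  | .pebble, κ, h => h.map fun h =>
      bif decide (κ = 1) then Sum.map h h else Sum.elim (Sum.inl ∘ h) (Sum.inl ∘ h)
  | .blind, _, h => h
  | .marble, κ, h => bif decide (κ = 0) then none else h

/-- The substitution `none` is used in the marble case only, and for words of length one only. -/
def Mode.SubstOK {A : Type u} {B : Type v} (mode : Mode) (w : List A) (h : Option B) : Prop :=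
  h = none → mode = .marble ∧ w.length = 1

theorem Mode.substOK_extSubst (mode : Mode) {A : Type u} {u : List A} {a : A} {v : List A} {κ : ℕ}
    {h : Option (A → A)} (hh : mode.SubstOK (u ++ a :: v) h) (h0 : κ = 0 → u = []) :
    mode.SubstOK (mode.arg (u ++ a :: v) (u.length + 1)) (mode.extSubst κ h) := by
  intro hn
  cases mode with
  | pebble =>
    have : h = none := by simpa [Mode.extSubst] using hn
    exact absurd (hh this).1 (by simp)
  | blind => exact absurd (hh hn).1 (by simp)
  | marble =>
    refine ⟨rfl, ?_⟩
    change ((u ++ a :: v).take (u.length + 1)).length = 1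
    by_cases hκ : κ = 0
    · simp [h0 hκ]
    · have hn' : (bif decide (κ = 0) then none else h) = none := hn
      rw [decide_eq_false hκ] at hn'
      have := (hh hn').2
      rw [List.length_append, List.length_cons] at this
      rw [List.length_take, List.length_append, List.length_cons]
      omega

/-- The argument of an external function that a transducer calls is obtained by a substitution from
the argument for the letter to which this call is charged. -/
theorem Mode.substWord_arg (mode : Mode) {A : Type u} {u : List A} {a : A} {v : List A} {κ : ℕ}
    {h : Option (A → A)} (hh : mode.SubstOK (u ++ a :: v) h) (h0 : κ = 0 → u = [])
    (h2 : κ = 2 → v = []) (hκ : κ ≤ 2) :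
    substWord (mode.extSubst κ h) (mode.arg (u ++ a :: v) (u.length + 1)) =
      mode.arg (substWord h (u ++ a :: v))
        (refPos κ u.length (substWord h (u ++ a :: v)).length) := by
  cases mode with
  | pebble =>
    cases h with
    | none => exact absurd (hh rfl).1 (by simp)
    | some h =>
      have hκ' : κ = 0 ∨ κ = 1 ∨ κ = 2 := by omega
      rcases hκ' with rfl | rfl | rfl
      · change ((u ++ a :: v).mapIdx fun j b => if j + 1 = u.length + 1 then Sum.inr b else
          Sum.inl b).map (Sum.elim (Sum.inl ∘ h) (Sum.inl ∘ h)) = ((u ++ a :: v).map h).mapIdx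
            fun j b => if j + 1 = 0 then Sum.inr b else Sum.inl b
        refine List.ext_getElem (by simp) fun i h1 h2 => ?_
        rw [List.getElem_map, List.getElem_mapIdx, List.getElem_mapIdx, List.getElem_map]
        rw [if_neg (Nat.succ_ne_zero i)]
        split_ifs <;> rfl
      · change ((u ++ a :: v).mapIdx fun j b => if j + 1 = u.length + 1 then Sum.inr b else
          Sum.inl b).map (Sum.map h h) = ((u ++ a :: v).map h).mapIdx
            fun j b => if j + 1 = u.length + 1 then Sum.inr b else Sum.inl b
        refine List.ext_getElem (by simp) fun i h1 h2 => ?_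
        rw [List.getElem_map, List.getElem_mapIdx, List.getElem_mapIdx, List.getElem_map]
        split_ifs <;> rfl
      · change ((u ++ a :: v).mapIdx fun j b => if j + 1 = u.length + 1 then Sum.inr b else
          Sum.inl b).map (Sum.elim (Sum.inl ∘ h) (Sum.inl ∘ h)) = ((u ++ a :: v).map h).mapIdx
            fun j b => if j + 1 = ((u ++ a :: v).map h).length + 1 then Sum.inr b else Sum.inl b
        refine List.ext_getElem (by simp) fun i h1 h2 => ?_
        rw [List.getElem_map, List.getElem_mapIdx, List.getElem_mapIdx, List.getElem_map]
        rw [List.length_mapIdx] at h2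
        split_ifs <;> first | rfl | omega
  | blind => rfl
  | marble =>
    have harg : Mode.marble.arg (u ++ a :: v) (u.length + 1) = u ++ [a] := by
      change (u ++ a :: v).take (u.length + 1) = _
      simp [List.take_append]
    have hκ' : κ = 0 ∨ κ = 1 ∨ κ = 2 := by omega
    cases h with
    | none =>
      have : substWord (Mode.marble.extSubst κ (none : Option (A → A)))
          (Mode.marble.arg (u ++ a :: v) (u.length + 1)) = [] := by
        rcases hκ' with rfl | rfl | rfl <;> rfl
      rw [this]
      exact List.take_nil.symm
    | some h =>
      change _ = (substWord (some h) (u ++ a :: v)).take _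
      rw [harg]
      rcases hκ' with rfl | rfl | rfl
      · rfl
      · change (u ++ [a]).map h = ((u ++ a :: v).map h).take (u.length + 1)
        rw [← List.map_take]
        simp [List.take_append]
      · change (u ++ [a]).map h = ((u ++ a :: v).map h).take (_ + 1)
        rw [h2 rfl]
        simp [substWord]

/-- A `k`-bimachine whose value is the sum of the values of the given `k`-transducers. -/
def KBimachine.ofList (mode : Mode) : (k : ℕ) → {A : Type u} →
    List (Option (A → A) × KTransducer mode k A) → KBimachine mode k A
  | 0, A, l => Machines.toBimachine (A := A) (L := ℕ) (L' := ℕ) l fun a refs =>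
      ((refs.filterMap (Machines.resolve (A := A) (L := ℕ) l a)).map Prod.snd).sum
  | k + 1, A, l => Machines.toBimachine (A := A) (L := KTransducer mode k (mode.Ext A))
      (L' := KBimachine mode k (mode.Ext A)) l fun a refs =>
      KBimachine.ofList mode k (refs.filterMap fun r =>
        (Machines.resolve (A := A) (L := KTransducer mode k (mode.Ext A)) l a r).map fun p =>
          (mode.extSubst r.2.1 p.1, p.2))

theorem sum_map_filterMap {β γ : Type*} (l : List β) (f : β → Option γ) (g : γ → ℕ) :
    ((l.filterMap f).map g).sum = (l.map fun b => (f b).elim 0 g).sum := by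
  induction l with
  | nil => rfl
  | cons b l ih => cases h : f b <;> simp [h, ih]

theorem Machines.fst_mem_of_resolve {A : Type u} {L : Type v} {l : Machines A L} {a : A}
    {r : ℕ × ℕ × ℕ} {p : Option (A → A) × L} (h : l.resolve a r = some p) :
    ∃ e ∈ l, e.1 = p.1 := by
  simp only [Machines.resolve, Option.bind_eq_some_iff] at h
  obtain ⟨e, he, x, -, hx⟩ := h
  refine ⟨e, List.mem_of_getElem? he, ?_⟩
  split_ifs at hx
  obtain ⟨y, -, rfl⟩ := Option.map_eq_some_iff.1 hx
  rfl

/-- The induction on the level. A label stands for the list of all external functions whose calls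
are charged to a letter. -/
theorem KBimachine.eval_ofList (mode : Mode) (k : ℕ) {A : Type u}
    (l : List (Option (A → A) × KTransducer mode k A)) {w : List A} (hw : w ≠ [])
    (hl : ∀ e ∈ l, mode.SubstOK w e.1) :
    (KBimachine.ofList mode k l).eval mode k w =
      (l.map fun e => e.2.eval mode k (substWord e.1 w)).sum := by
  induction k generalizing A with
  | zero =>
    refine Machines.output_toBimachine (A := A) (L := ℕ) (L' := ℕ) (l := l) (fun _ x _ => x) _ hw
      fun u a v refs _ _ => ?_
    exact sum_map_filterMap _ _ _
  | succ k ih =>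
    refine Machines.output_toBimachine (A := A) (L := KTransducer mode k (mode.Ext A))
      (L' := KBimachine mode k (mode.Ext A)) (l := l)
      (fun h S i => S.eval mode k (mode.arg (substWord h w) i)) _ hw
      fun u a v refs hwe hrefs => ?_
    subst hwe
    refine (ih _ (mode.arg_ne_nil hw _) ?_).trans ?_
    · intro e he
      obtain ⟨r, hr, he⟩ := List.mem_filterMap.1 he
      obtain ⟨p, hp, rfl⟩ := Option.map_eq_some_iff.1 he
      obtain ⟨e, he, hep⟩ := Machines.fst_mem_of_resolve hp
      exact mode.substOK_extSubst (hep ▸ hl e he) (hrefs r hr).1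
    · rw [sum_map_filterMap]
      refine congrArg List.sum (List.map_congr_left fun r hr => ?_)
      unfold Machines.refValue
      rcases hp : Machines.resolve (A := A) (L := KTransducer mode k (mode.Ext A)) l a r with _ | p
      · rfl
      · obtain ⟨e, he, hep⟩ := Machines.fst_mem_of_resolve hp
        obtain ⟨h0, h2, h3⟩ := hrefs r hr
        exact congrArg (p.2.eval mode k) (mode.substWord_arg (hep ▸ hl e he) h0 h2 h3)

/-- The `k`-bimachine that simulates a `k`-transducer. -/
def KTransducer.toBimachine (mode : Mode) (k : ℕ) {A : Type u} (T : KTransducer mode k A) :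
    KBimachine mode k A :=
  KBimachine.ofList mode k [(some id, T)]

theorem KTransducer.eval_toBimachine (mode : Mode) (k : ℕ) {A : Type u} (T : KTransducer mode k A)
    {w : List A} (hw : w ≠ []) : (T.toBimachine mode k).eval mode k w = T.eval mode k w := by
  refine (KBimachine.eval_ofList mode k _ hw ?_).trans ?_
  · intro e he
    obtain rfl := List.mem_singleton.1 he
    exact fun h => absurd h (Option.some_ne_none _)
  · simp [substWord]

/-! ### Primitive recursiveness of the simulation -/

namespace Prim

variable {α : Type*} [Primcodable α]

@[fun_prop] theorem encFun {s t : α → ℕ} {f : α → ℕ → ℕ} (hs : Primrec s) (ht : Primrec t)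
    (hf : Primrec fun p : α × ℕ => f p.1 p.2) :
    Primrec fun x => PebbleBim.encFun (s x) (t x) (f x) := by
  unfold PebbleBim.encFun
  refine sum (map (range ht) ?_)
  exact mul (mod hf (by fun_prop)) (by fun_prop)

@[fun_prop] theorem digit {s x i : α → ℕ} (hs : Primrec s) (hx : Primrec x) (hi : Primrec i) :
    Primrec fun a => PebbleBim.digit (s a) (x a) (i a) := by
  unfold PebbleBim.digit; fun_prop

@[fun_prop] theorem action {col : α → Column} {halting marks : α → List Bool} {atEnd : α → Bool}
    {q : α → ℕ} (hc : Primrec col) (hs : Primrec halting) (hm : Primrec marks) (he : Primrec atEnd)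
    (hq : Primrec q) :
    Primrec fun a => PebbleBim.action (col a) (halting a) (marks a) (atEnd a) (q a) := by
  unfold PebbleBim.action Column at *; fun_prop

variable {s x q : α → ℕ} {col : α → Column} {halting marks : α → List Bool} {atEnd : α → Bool}

@[fun_prop] theorem roundTrip (hs : Primrec s) (hx : Primrec x) (hc : Primrec col)
    (hst : Primrec halting) (hm : Primrec marks) (he : Primrec atEnd) (hq : Primrec q) :
    Primrec fun a => PebbleBim.roundTrip (PebbleBim.action (col a) (halting a) (marks a) (atEnd a))
      (PebbleBim.digit (s a) (x a)) (q a) := by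
  unfold PebbleBim.roundTrip; fun_prop

@[fun_prop] theorem rounds {t : α → ℕ} (hs : Primrec s) (hx : Primrec x) (hc : Primrec col)
    (hst : Primrec halting) (hm : Primrec marks) (he : Primrec atEnd) (ht : Primrec t)
    (hq : Primrec q) :
    Primrec fun a => PebbleBim.rounds (PebbleBim.action (col a) (halting a) (marks a) (atEnd a))
      (PebbleBim.digit (s a) (x a)) (t a) (q a) := by
  unfold PebbleBim.rounds; fun_prop

@[fun_prop] theorem leave (hs : Primrec s) (hx : Primrec x) (hc : Primrec col)
    (hst : Primrec halting) (hm : Primrec marks) (he : Primrec atEnd) (hq : Primrec q) :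
    Primrec fun a => PebbleBim.leave (s a)
      (PebbleBim.action (col a) (halting a) (marks a) (atEnd a))
      (PebbleBim.digit (s a) (x a)) (q a) := by
  unfold PebbleBim.leave; fun_prop

@[fun_prop] theorem extend (hs : Primrec s) (hx : Primrec x) (hc : Primrec col)
    (hst : Primrec halting) (hm : Primrec marks) (he : Primrec atEnd) (hq : Primrec q) :
    Primrec fun a => PebbleBim.extend (s a)
      (PebbleBim.action (col a) (halting a) (marks a) (atEnd a))
      (PebbleBim.digit (s a) (x a)) (q a) := by
  unfold PebbleBim.extend; fun_prop

@[fun_prop] theorem update (hs : Primrec s) (hx : Primrec x) (hc : Primrec col)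
    (hst : Primrec halting) (hm : Primrec marks) (he : Primrec atEnd) :
    Primrec fun a => PebbleBim.update (s a)
      (PebbleBim.action (col a) (halting a) (marks a) (atEnd a)) (x a) := by
  unfold PebbleBim.update; fun_prop

@[fun_prop] theorem startCode (hs : Primrec s) (hq : Primrec q) :
    Primrec fun a => PebbleBim.startCode (s a) (q a) := by
  unfold PebbleBim.startCode emptyBehaviour; fun_prop

variable {c : α → Option Column} {m τ t u v : α → ℕ}

@[fun_prop] theorem letterUpdate (hs : Primrec s) (hc : Primrec c) (hm : Primrec marks)
    (hx : Primrec x) : Primrec fun a => PebbleBim.letterUpdate (s a) (c a) (marks a) (x a) := by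
  unfold PebbleBim.letterUpdate; fun_prop

@[fun_prop] theorem letterMap {cols : α → List (Option Column)} {z : α → ℕ} (hs : Primrec s)
    (hτ : Primrec τ) (hc : Primrec cols) (hz : Primrec z) :
    Primrec fun a => PebbleBim.letterMap (s a) (τ a) (cols a) (z a) := by
  unfold PebbleBim.letterMap; fun_prop

@[fun_prop] theorem wordUpdate (hm : Primrec m) (hτ : Primrec τ) (hu : Primrec u)
    (ht : Primrec t) (hx : Primrec x) :
    Primrec fun a => PebbleBim.wordUpdate (m a) (τ a) (u a) (t a) (x a) := by
  unfold PebbleBim.wordUpdate; fun_prop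

@[fun_prop] theorem single (hq : Primrec q) : Primrec fun a => PebbleBim.single (q a) := by
  unfold PebbleBim.single; fun_prop

@[fun_prop] theorem mapMul (hm : Primrec m) (hu : Primrec u) (hv : Primrec v) :
    Primrec fun a => PebbleBim.mapMul (m a) (u a) (v a) := by
  unfold PebbleBim.mapMul; fun_prop

@[fun_prop] theorem mapOne (hm : Primrec m) : Primrec fun a => PebbleBim.mapOne (m a) := by
  unfold PebbleBim.mapOne; fun_prop

variable {sk : α → Skeleton} {markL mark markR : α → List Bool}

@[fun_prop] theorem succeeds (hs : Primrec s) (hm : Primrec m) (hτ : Primrec τ) (ht : Primrec t)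
    (hsk : Primrec sk) (hc : Primrec c) (hu : Primrec u) (hv : Primrec v) (h1 : Primrec markL)
    (h2 : Primrec mark) (h3 : Primrec markR) :
    Primrec fun a => PebbleBim.succeeds (s a) (m a) (τ a) (t a) (sk a) (c a) (u a) (v a) (markL a)
      (mark a) (markR a) := by
  unfold PebbleBim.succeeds; fun_prop

@[fun_prop] theorem machineRefs (hs : Primrec s) (hm : Primrec m) (hτ : Primrec τ)
    (ht : Primrec t) (hsk : Primrec sk) (hc : Primrec c) (hu : Primrec u) (hv : Primrec v) :
    Primrec fun a => PebbleBim.machineRefs (s a) (m a) (τ a) (t a) (sk a) (c a) (u a) (v a) := by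
  unfold PebbleBim.machineRefs
  refine cond' (by fun_prop) (append ?_ (append (cond' (by fun_prop) ?_ (by fun_prop))
    (cond' (by fun_prop) ?_ (by fun_prop)))) (by fun_prop) <;> fun_prop

variable {sks : α → List Skeleton}

@[fun_prop] theorem stateBound (h : Primrec sks) :
    Primrec fun a => PebbleBim.stateBound (sks a) := by
  unfold PebbleBim.stateBound; fun_prop

@[fun_prop] theorem autSize (h : Primrec sks) : Primrec fun a => PebbleBim.autSize (sks a) := by
  unfold PebbleBim.autSize; fun_prop

@[fun_prop] theorem allRefs {cols : α → List (Option Column)} (h : Primrec sks)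
    (hc : Primrec cols) (hu : Primrec u) (hv : Primrec v) :
    Primrec fun a => PebbleBim.allRefs (sks a) (cols a) (u a) (v a) := by
  unfold PebbleBim.allRefs; fun_prop

end Prim

/-! ### The conversion of descriptions of transducers -/

/-- The description of a two-way transducer, see `TwoWay.code`. -/
def TwoWay.data {A : Type u} {L : Type v} (letters : List A) (labelCode : L → ℕ)
    (T : TwoWay A L) : TData :=
  (letters.length, T.n, (T.init : ℕ), T.finals,
    List.ofFn fun q : Fin T.n =>
      (TapeSymbol.leftMark :: TapeSymbol.rightMark :: letters.map TapeSymbol.letter).map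
        fun t => (T.step q t).map fun r => (((r.1.1 : ℕ), r.1.2.toBool), labelCode r.2))

theorem TwoWay.code_eq {A : Type u} {L : Type v} (letters : List A) (labelCode : L → ℕ)
    (T : TwoWay A L) : T.code letters labelCode = Encodable.encode (T.data letters labelCode) :=
  rfl

/-- The description that is encoded by a number, with a default value for all other numbers. -/
def TData.decode (c : ℕ) : TData := (Encodable.decode c).getD (0, 0, 0, [], [])

theorem TData.decode_encode (d : TData) : TData.decode (Encodable.encode d) = d := by
  rw [TData.decode, Encodable.encodek, Option.getD_some]

theorem TwoWay.decode_code_fst {A : Type u} {L : Type v} (letters : List A) (labelCode : L → ℕ)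
    (T : TwoWay A L) : (TData.decode (T.code letters labelCode)).1 = letters.length := by
  rw [TwoWay.code_eq, TData.decode_encode]
  rfl

/-- The moves on the symbol number `i`, read off from the transition table. -/
def TData.column (d : TData) (i : ℕ) : Column :=
  d.2.2.2.2.map fun row => (row.getD i none).map fun r => r.1

/-- Computes `TwoWay.skeleton` from a description. -/
def TData.skeleton (d : TData) : Skeleton :=
  (d.2.1, d.2.2.1, d.2.2.2.1, TData.column d 0, TData.column d 1)

/-- Descriptions of lists of transducers with substitutions: the number of letters, and for each
transducer the list of the numbers of the images of the letters (empty for the substitution `none`)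
and its description. -/
abbrev MachinesData : Type := ℕ × List (List ℕ × ℕ)

namespace MachinesData

/-- Computes `Machines.skeletons` from a description. -/
def skeletons (D : MachinesData) : List Skeleton :=
  D.2.map fun e => TData.skeleton (TData.decode e.2)

/-- Computes `Machines.columns` for the letter number `i`. -/
def columns (D : MachinesData) (i : ℕ) : List (Option Column) :=
  D.2.map fun e => e.1[i]?.map fun j => TData.column (TData.decode e.2) (j + 2)

/-- The number of the symbol that is read by a transition of the given kind, if this kind exists. -/
def symbol (κ : ℕ) (hl : List ℕ) (i : ℕ) : Option ℕ :=
  bif decide (κ = 0) then some 0 else bif decide (κ = 2) then some 1 else hl[i]?.map fun j => j + 2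

/-- Computes `Machines.resolve` for the letter number `i`. -/
def resolve (D : MachinesData) (i : ℕ) (r : ℕ × ℕ × ℕ) : Option (List ℕ × ℕ) :=
  D.2[r.1]?.bind fun e => (symbol r.2.1 e.1 i).bind fun x =>
    (((TData.decode e.2).2.2.2.2.getD r.2.2 []).getD x none).map fun p => (e.1, p.2)

/-- The transitions charged to the letter number `i`, if the words before and after it have the
images `x` and `y`. -/
def refs (D : MachinesData) (x i y : ℕ) : List (ℕ × ℕ × ℕ) :=
  allRefs D.skeletons (D.columns i) x y

/-- The number of elements of the monoid. -/
def monoidSize (D : MachinesData) : ℕ := autSize D.skeletons ^ autSize D.skeletons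

/-- The image of the letter number `i` in the monoid. -/
def letterImage (D : MachinesData) (i : ℕ) : ℕ :=
  encFun (autSize D.skeletons) (autSize D.skeletons)
    (letterMap (stateBound D.skeletons) D.skeletons.length (D.columns i))

/-- Computes the description of `Machines.toBimachine`, where `lab` computes the descriptions of the
labels. -/
def toBimachine (D : MachinesData) (lab : ℕ → List (ℕ × ℕ × ℕ) → ℕ) : BData :=
  (D.1, D.monoidSize,
    (List.range D.monoidSize).map (fun x => (List.range D.monoidSize).map fun y =>
      mapMul (autSize D.skeletons) x y),
    mapOne (autSize D.skeletons), (List.range D.1).map D.letterImage,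
    (List.range D.monoidSize).map fun x => (List.range D.1).map fun i =>
      (List.range D.monoidSize).map fun y => lab i (D.refs x i y))

end MachinesData

open Classical in
/-- The number of a letter in an enumeration of the alphabet. -/
noncomputable def letterNumber {A : Type u} (letters : List A) (a : A) : ℕ := letters.idxOf a

/-- The list of the numbers of the images of the letters under a substitution. -/
noncomputable def substCode {A : Type u} (letters : List A) (h : Option (A → A)) : List ℕ :=
  h.elim [] fun h => letters.map fun a => letterNumber letters (h a)

/-- The description of a list of transducers with substitutions. -/
noncomputable def Machines.data {A : Type u} {L : Type v} (letters : List A) (labelCode : L → ℕ)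
    (l : Machines A L) : MachinesData :=
  (letters.length, l.map fun e => (substCode letters e.1, e.2.code letters labelCode))

section

variable {A : Type u} {L : Type v} {L' : Type w} {letters : List A} {labelCode : L → ℕ}

theorem TwoWay.column_data (T : TwoWay A L) {i : ℕ} {t : TapeSymbol A}
    (h : (TapeSymbol.leftMark :: TapeSymbol.rightMark :: letters.map TapeSymbol.letter)[i]? =
      some t) : (T.data letters labelCode).column i = T.column t := by
  unfold TwoWay.data TData.column TwoWay.column
  rw [List.map_ofFn]
  refine congrArg List.ofFn (funext fun q => ?_)
  rw [Function.comp_apply, List.getD_eq_getElem?_getD, List.getElem?_map, h]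
  simp [Function.comp_def]

theorem TwoWay.skeleton_data (T : TwoWay A L) :
    (T.data letters labelCode).skeleton = T.skeleton := by
  unfold TData.skeleton TwoWay.skeleton
  rw [T.column_data (i := 0) rfl, T.column_data (i := 1) rfl]
  rfl

theorem Machines.skeletons_data (l : Machines A L) :
    (l.data letters labelCode).skeletons = l.skeletons := by
  unfold MachinesData.skeletons Machines.skeletons Machines.data
  rw [List.map_map]
  refine List.map_congr_left fun e _ => ?_
  simp only [Function.comp_apply, TwoWay.code_eq, TData.decode_encode, TwoWay.skeleton_data]

theorem getElem?_substCode {i : ℕ} (hi : i < letters.length) (h : Option (A → A)) :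
    (substCode letters h)[i]? = h.map fun h => letterNumber letters (h letters[i]) := by
  cases h with
  | none => rfl
  | some h => simp [substCode, hi]

theorem getElem_letterNumber (hl : ∀ a, a ∈ letters) (a : A) :
    letters[letterNumber letters a]? = some a := by
  classical
  have h := List.idxOf_lt_length_of_mem (hl a)
  exact (List.getElem?_eq_getElem h).trans (congrArg some (List.getElem_idxOf h))

theorem symbol_letterNumber (hl : ∀ a, a ∈ letters) (a : A) :
    (TapeSymbol.leftMark :: TapeSymbol.rightMark :: letters.map TapeSymbol.letter)[
      letterNumber letters a + 2]? = some (.letter a) := by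
  simp [getElem_letterNumber hl]

theorem Machines.columns_data (hl : ∀ a, a ∈ letters) (l : Machines A L) {i : ℕ}
    (hi : i < letters.length) : (l.data letters labelCode).columns i = l.columns letters[i] := by
  unfold MachinesData.columns Machines.columns Machines.data
  rw [List.map_map]
  refine List.map_congr_left fun e _ => ?_
  rw [Function.comp_apply, getElem?_substCode hi, Option.map_map]
  refine congrArg (fun f => Option.map f e.1) (funext fun h => ?_)
  rw [Function.comp_apply, TwoWay.code_eq, TData.decode_encode]
  exact e.2.column_data (symbol_letterNumber hl _)

theorem symbol_substCode (hl : ∀ a, a ∈ letters) (κ : ℕ) {i : ℕ} (hi : i < letters.length)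
    (h : Option (A → A)) :
    (MachinesData.symbol κ (substCode letters h) i).map (fun j =>
      (TapeSymbol.leftMark :: TapeSymbol.rightMark :: letters.map TapeSymbol.letter)[j]?) =
    (refSymbol κ h letters[i]).map some := by
  unfold MachinesData.symbol refSymbol
  cases decide (κ = 0) <;> [cases decide (κ = 2); skip]
  · simp only [cond_false, getElem?_substCode hi, Option.map_map]
    refine congrArg (fun f => Option.map f h) (funext fun h => ?_)
    exact symbol_letterNumber hl _
  · rfl
  · rfl

theorem TwoWay.step_data (T : TwoWay A L) {j : ℕ} {x : TapeSymbol A}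
    (h : (TapeSymbol.leftMark :: TapeSymbol.rightMark :: letters.map TapeSymbol.letter)[j]? =
      some x) (q : ℕ) {γ : Type*} (k : L → γ) (k' : ℕ → γ) (hk : ∀ y, k' (labelCode y) = k y) :
    (((T.data letters labelCode).2.2.2.2.getD q []).getD j none).map (fun p => k' p.2) =
      if hq : q < T.n then (T.step ⟨q, hq⟩ x).map fun p => k p.2 else none := by
  unfold TwoWay.data
  split_ifs with hq
  · simp only [List.getD_eq_getElem?_getD, List.getElem?_ofFn, hq, dif_pos, Option.getD_some,
      List.getElem?_map, h, Option.map_some, Option.map_map]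
    exact congrArg (fun f => Option.map f _) (funext fun p => hk _)
  · simp [List.getD_eq_getElem?_getD, hq]

theorem Machines.resolve_data (hl : ∀ a, a ∈ letters) (l : Machines A L) {i : ℕ}
    (hi : i < letters.length) (r : ℕ × ℕ × ℕ) :
    (l.data letters labelCode).resolve i r =
      (l.resolve letters[i] r).map fun p => (substCode letters p.1, labelCode p.2) := by
  unfold MachinesData.resolve Machines.resolve Machines.data
  simp only [List.getElem?_map]
  rcases l[r.1]? with _ | e
  · rfl
  simp only [Option.map_some, Option.bind_some, TwoWay.code_eq, TData.decode_encode]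
  have hs := symbol_substCode hl r.2.1 hi e.1
  rcases h1 : refSymbol r.2.1 e.1 letters[i] with _ | x <;>
    rcases h2 : MachinesData.symbol r.2.1 (substCode letters e.1) i with _ | j <;>
    rw [h1, h2] at hs
  · rfl
  · simp at hs
  · simp at hs
  · simp only [Option.map_some, Option.some.injEq] at hs
    simp only [Option.bind_some]
    refine (e.2.step_data hs r.2.2 (fun y => (substCode letters e.1, labelCode y)) _
      fun _ => rfl).trans ?_
    split_ifs <;> simp [Function.comp_def]

theorem ofFn_eq_map_range {β : Type*} {n N : ℕ} (hn : n = N) (F : Fin n → β) (G : ℕ → β)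
    (h : ∀ x, F x = G x) : List.ofFn F = (List.range N).map G := by
  subst hn
  rw [← ofFn_val]
  exact congrArg List.ofFn (funext h)

theorem Machines.code_toBimachine (hl : ∀ a, a ∈ letters) (l : Machines A L)
    (lab : A → List (ℕ × ℕ × ℕ) → L') (labelCode' : L' → ℕ)
    (labN : ℕ → List (ℕ × ℕ × ℕ) → ℕ)
    (h : ∀ i (hi : i < letters.length), ∀ x < (l.data letters labelCode).monoidSize,
      ∀ y < (l.data letters labelCode).monoidSize,
      labelCode' (lab letters[i] ((l.data letters labelCode).refs x i y)) =
        labN i ((l.data letters labelCode).refs x i y)) :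
    (l.toBimachine lab).code letters labelCode' =
      Encodable.encode ((l.data letters labelCode).toBimachine labN) := by
  have hn : (l.toBimachine lab).n = (l.data letters labelCode).monoidSize := by
    unfold MachinesData.monoidSize
    rw [Machines.skeletons_data]
    rfl
  unfold Bimachine.code
  congr 1
  refine Prod.ext rfl (Prod.ext hn (Prod.ext ?_ (Prod.ext ?_ (Prod.ext ?_ ?_))))
  · refine ofFn_eq_map_range hn _ _ fun x => ofFn_eq_map_range hn _ _ fun y => ?_
    rw [Machines.skeletons_data]
    rfl
  · change mapOne _ = mapOne _
    rw [Machines.skeletons_data]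
  · refine map_eq_map_range _ _ _ fun i hi => ?_
    unfold MachinesData.letterImage
    rw [Machines.skeletons_data, Machines.columns_data hl l hi]
    rfl
  · refine ofFn_eq_map_range hn _ _ fun x => map_eq_map_range _ _ _ fun i hi =>
      ofFn_eq_map_range hn _ _ fun y => ?_
    refine Eq.trans ?_ (h i hi x (hn ▸ x.2) y (hn ▸ y.2))
    unfold MachinesData.refs
    rw [Machines.skeletons_data, Machines.columns_data hl l hi]
    rfl

theorem Mode.mem_extLetters (mode : Mode) (hl : ∀ a, a ∈ letters) (b : mode.Ext A) :
    b ∈ mode.extLetters letters := by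
  cases mode with
  | pebble =>
    have : ∀ c : A ⊕ A, c ∈ letters.map Sum.inl ++ letters.map Sum.inr := by
      rintro (a | a) <;> simp [hl a]
    exact this b
  | blind => exact hl b
  | marble => exact hl b

/-- The list for the substitution `mode.extSubst κ h`, computed from the list `hl` for the
substitution `h` and the number of letters. -/
def Mode.extSubstData : Mode → ℕ → ℕ → List ℕ → List ℕ
  | .pebble, n, κ, hl => hl ++ hl.map fun i => bif decide (κ = 1) then n + i else i
  | .blind, _, _, hl => hl
  | .marble, _, κ, hl => bif decide (κ = 0) then [] else hl

theorem letterNumber_map {β : Type*} {f : A → β} (hf : f.Injective) (l : List A) (a : A) :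
    letterNumber (l.map f) (f a) = letterNumber l a := by
  classical
  unfold letterNumber
  induction l with
  | nil => rfl
  | cons b l ih =>
    rw [List.map_cons, List.idxOf_cons, List.idxOf_cons, ih,
      show (f b == f a) = (b == a) by rw [Bool.eq_iff_iff, beq_iff_eq, beq_iff_eq, hf.eq_iff]]

theorem letterNumber_append_left {l l' : List A} {a : A} (h : a ∈ l) :
    letterNumber (l ++ l') a = letterNumber l a := by
  classical
  exact List.idxOf_append_of_mem h

theorem letterNumber_append_right {l l' : List A} {a : A} (h : a ∉ l) :
    letterNumber (l ++ l') a = l.length + letterNumber l' a := by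
  classical
  exact List.idxOf_append_of_notMem h

theorem letterNumber_inl (hl : ∀ a, a ∈ letters) (a : A) :
    letterNumber (letters.map Sum.inl ++ letters.map Sum.inr : List (A ⊕ A)) (.inl a) =
      letterNumber letters a := by
  rw [letterNumber_append_left (List.mem_map.2 ⟨a, hl a, rfl⟩), letterNumber_map Sum.inl_injective]

theorem letterNumber_inr (a : A) :
    letterNumber (letters.map Sum.inl ++ letters.map Sum.inr : List (A ⊕ A)) (.inr a) =
      letters.length + letterNumber letters a := by
  rw [letterNumber_append_right (by simp), letterNumber_map Sum.inr_injective, List.length_map]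

theorem substCode_extSubst (mode : Mode) (hl : ∀ a, a ∈ letters) (κ : ℕ) (h : Option (A → A)) :
    substCode (mode.extLetters letters) (mode.extSubst κ h) =
      mode.extSubstData letters.length κ (substCode letters h) := by
  cases mode with
  | pebble =>
    cases h with
    | none => rfl
    | some h =>
      change (letters.map Sum.inl ++ letters.map Sum.inr : List (A ⊕ A)).map (fun b =>
        letterNumber (letters.map Sum.inl ++ letters.map Sum.inr : List (A ⊕ A))
          ((bif decide (κ = 1) then Sum.map h h else Sum.elim (Sum.inl ∘ h) (Sum.inl ∘ h)) b)) =
        letters.map (fun a => letterNumber letters (h a)) ++ (letters.map fun a =>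
          letterNumber letters (h a)).map fun i =>
            bif decide (κ = 1) then letters.length + i else i
      rw [List.map_append, List.map_map, List.map_map, List.map_map]
      congr 1
      · refine List.map_congr_left fun a _ => ?_
        cases decide (κ = 1) <;> exact letterNumber_inl hl _
      · refine List.map_congr_left fun a _ => ?_
        cases decide (κ = 1)
        · exact letterNumber_inl hl _
        · exact letterNumber_inr _
  | blind => rfl
  | marble =>
    change substCode letters (bif decide (κ = 0) then none else h) =
      bif decide (κ = 0) then [] else substCode letters h
    cases decide (κ = 0) <;> rfl

theorem substCode_id (hn : letters.Nodup) :
    substCode letters (some id) = List.range letters.length := by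
  classical
  refine List.ext_getElem (by simp [substCode]) fun i h1 h2 => ?_
  simp only [substCode, Option.elim_some, List.getElem_map, id, List.getElem_range]
  exact hn.idxOf_getElem i _

end

/-- The description of the list of transducers from which the label for the transitions `refs` is
computed. -/
def MachinesData.child (mode : Mode) (D : MachinesData) (i : ℕ) (refs : List (ℕ × ℕ × ℕ)) :
    MachinesData :=
  (mode.extCount D.1, refs.filterMap fun r => (D.resolve i r).map fun p =>
    (mode.extSubstData D.1 r.2.1 p.1, p.2))

/-- The descriptions of the lists of transducers from which all labels are computed. -/
def MachinesData.children (mode : Mode) (D : MachinesData) : List MachinesData :=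
  (List.range D.monoidSize).flatMap fun x => (List.range D.1).flatMap fun i =>
    (List.range D.monoidSize).map fun y => D.child mode i (D.refs x i y)

/-- The label at level `0`: the sum of the labels of the transitions `refs`. -/
def MachinesData.valueSum (D : MachinesData) (i : ℕ) (refs : List (ℕ × ℕ × ℕ)) : ℕ :=
  ((refs.filterMap fun r => D.resolve i r).map fun p => p.2).sum

/-- The conversion of descriptions of lists of `k`-transducers to descriptions of
`k`-bimachines. -/
def MachinesData.toBimachineCode (mode : Mode) : ℕ → MachinesData → ℕ
  | 0, D => Encodable.encode (D.toBimachine D.valueSum)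
  | k + 1, D => Encodable.encode (D.toBimachine fun i refs =>
      valueAt (D.children mode) ((D.children mode).map (toBimachineCode mode k))
        (D.child mode i refs))

theorem Machines.valueSum_data {A : Type u} {L : Type v} {letters : List A} {labelCode : L → ℕ}
    (hl : ∀ a, a ∈ letters) (l : Machines A L) {i : ℕ} (hi : i < letters.length)
    (refs : List (ℕ × ℕ × ℕ)) :
    (l.data letters labelCode).valueSum i refs =
      ((refs.filterMap (l.resolve letters[i])).map fun p => labelCode p.2).sum := by
  unfold MachinesData.valueSum
  simp only [Machines.resolve_data hl l hi]
  rw [sum_map_filterMap, sum_map_filterMap]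
  refine congrArg List.sum (List.map_congr_left fun r _ => ?_)
  rw [Option.elim_map]
  rfl

theorem MachinesData.child_mem (mode : Mode) (D : MachinesData) {x i y : ℕ}
    (hx : x < D.monoidSize) (hi : i < D.1) (hy : y < D.monoidSize) :
    D.child mode i (D.refs x i y) ∈ D.children mode :=
  List.mem_flatMap.2 ⟨x, List.mem_range.2 hx, List.mem_flatMap.2 ⟨i, List.mem_range.2 hi,
    List.mem_map.2 ⟨y, List.mem_range.2 hy, rfl⟩⟩⟩

/-- The description of a list of `k`-transducers with substitutions. -/
noncomputable def KTransducer.listData (mode : Mode) (k : ℕ) {A : Type u} (letters : List A)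
    (l : List (Option (A → A) × KTransducer mode k A)) : MachinesData :=
  (letters.length, l.map fun e => (substCode letters e.1, e.2.code mode k letters))

/-- The numerical conversion agrees with the conversion of lists of machines. -/
theorem KBimachine.code_ofList (mode : Mode) (k : ℕ) {A : Type u} {letters : List A}
    (hl : ∀ a, a ∈ letters) (l : List (Option (A → A) × KTransducer mode k A)) :
    (KBimachine.ofList mode k l).code mode k letters =
      MachinesData.toBimachineCode mode k (KTransducer.listData mode k letters l) := by
  induction k generalizing A with
  | zero =>
    refine Machines.code_toBimachine (A := A) (L := ℕ) (L' := ℕ) (labelCode := fun x => x) hl l _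
      (fun x => x) (MachinesData.valueSum _) fun i hi x _ y _ => ?_
    exact (Machines.valueSum_data (A := A) (L := ℕ) (labelCode := fun x => x) hl l hi _).symm
  | succ k ih =>
    refine Machines.code_toBimachine (A := A) (L := KTransducer mode k (mode.Ext A))
      (L' := KBimachine mode k (mode.Ext A))
      (labelCode := fun S => KTransducer.code mode k (mode.extLetters letters) S) hl l _
      (fun S => KBimachine.code mode k (mode.extLetters letters) S) _ fun i hi x hx y hy => ?_
    refine Eq.trans ?_ (valueAt_map _ (MachinesData.child_mem mode _ hx hi hy)).symm
    refine (ih (mode.mem_extLetters hl) _).trans ?_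
    congr 1
    refine Prod.ext (mode.length_extLetters letters) ?_
    unfold KTransducer.listData MachinesData.child
    rw [List.map_filterMap]
    refine congrArg (fun f => List.filterMap f _) (funext fun r => ?_)
    rw [Machines.resolve_data (A := A) (L := KTransducer mode k (mode.Ext A)) hl l hi,
      Option.map_map, Option.map_map]
    refine congrArg (fun f => Option.map f _) (funext fun p => ?_)
    exact Prod.ext (substCode_extSubst mode hl _ _) rfl

namespace Prim

variable {α : Type*} [Primcodable α]

@[fun_prop] theorem decodeTData {f : α → ℕ} (hf : Primrec f) :
    Primrec fun x => TData.decode (f x) := by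
  unfold TData.decode; fun_prop

@[fun_prop] theorem tDataColumn {d : α → TData} {i : α → ℕ} (hd : Primrec d) (hi : Primrec i) :
    Primrec fun x => (d x).column (i x) := by
  unfold TData.column TData at *; fun_prop

@[fun_prop] theorem tDataSkeleton {d : α → TData} (hd : Primrec d) :
    Primrec fun x => (d x).skeleton := by
  unfold TData.skeleton; fun_prop

variable {D : α → MachinesData} {i x y κ n : α → ℕ} {hl : α → List ℕ} {r : α → ℕ × ℕ × ℕ}

@[fun_prop] theorem machinesSkeletons (hD : Primrec D) : Primrec fun a => (D a).skeletons := by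
  unfold MachinesData.skeletons; fun_prop

@[fun_prop] theorem machinesColumns (hD : Primrec D) (hi : Primrec i) :
    Primrec fun a => (D a).columns (i a) := by
  unfold MachinesData.columns; fun_prop

@[fun_prop] theorem machinesSymbol (hκ : Primrec κ) (hh : Primrec hl) (hi : Primrec i) :
    Primrec fun a => MachinesData.symbol (κ a) (hl a) (i a) := by
  unfold MachinesData.symbol; fun_prop

@[fun_prop] theorem machinesResolve (hD : Primrec D) (hi : Primrec i) (hr : Primrec r) :
    Primrec fun a => (D a).resolve (i a) (r a) := by
  unfold MachinesData.resolve; fun_prop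

@[fun_prop] theorem machinesRefs (hD : Primrec D) (hx : Primrec x) (hi : Primrec i)
    (hy : Primrec y) : Primrec fun a => (D a).refs (x a) (i a) (y a) := by
  unfold MachinesData.refs; fun_prop

@[fun_prop] theorem monoidSize (hD : Primrec D) : Primrec fun a => (D a).monoidSize := by
  unfold MachinesData.monoidSize; fun_prop

@[fun_prop] theorem machinesLetterImage (hD : Primrec D) (hi : Primrec i) :
    Primrec fun a => (D a).letterImage (i a) := by
  unfold MachinesData.letterImage; fun_prop

@[fun_prop] theorem machinesToBimachine {lab : α → ℕ → List (ℕ × ℕ × ℕ) → ℕ} (hD : Primrec D)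
    (hlab : Primrec fun p : α × ℕ × List (ℕ × ℕ × ℕ) => lab p.1 p.2.1 p.2.2) :
    Primrec fun a => (D a).toBimachine (lab a) := by
  unfold MachinesData.toBimachine
  refine mk (by fun_prop) (mk (by fun_prop) (mk (by fun_prop) (mk (by fun_prop)
    (mk (by fun_prop) ?_))))
  refine map (by fun_prop) (map (by fun_prop) (map (by fun_prop) ?_))
  exact hlab.comp (mk (by fun_prop) (mk (by fun_prop) (by fun_prop)))

@[fun_prop] theorem extSubstData (mode : Mode) (hn : Primrec n) (hκ : Primrec κ)
    (hh : Primrec hl) : Primrec fun a => mode.extSubstData (n a) (κ a) (hl a) := by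
  cases mode <;> unfold Mode.extSubstData <;> fun_prop

@[fun_prop] theorem machinesChild (mode : Mode) {refs : α → List (ℕ × ℕ × ℕ)} (hD : Primrec D)
    (hi : Primrec i) (hr : Primrec refs) : Primrec fun a => (D a).child mode (i a) (refs a) := by
  unfold MachinesData.child; fun_prop

@[fun_prop] theorem machinesChildren (mode : Mode) (hD : Primrec D) :
    Primrec fun a => (D a).children mode := by
  unfold MachinesData.children; fun_prop

@[fun_prop] theorem machinesValueSum {refs : α → List (ℕ × ℕ × ℕ)} (hD : Primrec D)
    (hi : Primrec i) (hr : Primrec refs) : Primrec fun a => (D a).valueSum (i a) (refs a) := by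
  unfold MachinesData.valueSum; fun_prop

end Prim

theorem MachinesData.primrec_toBimachineCode (mode : Mode) :
    Primrec fun p : ℕ × MachinesData => MachinesData.toBimachineCode mode p.1 p.2 :=
  Prim.levelRec (R := MachinesData.toBimachineCode mode)
    (base := fun D => Encodable.encode (D.toBimachine D.valueSum))
    (deps := fun D => D.children mode)
    (step := fun D vals => Encodable.encode
      (D.toBimachine fun i refs => valueAt (D.children mode) vals (D.child mode i refs)))
    (by fun_prop) (by fun_prop) (by fun_prop) (fun _ => rfl) (fun _ _ => rfl)

/-- The conversion of descriptions of `k`-transducers to descriptions of `k`-bimachines. -/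
def toBimachineCode (mode : Mode) (k c : ℕ) : ℕ :=
  MachinesData.toBimachineCode mode k
    ((TData.decode c).1, [(List.range (TData.decode c).1, c)])

theorem primrec_toBimachineCode (mode : Mode) :
    Primrec fun p : ℕ × ℕ => toBimachineCode mode p.1 p.2 :=
  (MachinesData.primrec_toBimachineCode mode).comp
    (Prim.mk (by fun_prop) (Prim.mk (by fun_prop) (by fun_prop)))

theorem KTransducer.length_of_code (mode : Mode) (k : ℕ) {A : Type u} (letters : List A)
    (T : KTransducer mode k A) : (TData.decode (T.code mode k letters)).1 = letters.length := by
  cases k with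
  | zero => exact TwoWay.decode_code_fst (A := A) (L := ℕ) letters _ T
  | succ k =>
    exact TwoWay.decode_code_fst (A := A) (L := KTransducer mode k (mode.Ext A)) letters _ T

theorem KTransducer.code_toBimachine (mode : Mode) (k : ℕ) {A : Type u} {letters : List A}
    (hn : letters.Nodup) (hl : ∀ a, a ∈ letters) (T : KTransducer mode k A) :
    (T.toBimachine mode k).code mode k letters =
      toBimachineCode mode k (T.code mode k letters) := by
  refine (KBimachine.code_ofList mode k hl _).trans ?_
  unfold toBimachineCode KTransducer.listData
  rw [KTransducer.length_of_code, List.map_singleton, substCode_id hn]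

end PebbleBim

theorem proposition3p2 (mode : PebbleBim.Mode) :
    -- the two models compute the same functions
    (∀ (k : ℕ) (A : Type u) [Finite A] (f : {w : List A // w ≠ []} → ℕ),
      PebbleBim.BimachineComputable mode k f ↔ PebbleBim.TransducerComputable mode k f) ∧
    -- effective conversion from bimachines to transducers
    (∃ F : ℕ × ℕ → ℕ, Computable F ∧
      ∀ (k : ℕ) (A : Type u) (letters : List A), letters.Nodup → (∀ a, a ∈ letters) →
        ∀ B : PebbleBim.KBimachine mode k A, ∃ T : PebbleBim.KTransducer mode k A,
          F (k, B.code mode k letters) = T.code mode k letters ∧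
          ∀ w : List A, w ≠ [] → T.eval mode k w = B.eval mode k w) ∧
    -- effective conversion from transducers to bimachines
    (∃ G : ℕ × ℕ → ℕ, Computable G ∧
      ∀ (k : ℕ) (A : Type u) (letters : List A), letters.Nodup → (∀ a, a ∈ letters) →
        ∀ T : PebbleBim.KTransducer mode k A, ∃ B : PebbleBim.KBimachine mode k A,
          G (k, T.code mode k letters) = B.code mode k letters ∧
          ∀ w : List A, w ≠ [] → B.eval mode k w = T.eval mode k w) := by
  refine ⟨fun k A _ f => ⟨?_, ?_⟩, ⟨fun p => PebbleBim.toTransducerCode mode p.1 p.2,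
    (PebbleBim.primrec_toTransducerCode mode).to_comp, fun k A letters _ _ B => ?_⟩,
    ⟨fun p => PebbleBim.toBimachineCode mode p.1 p.2, ?_, fun k A letters hn hl T => ?_⟩⟩
  · rintro ⟨B, hB⟩
    exact ⟨B.toTransducer mode k, fun w => (B.eval_toTransducer mode k w.1 w.2).trans (hB w)⟩
  · rintro ⟨T, hT⟩
    exact ⟨T.toBimachine mode k, fun w => (T.eval_toBimachine mode k w.2).trans (hT w)⟩
  · exact ⟨B.toTransducer mode k, (B.code_toTransducer mode k letters).symm,
      fun w hw => B.eval_toTransducer mode k w hw⟩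
  · exact (PebbleBim.primrec_toBimachineCode mode).to_comp
  · exact ⟨T.toBimachine mode k, (T.code_toBimachine mode k hn hl).symm,
      fun w hw => T.eval_toBimachine mode k hw⟩
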